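/- Let $M$ be a real-analytic three-dimensional manifold with a real-analytic co-oriented contact sub-Riemannian structure $(\mathcal D,g)$: $\mathcal D=\ker\omega$ for an analytic contact form $\omega$ (so $d\omega|_{\mathcal D}$ is non-degenerate), $g$ is an analytic metric on $\mathcal D$, and $\omega$ is normalized so that $|d\omega(f_1,f_2)|=1$ for every $g$-orthonormal basis $f_1,f_2$ of $\mathcal D_q$, $q\in M$. Let $f_0$ be the Reeb vector field, i.e. $\omega(f_0)=1$ and $d\omega(f_0,\cdot)=0$, and for $\varepsilon>0$ let $g^\varepsilon$ be the Riemannian metric on $M$ with $g^\varepsilon|_{\mathcal D}=g$, $g^\varepsilon(\mathcal D,f_0)=0$ and $g^\varepsilon(f_0,f_0)=1/\varepsilon$. Orient $M$ by $\omega\wedge d\omega$. Let $S\subset M$ be an oriented, analytically embedded surface, let $\Sigma(S)=\{p\in S: T_pS=\mathcal D_p\}$ be its set of characteristic points, and let $\sigma$ be a smooth measure on $S$ (a measure with smooth positive density with respect to Lebesgue measure in every chart). Let $H^\varepsilon$ be the mean curvature (the sum of the principal curvatures) of $S$ in $(M,g^\varepsilon)$ with respect to the unit normal determined by the orientations. If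 every point of $\Sigma(S)$ is isolated in $\Sigma(S)$, then the sub-Riemannian mean curvature $$\mathcal H(p)=\lim_{\varepsilon\to0^+}H^\varepsilon(p)$$ exists as a finite limit at every $p\in S\setminus\Sigma(S)$, and $\mathcal H$ (extended by $0$ to the $\sigma$-null set $\Sigma(S)$) is locally integrable: $\mathcal H\in L^1_{loc}(S,\sigma)$. -/

import Mathlib

open Set Filter Topology MeasureTheory Bundle
open scoped Manifold ContDiff

noncomputable section

namespace SubRiem

/-! ## Coordinate vectors and the exterior derivative of a one-form -/

/-- The tangent vector of the `n`-manifold `X`, based at the point with coordinates `x` in the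
preferred chart at `c`, whose components in that chart are `v`. -/
def coordVec {n : ℕ} {X : Type*} [TopologicalSpace X] [ChartedSpace (EuclideanSpace ℝ (Fin n)) X]
    (c : X) (x v : EuclideanSpace ℝ (Fin n)) :
    TangentSpace (𝓡 n) ((extChartAt (𝓡 n) c).symm x) :=
  mfderiv 𝓘(ℝ, EuclideanSpace ℝ (Fin n)) (𝓡 n) (extChartAt (𝓡 n) c).symm x v

/-- The components of a tangent vector at `q` in the preferred chart at `q`. -/
def coords {n : ℕ} {X : Type*} [TopologicalSpace X] [ChartedSpace (EuclideanSpace ℝ (Fin n)) X]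
    {q : X} (u : TangentSpace (𝓡 n) q) : EuclideanSpace ℝ (Fin n) :=
  mfderiv (𝓡 n) 𝓘(ℝ, EuclideanSpace ℝ (Fin n)) (extChartAt (𝓡 n) q) q u

/-- The exterior derivative `(dα)_q(u, v) = ∑ i j, (∂ᵢ αⱼ - ∂ⱼ αᵢ) uⁱ vʲ` of a one-form `α`,
computed in the preferred chart at `q`; the convention is
`dα(U, V) = U(α(V)) - V(α(U)) - α([U, V])`. -/
def extDerivForm {n : ℕ} {X : Type*} [TopologicalSpace X]
    [ChartedSpace (EuclideanSpace ℝ (Fin n)) X]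
    (α : ∀ q : X, TangentSpace (𝓡 n) q →L[ℝ] ℝ) (q : X) (u v : TangentSpace (𝓡 n) q) : ℝ :=
  fderiv ℝ (fun x ↦ α ((extChartAt (𝓡 n) q).symm x) (coordVec q x (coords v)))
      (extChartAt (𝓡 n) q q) (coords u)
    - fderiv ℝ (fun x ↦ α ((extChartAt (𝓡 n) q).symm x) (coordVec q x (coords u)))
      (extChartAt (𝓡 n) q q) (coords v)

/-! ## Analytic contact sub-Riemannian structures -/

/-- An analytic co-oriented contact sub-Riemannian structure `(D, g)` on a 3-manifold, recorded
through its normalized contact form `form`, with `D = ker form`.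

The sub-Riemannian metric is the restriction of `metric q` to `D q = ker (form q)`, an inner
product depending analytically on `q`. Only this restriction is used below; the values of
`metric q` outside `D q` are auxiliary, and every analytic metric on `D` is such a restriction
(extend it by zero on a complementary analytic line field). -/
structure AnalyticContactStructure (M : Type*) [TopologicalSpace M]
    [ChartedSpace (EuclideanSpace ℝ (Fin 3)) M] [IsManifold (𝓡 3) ω M] where
  /-- the contact form -/
  form : ∀ q : M, TangentSpace (𝓡 3) q →L[ℝ] ℝ
  form_analytic : ContMDiff (𝓡 3) ((𝓡 3).prod 𝓘(ℝ, EuclideanSpace ℝ (Fin 3) →L[ℝ] ℝ)) ω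
    (fun q ↦ TotalSpace.mk' (EuclideanSpace ℝ (Fin 3) →L[ℝ] ℝ)
      (E := fun q : M ↦ TangentSpace (𝓡 3) q →L[ℝ] Trivial M ℝ q) q (form q))
  form_ne_zero : ∀ q, form q ≠ 0
  /-- the contact condition: `d form` is non-degenerate on `D` -/
  contact : ∀ q (u : TangentSpace (𝓡 3) q), form q u = 0 →
    (∀ v, form q v = 0 → extDerivForm form q u v = 0) → u = 0
  /-- a bilinear form whose restriction to `D` is the sub-Riemannian metric -/
  metric : ∀ q : M, TangentSpace (𝓡 3) q →L[ℝ] TangentSpace (𝓡 3) q →L[ℝ] ℝ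
  metric_analytic : ContMDiff (𝓡 3)
    ((𝓡 3).prod 𝓘(ℝ, EuclideanSpace ℝ (Fin 3) →L[ℝ] EuclideanSpace ℝ (Fin 3) →L[ℝ] ℝ)) ω
    (fun q ↦ TotalSpace.mk'
      (EuclideanSpace ℝ (Fin 3) →L[ℝ] EuclideanSpace ℝ (Fin 3) →L[ℝ] ℝ)
      (E := fun q : M ↦ TangentSpace (𝓡 3) q →L[ℝ] TangentSpace (𝓡 3) q →L[ℝ] Trivial M ℝ q)
      q (metric q))
  metric_symm : ∀ q (u v : TangentSpace (𝓡 3) q), metric q u v = metric q v u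
  metric_pos : ∀ q (u : TangentSpace (𝓡 3) q), form q u = 0 → u ≠ 0 → 0 < metric q u u
  /-- the normalization: on `D`, the two-form `d form` is an area form of the metric, that is
  `|d form (u, v)|` is the `g`-area of the parallelogram spanned by `u` and `v` -/
  normalized : ∀ q (u v : TangentSpace (𝓡 3) q), form q u = 0 → form q v = 0 →
    extDerivForm form q u v ^ 2 = metric q u u * metric q v v - metric q u v ^ 2

section Structure

variable {M : Type*} [TopologicalSpace M] [ChartedSpace (EuclideanSpace ℝ (Fin 3)) M]
  [IsManifold (𝓡 3) ω M] (K : AnalyticContactStructure M)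

/-- The contact distribution. -/
def AnalyticContactStructure.distribution (q : M) : Submodule ℝ (TangentSpace (𝓡 3) q) :=
  LinearMap.ker (K.form q).toLinearMap

/-- The Reeb vector field: the unique vector `f₀` with `form f₀ = 1` and `d form (f₀, ·) = 0`. -/
def AnalyticContactStructure.reeb (q : M) : TangentSpace (𝓡 3) q :=
  Classical.epsilon fun v : TangentSpace (𝓡 3) q ↦
    K.form q v = 1 ∧ ∀ u, extDerivForm K.form q v u = 0

/-- The horizontal part of a vector, along the splitting `D ⊕ ℝ f₀`. -/
def AnalyticContactStructure.horiz (q : M) (u : TangentSpace (𝓡 3) q) : TangentSpace (𝓡 3) q :=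
  u - K.form q u • K.reeb q

/-- The Riemannian approximation `g^ε`: equal to `g` on `D`, with the Reeb field `f₀` orthogonal
to `D` and `g^ε(f₀, f₀) = 1 / ε`. -/
def AnalyticContactStructure.approx (ε : ℝ) (q : M) (u v : TangentSpace (𝓡 3) q) : ℝ :=
  K.metric q (K.horiz q u) (K.horiz q v) + ε⁻¹ * (K.form q u * K.form q v)

/-- The orientation three-form `form ∧ d form`. -/
def AnalyticContactStructure.orientForm (q : M) (u v w : TangentSpace (𝓡 3) q) : ℝ :=
  K.form q u * extDerivForm K.form q v w + K.form q v * extDerivForm K.form q w u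
    + K.form q w * extDerivForm K.form q u v

/-- The metric `g^ε` in the preferred chart at `c`: its value at the point with coordinates `x` on
the vectors with components `a`, `b`. -/
def AnalyticContactStructure.approxCoord (ε : ℝ) (c : M)
    (x a b : EuclideanSpace ℝ (Fin 3)) : ℝ :=
  K.approx ε ((extChartAt (𝓡 3) c).symm x) (coordVec c x a) (coordVec c x b)

end Structure

/-! ## Mean curvature of a parametrized surface -/

section Euclidean

/-- The second fundamental form `II(u, v) = G(∇_u ∂_v f, ν)` at `f x` of the surface parametrized
by `f`, with respect to a normal vector `ν` and the Levi-Civita connection `∇` of the metric `G`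
on (an open subset of) `ℝ³`; the last three terms are the Christoffel symbols of the first kind.
Here `G y a b` is the value of the metric at `y` on the vectors `a`, `b`. -/
def secondForm (G : EuclideanSpace ℝ (Fin 3) → EuclideanSpace ℝ (Fin 3) →
      EuclideanSpace ℝ (Fin 3) → ℝ)
    (f : EuclideanSpace ℝ (Fin 2) → EuclideanSpace ℝ (Fin 3)) (x : EuclideanSpace ℝ (Fin 2))
    (ν : EuclideanSpace ℝ (Fin 3)) (u v : EuclideanSpace ℝ (Fin 2)) : ℝ :=
  G (f x) (fderiv ℝ (fun z ↦ fderiv ℝ f z v) x u) ν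
    + (fderiv ℝ (fun y ↦ G y (fderiv ℝ f x v) ν) (f x) (fderiv ℝ f x u)
      + fderiv ℝ (fun y ↦ G y (fderiv ℝ f x u) ν) (f x) (fderiv ℝ f x v)
      - fderiv ℝ (fun y ↦ G y (fderiv ℝ f x u) (fderiv ℝ f x v)) (f x) ν) / 2

/-- The first fundamental form of the surface parametrized by `f`. -/
def firstForm (G : EuclideanSpace ℝ (Fin 3) → EuclideanSpace ℝ (Fin 3) →
      EuclideanSpace ℝ (Fin 3) → ℝ)
    (f : EuclideanSpace ℝ (Fin 2) → EuclideanSpace ℝ (Fin 3)) (x : EuclideanSpace ℝ (Fin 2))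
    (u v : EuclideanSpace ℝ (Fin 2)) : ℝ :=
  G (f x) (fderiv ℝ f x u) (fderiv ℝ f x v)

/-- The mean curvature (sum of the principal curvatures) of the surface parametrized by `f`, with
respect to the unit normal `ν`: the trace of the second fundamental form with respect to the first,
`(E N - 2 F M + G L) / (E G - F²)` in the notation of Gauss. -/
def meanCurvatureParam (G : EuclideanSpace ℝ (Fin 3) → EuclideanSpace ℝ (Fin 3) →
      EuclideanSpace ℝ (Fin 3) → ℝ)
    (f : EuclideanSpace ℝ (Fin 2) → EuclideanSpace ℝ (Fin 3)) (x : EuclideanSpace ℝ (Fin 2))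
    (ν : EuclideanSpace ℝ (Fin 3)) : ℝ :=
  let e : Fin 2 → EuclideanSpace ℝ (Fin 2) := fun i ↦ EuclideanSpace.single i 1
  (firstForm G f x (e 0) (e 0) * secondForm G f x ν (e 1) (e 1)
      - 2 * firstForm G f x (e 0) (e 1) * secondForm G f x ν (e 0) (e 1)
      + firstForm G f x (e 1) (e 1) * secondForm G f x ν (e 0) (e 0))
    / (firstForm G f x (e 0) (e 0) * firstForm G f x (e 1) (e 1)
      - firstForm G f x (e 0) (e 1) ^ 2)

end Euclidean

/-! ## Oriented surfaces -/

/-- An orientation of a surface, given by a smooth nowhere vanishing two-form (an area form). -/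
structure AreaForm (S : Type*) [TopologicalSpace S] [ChartedSpace (EuclideanSpace ℝ (Fin 2)) S]
    [IsManifold (𝓡 2) ω S] where
  /-- the two-form -/
  form : ∀ p : S, TangentSpace (𝓡 2) p →L[ℝ] TangentSpace (𝓡 2) p →L[ℝ] ℝ
  form_smooth : ContMDiff (𝓡 2)
    ((𝓡 2).prod 𝓘(ℝ, EuclideanSpace ℝ (Fin 2) →L[ℝ] EuclideanSpace ℝ (Fin 2) →L[ℝ] ℝ)) ∞
    (fun p ↦ TotalSpace.mk'
      (EuclideanSpace ℝ (Fin 2) →L[ℝ] EuclideanSpace ℝ (Fin 2) →L[ℝ] ℝ)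
      (E := fun p : S ↦ TangentSpace (𝓡 2) p →L[ℝ] TangentSpace (𝓡 2) p →L[ℝ] Trivial S ℝ p)
      p (form p))
  form_self : ∀ p (u : TangentSpace (𝓡 2) p), form p u u = 0
  form_ne_zero : ∀ p, form p ≠ 0

section Surface

variable {M : Type*} [TopologicalSpace M] [ChartedSpace (EuclideanSpace ℝ (Fin 3)) M]
  [IsManifold (𝓡 3) ω M] (K : AnalyticContactStructure M)
  {S : Type*} [TopologicalSpace S] [ChartedSpace (EuclideanSpace ℝ (Fin 2)) S]
  [IsManifold (𝓡 2) ω S]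

/-- The characteristic set of the surface `ι : S → M`: the points at which the tangent plane of the
surface is the contact plane. -/
def charSet (ι : S → M) : Set S :=
  {p | LinearMap.range (mfderiv (𝓡 2) (𝓡 3) ι p).toLinearMap = K.distribution (ι p)}

/-- `ν` is the unit normal at `p` of the oriented surface `ι : S → M` in the Riemannian manifold
`(M, g^ε)`, where `M` is oriented by `form ∧ d form`. -/
def IsUnitNormal (ι : S → M) (A : AreaForm S) (ε : ℝ) (p : S)
    (ν : TangentSpace (𝓡 3) (ι p)) : Prop :=
  (∀ u : TangentSpace (𝓡 2) p, K.approx ε (ι p) ν (mfderiv (𝓡 2) (𝓡 3) ι p u) = 0) ∧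
  K.approx ε (ι p) ν ν = 1 ∧
  ∀ u v : TangentSpace (𝓡 2) p, 0 < A.form p u v →
    0 < K.orientForm (ι p) ν (mfderiv (𝓡 2) (𝓡 3) ι p u) (mfderiv (𝓡 2) (𝓡 3) ι p v)

/-- The unit normal of the oriented surface in `(M, g^ε)`. -/
def unitNormal (ι : S → M) (A : AreaForm S) (ε : ℝ) (p : S) : TangentSpace (𝓡 3) (ι p) :=
  Classical.epsilon (IsUnitNormal K ι A ε p)

/-- The mean curvature at `p` of the oriented surface `ι : S → M` in the Riemannian manifold
`(M, g^ε)`, computed in the preferred charts of `S` at `p` and of `M` at `ι p`. -/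
def meanCurvature (ι : S → M) (A : AreaForm S) (ε : ℝ) (p : S) : ℝ :=
  meanCurvatureParam (K.approxCoord ε (ι p))
    (extChartAt (𝓡 3) (ι p) ∘ ι ∘ (extChartAt (𝓡 2) p).symm) (extChartAt (𝓡 2) p p)
    (coords (unitNormal K ι A ε p))

open Classical in
/-- The sub-Riemannian mean curvature of the oriented surface `ι : S → M`: the limit, as `ε → 0⁺`,
of the mean curvatures in `(M, g^ε)`, at the points that are not characteristic. It is not
defined at the characteristic points, and `0` stands for its value there. -/
def srMeanCurvature (ι : S → M) (A : AreaForm S) (p : S) : ℝ :=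
  if p ∈ charSet K ι then 0
  else limUnder (𝓝[>] (0 : ℝ)) (fun ε ↦ meanCurvature K ι A ε p)

end Surface

/-- A smooth measure on a surface: in every chart of the atlas it has a smooth positive density
with respect to Lebesgue measure. -/
def IsSmoothMeasure {S : Type*} [TopologicalSpace S] [ChartedSpace (EuclideanSpace ℝ (Fin 2)) S]
    [MeasurableSpace S] (σ : Measure S) : Prop :=
  ∀ e ∈ atlas (EuclideanSpace ℝ (Fin 2)) S, ∃ ρ : EuclideanSpace ℝ (Fin 2) → ℝ,
    ContDiffOn ℝ ∞ ρ e.target ∧ (∀ x ∈ e.target, 0 < ρ x) ∧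
    (σ.restrict e.source).map e
      = (volume.restrict e.target).withDensity (fun x ↦ ENNReal.ofReal (ρ x))

end SubRiem

end

set_option maxSynthPendingDepth 3
set_option linter.unusedSectionVars false

namespace SubRiem

section Integrability

open scoped ENNReal NNReal

/-! ## Local integrability of the inverse of an analytic map with an isolated zero -/

/-! Existence of the limit is an algebraic cancellation. Let `p₀`, `p₁` be the coordinate tangent
vectors of a parametrization, `w` the contact form, `d` its exterior derivative, `R` the Reeb vector
and `h` the metric of the contact plane extended by zero along `R`. Put `P = w p₀` and `Q = w p₁`;
the characteristic points are the common zeros of `P` and `Q`. The vector `z = Q p₀ - P p₁` is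
tangent and horizontal. With `J` the quarter turn of the contact plane and `κ = d p₀ p₁`, the vector
`J z - ε κ R` is normal to the surface for `g^ε = h + ε⁻¹ w ⊗ w`, with squared norm `h z z + ε κ²`
(`isUnitNormalLin_iff`). Against this normal, the only part of the second fundamental form of order
`ε⁻¹` is the symmetrized product of `w` and `h z ·`. Since `z` is horizontal, `h z ·` is the
`g^ε`-dual of `z`, so the trace of this part is proportional to `w z = 0`. What remains is
continuous at `ε = 0` when `h z z ≠ 0`, and the limit is, up to sign, `(P² b₁₁ - 2 P Q b₀₁ + Q² b₀₀)
/ (h z z)^(3/2)` with continuous `bᵢⱼ` (`meanCurvatureLin_dilated`,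
`tendsto_meanCurvatureLin_dilated`).

Integrability: `h z z ≥ C (P² + Q²)` (`exists_le_charField`), so the limit is bounded by a constant
times `1 / (|P| + |Q|)`. At a characteristic point `∂₀Q - ∂₁P = κ ≠ 0` by the contact condition
(`fderiv_form_ne`), so up to exchanging roles `∂₁P ≠ 0` and the zero set of `P` is an analytic graph
`x₁ = g x₀`. The restriction of `Q` to it is an analytic function of one variable, not identically
zero because the characteristic point is isolated, hence vanishing to a finite order `k`. Thus `|P|
+ |Q|` dominates both `|x₁ - g x₀|` and `|x₀|^k` (origin at the point), and by interpolation their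
product `|x₀|^s |x₁ - g x₀|^s` with `s = k / (k + 1) < 1`, whose inverse is integrable
(`exists_lintegral_inv_abs_add_abs_lt_top`).

The mean curvature at `p` is defined in the charts preferred at `p`, so its invariance under changes
of charts (`meanCurvatureParam_transition`) is needed to express it near `p₀` by one formula in the
charts at `p₀`. -/

theorem lintegral_rpow_neg_Icc_lt_top {s : ℝ} (hs : s < 1) :
    ∫⁻ x in Icc (-1 : ℝ) 1, ENNReal.ofReal |x| ^ (-s) < ⊤ := by
  have h1 : ∫⁻ x in Ioc (0 : ℝ) 1, ENNReal.ofReal |x| ^ (-s) < ⊤ := by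
    have h : IntegrableOn (fun x : ℝ ↦ x ^ (-s)) (Ioc 0 1) :=
      (intervalIntegrable_iff_integrableOn_Ioc_of_le zero_le_one).1
        (intervalIntegral.intervalIntegrable_rpow' (by linarith))
    refine lt_of_le_of_lt (le_of_eq ?_) h.lintegral_lt_top
    refine setLIntegral_congr_fun measurableSet_Ioc fun x hx ↦ ?_
    rw [abs_of_pos hx.1, ENNReal.ofReal_rpow_of_pos hx.1]
  have h2 : ∫⁻ x in Ico (-1 : ℝ) 0, ENNReal.ofReal |x| ^ (-s) < ⊤ := by
    have := (Measure.measurePreserving_neg (volume : Measure ℝ)).setLIntegral_comp_preimage_emb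
      (MeasurableEquiv.neg ℝ).measurableEmbedding (fun x ↦ ENNReal.ofReal |x| ^ (-s)) (Ioc 0 1)
    simp only [abs_neg] at this
    rw [show (Neg.neg ⁻¹' Ioc (0 : ℝ) 1) = Ico (-1) 0 by simp] at this
    rwa [this]
  have h3 : Icc (-1 : ℝ) 1 = Ico (-1) 0 ∪ {0} ∪ Ioc 0 1 := by
    ext x
    simp only [mem_Icc, mem_union, mem_Ico, mem_singleton_iff, mem_Ioc]
    constructor
    · intro h; rcases lt_trichotomy x 0 with h' | h' | h'
      · exact Or.inl (Or.inl ⟨h.1, h'⟩)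
      · exact Or.inl (Or.inr h')
      · exact Or.inr ⟨h', h.2⟩
    · rintro ((h | h) | h)
      · exact ⟨h.1, by linarith [h.2]⟩
      · subst h; norm_num
      · exact ⟨by linarith [h.1], h.2⟩
  rw [h3]
  refine lt_of_le_of_lt (lintegral_union_le _ _ _) (ENNReal.add_lt_top.2 ⟨?_, h1⟩)
  refine lt_of_le_of_lt (lintegral_union_le _ _ _) (ENNReal.add_lt_top.2 ⟨h2, ?_⟩)
  simp

/-- Only points within distance 1 of `a` see the singularity; elsewhere the integrand is at most 1.
Uniformity in `a` matters because the centre will lie on a curve and move with the other variable.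
-/
theorem exists_lintegral_rpow_neg_sub_le {s : ℝ} (h0 : 0 ≤ s) (hs : s < 1) {J : Set ℝ}
    (hJ : volume J < ⊤) :
    ∃ C : ENNReal, C < ⊤ ∧ ∀ a : ℝ, ∫⁻ x in J, ENNReal.ofReal |x - a| ^ (-s) ≤ C := by
  refine ⟨(∫⁻ x in Icc (-1 : ℝ) 1, ENNReal.ofReal |x| ^ (-s)) + volume J,
    ENNReal.add_lt_top.2 ⟨lintegral_rpow_neg_Icc_lt_top hs, hJ⟩, fun a ↦ ?_⟩
  have hle : ∀ x : ℝ, ENNReal.ofReal |x - a| ^ (-s) ≤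
      (Icc (-1 : ℝ) 1).indicator (fun x ↦ ENNReal.ofReal |x| ^ (-s)) (x - a) + 1 := by
    intro x
    by_cases hx : x - a ∈ Icc (-1 : ℝ) 1
    · rw [indicator_of_mem hx]; exact le_self_add
    · refine le_add_left ?_
      have h1 : (1 : ENNReal) ≤ ENNReal.ofReal |x - a| := by
        rw [ENNReal.one_le_ofReal]
        by_contra! h
        exact hx (abs_le.1 h.le)
      rw [ENNReal.rpow_neg, ENNReal.inv_le_one]
      rcases h0.eq_or_lt with rfl | h0
      · simp
      · exact ENNReal.one_le_rpow h1 h0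
  calc ∫⁻ x in J, ENNReal.ofReal |x - a| ^ (-s)
      ≤ ∫⁻ x in J, ((Icc (-1 : ℝ) 1).indicator (fun x ↦ ENNReal.ofReal |x| ^ (-s)) (x - a) + 1) :=
        lintegral_mono hle
    _ = (∫⁻ x in J, (Icc (-1 : ℝ) 1).indicator (fun x ↦ ENNReal.ofReal |x| ^ (-s)) (x - a))
        + volume J := by
        rw [lintegral_add_right _ measurable_const]; simp
    _ ≤ (∫⁻ x, (Icc (-1 : ℝ) 1).indicator (fun x ↦ ENNReal.ofReal |x| ^ (-s)) (x - a))
        + volume J := by gcongr; exact Measure.restrict_le_self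
    _ = _ := by
        rw [lintegral_sub_right_eq_self
          (fun x ↦ (Icc (-1 : ℝ) 1).indicator (fun x ↦ ENNReal.ofReal |x| ^ (-s)) x) a,
          lintegral_indicator measurableSet_Icc]

/-- The invertible linear map `(s, t) ↦ (s, L (s, t))`, where `L (0, 1) ≠ 0`. -/
noncomputable def shearEquiv (L : ℝ × ℝ →L[ℝ] ℝ) (hL : L (0, 1) ≠ 0) : (ℝ × ℝ) ≃L[ℝ] (ℝ × ℝ) :=
  ContinuousLinearEquiv.equivOfInverse
    ((ContinuousLinearMap.fst ℝ ℝ ℝ).prod L)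
    ((ContinuousLinearMap.fst ℝ ℝ ℝ).prod
      ((L (0, 1))⁻¹ • (ContinuousLinearMap.snd ℝ ℝ ℝ - L (1, 0) • ContinuousLinearMap.fst ℝ ℝ ℝ)))
    (by
      intro z
      have h : L z = z.1 * L (1, 0) + z.2 * L (0, 1) := by
        conv_lhs => rw [show z = z.1 • ((1 : ℝ), (0 : ℝ)) + z.2 • ((0 : ℝ), (1 : ℝ)) by simp]
        rw [map_add, map_smul, map_smul]; simp
      ext
      · simp
      · simp only [ContinuousLinearMap.prod_apply, ContinuousLinearMap.coe_fst',
          FunLike.coe_smul, FunLike.coe_sub, Pi.smul_apply, Pi.sub_apply,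
          ContinuousLinearMap.coe_snd', smul_eq_mul, h]
        field_simp
        ring)
    (by
      intro z
      have h : ∀ z, L z = z.1 * L (1, 0) + z.2 * L (0, 1) := by
        intro z
        conv_lhs => rw [show z = z.1 • ((1 : ℝ), (0 : ℝ)) + z.2 • ((0 : ℝ), (1 : ℝ)) by simp]
        rw [map_add, map_smul, map_smul]; simp
      ext
      · simp
      · simp only [ContinuousLinearMap.prod_apply, ContinuousLinearMap.coe_fst',
          FunLike.coe_smul, FunLike.coe_sub, Pi.smul_apply, Pi.sub_apply,
          ContinuousLinearMap.coe_snd', smul_eq_mul]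
        rw [h]
        field_simp
        ring)

/-- If `P`, `Q` are analytic functions of two variables with an isolated common zero (or none) at
`z₀` and `∂₂P ≠ 0`, `P = 0` at `z₀`, then `|P| + |Q|` is bounded below by the distance to an
analytic graph and by a power of the distance to a line. -/
theorem eventually_le_abs_add_abs {P Q : ℝ × ℝ → ℝ} {z₀ : ℝ × ℝ} (hP : ContDiffAt ℝ ω P z₀)
    (hQ : ContDiffAt ℝ ω Q z₀) (hP0 : P z₀ = 0) (hd : fderiv ℝ P z₀ (0, 1) ≠ 0)
    (hiso : ∀ᶠ z in 𝓝[≠] z₀, ¬(P z = 0 ∧ Q z = 0)) :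
    ∃ c > 0, ∃ (g : ℝ → ℝ) (k : ℕ), ∀ᶠ z in 𝓝 z₀,
      c * |z.2 - g z.1| ≤ |P z| + |Q z| ∧ c * |z.1 - z₀.1| ^ k ≤ |P z| + |Q z| := by
  -- `Φ` straightens the zero set of `P`; below, `r y = Ψ (y, 0)` parametrizes that zero set as a
  -- graph over the first coordinate.
  set Φ : ℝ × ℝ → ℝ × ℝ := fun z ↦ (z.1, P z) with hΦ
  have hΦc : ContDiffAt ℝ ω Φ z₀ := contDiffAt_fst.prodMk hP
  have hω : (ω : WithTop ℕ∞) ≠ 0 := by simp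
  have hΦd : HasFDerivAt Φ (shearEquiv (fderiv ℝ P z₀) hd : ℝ × ℝ →L[ℝ] ℝ × ℝ) z₀ :=
    hasFDerivAt_fst.prodMk (hP.differentiableAt hω).hasFDerivAt
  have hst := hΦc.hasStrictFDerivAt' hΦd hω
  set Ψ : ℝ × ℝ → ℝ × ℝ := hΦc.localInverse hΦd hω with hΨ
  have hΨc : ContDiffAt ℝ ω Ψ (Φ z₀) := hΦc.to_localInverse hΦd hω
  have hleft : ∀ᶠ z in 𝓝 z₀, Ψ (Φ z) = z := hst.eventually_left_inverse
  have hright : ∀ᶠ w in 𝓝 (Φ z₀), Φ (Ψ w) = w := hst.eventually_right_inverse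
  have hΨ0 : Ψ (Φ z₀) = z₀ := hleft.self_of_nhds
  have hΦ0 : Φ z₀ = (z₀.1, 0) := by simp [hΦ, hP0]
  set r : ℝ → ℝ × ℝ := fun y ↦ Ψ (y, 0) with hr
  have hemb : ContDiffAt ℝ ω (fun y : ℝ ↦ (y, (0 : ℝ))) z₀.1 := contDiffAt_id.prodMk contDiffAt_const
  have hrc : ContDiffAt ℝ ω r z₀.1 := by
    refine ContDiffAt.comp z₀.1 (g := Ψ) ?_ hemb
    rw [← hΦ0]; exact hΨc
  have hr0 : r z₀.1 = z₀ := by rw [hr]; simp only; rw [← hΦ0, hΨ0]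
  have hq : AnalyticAt ℝ (fun y ↦ Q (r y)) z₀.1 := by
    refine ContDiffAt.analyticAt (ContDiffAt.comp z₀.1 (g := Q) ?_ hrc)
    rw [hr0]; exact hQ
  have hrΦ : ∀ᶠ y in 𝓝 z₀.1, Φ (r y) = (y, 0) := by
    have : Tendsto (fun y : ℝ ↦ (y, (0 : ℝ))) (𝓝 z₀.1) (𝓝 (Φ z₀)) := by
      rw [hΦ0]; exact hemb.continuousAt
    exact this.eventually hright
  have hrt : Tendsto r (𝓝 z₀.1) (𝓝 z₀) := by
    have := hrc.continuousAt.tendsto; rwa [hr0] at this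
  -- Otherwise the curve would consist of common zeros of `P` and `Q` accumulating at `z₀`.
  have hne : ¬∀ᶠ y in 𝓝 z₀.1, Q (r y) = 0 := by
    intro h
    have h1 : ∀ᶠ y in 𝓝 z₀.1, r y ≠ z₀ → ¬(P (r y) = 0 ∧ Q (r y) = 0) :=
      hrt.eventually (eventually_nhdsWithin_iff.1 hiso)
    have h2 : ∀ᶠ y in 𝓝 z₀.1, y = z₀.1 := by
      filter_upwards [h, h1, hrΦ] with y hy hy1 hy2
      have e1 : (r y).1 = y := congrArg Prod.fst hy2
      have e2 : P (r y) = 0 := congrArg Prod.snd hy2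
      by_contra hne
      exact hy1 (fun h ↦ hne (by rw [← e1, h])) ⟨e2, hy⟩
    have h3 : ∃ᶠ y in 𝓝[≠] z₀.1, True := Filter.frequently_true_iff_neBot _ |>.2 inferInstance
    refine (h3.and_eventually (eventually_nhdsWithin_iff.2 (h2.mono fun y hy hy' ↦ hy' hy))).exists.elim
      fun y hy ↦ hy.2
  -- By analyticity, `Q` has a finite order of vanishing `k` along the curve; `k = 0` if `Q z₀ ≠ 0`.
  obtain ⟨k, u, hu, hu0, hquk⟩ := hq.exists_eventuallyEq_pow_smul_nonzero_iff.2 hne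
  obtain ⟨L, t, ht, hL⟩ := (hΨc.of_le (by simp)).exists_lipschitzOnWith (𝕂 := ℝ)
  obtain ⟨B, t', ht', hB⟩ := (hQ.of_le (by simp)).exists_lipschitzOnWith (𝕂 := ℝ)
  have hulow : ∀ᶠ y in 𝓝 z₀.1, |u z₀.1| / 2 < |u y| :=
    hu.continuousAt.abs.eventually_const_lt (by have := abs_pos.2 hu0; linarith)
  have hfst : Tendsto (Prod.fst : ℝ × ℝ → ℝ) (𝓝 z₀) (𝓝 z₀.1) := continuousAt_fst
  -- Since `z = Ψ (z.1, P z)` and `r z.1 = Ψ (z.1, 0)`, the Lipschitz constant of `Ψ` bounds the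
  -- distance to the curve by `|P z|`.
  have hdist : ∀ᶠ z in 𝓝 z₀, dist z (r z.1) ≤ L * |P z| := by
    have e1 : ∀ᶠ z in 𝓝 z₀, Φ z ∈ t := hΦc.continuousAt.eventually ht
    have e2 : ∀ᶠ z in 𝓝 z₀, (z.1, (0 : ℝ)) ∈ t := by
      have : Tendsto (fun z : ℝ × ℝ ↦ (z.1, (0 : ℝ))) (𝓝 z₀) (𝓝 (Φ z₀)) := by
        rw [hΦ0]; exact (continuous_fst.prodMk continuous_const).continuousAt
      exact this.eventually ht
    filter_upwards [e1, e2, hleft] with z h1 h2 h3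
    have := hL.dist_le_mul _ h1 _ h2
    rw [h3] at this
    refine this.trans (le_of_eq ?_)
    congr 1
    simp [hΦ, Prod.dist_eq]
  have hQd : ∀ᶠ z in 𝓝 z₀, |Q (r z.1)| ≤ |Q z| + B * (L * |P z|) := by
    filter_upwards [hdist, ht', (hrt.comp hfst).eventually ht'] with z h1 h2 h3
    have := hB.dist_le_mul _ h2 _ h3
    rw [Real.dist_eq] at this
    have h4 : |Q (r z.1)| ≤ |Q z| + |Q z - Q (r z.1)| := by
      have := abs_sub_abs_le_abs_sub (Q (r z.1)) (Q z)
      rw [abs_sub_comm] at this; linarith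
    have h5 := mul_le_mul_of_nonneg_left h1 B.2
    simp only [NNReal.val_eq_coe, Function.comp_apply] at *
    linarith
  set m : ℝ := |u z₀.1| / 2 with hm
  have hmpos : 0 < m := by have := abs_pos.2 hu0; positivity
  have hLn : (0 : ℝ) ≤ L := L.2
  have hBn : (0 : ℝ) ≤ B := B.2
  -- The first entry comes from `|z.2 - g z.1| ≤ L |P|`, the second from `m |z.1 - z₀.1|^k ≤ |Q| + B
  -- L |P|`; the summands 1 keep the denominators positive.
  refine ⟨min (1 / (1 + L)) (m / (1 + B * L)), by positivity, fun y ↦ (r y).2, k, ?_⟩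
  filter_upwards [hdist, hQd, hfst.eventually hulow, hfst.eventually hquk] with z h1 h2 h3 h4
  have hPn := abs_nonneg (P z)
  have hQn := abs_nonneg (Q z)
  constructor
  · refine (mul_le_mul_of_nonneg_right (min_le_left _ _) (abs_nonneg _)).trans ?_
    have h5 : |z.2 - (r z.1).2| ≤ L * |P z| := by
      refine le_trans ?_ h1
      rw [Prod.dist_eq, ← Real.dist_eq]; exact le_max_right _ _
    rw [one_div, inv_mul_le_iff₀ (by positivity)]
    nlinarith
  · refine (mul_le_mul_of_nonneg_right (min_le_right _ _) (by positivity)).trans ?_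
    rw [div_mul_eq_mul_div, div_le_iff₀ (by positivity)]
    have h5 : m * |z.1 - z₀.1| ^ k ≤ |Q (r z.1)| := by
      rw [h4, smul_eq_mul, abs_mul, abs_pow, mul_comm]
      exact mul_le_mul_of_nonneg_left h3.le (by positivity)
    nlinarith [mul_nonneg (mul_nonneg hBn hLn) hQn]

/-- Neither lower bound alone has an integrable inverse in general; their weighted geometric mean
does, being a product of powers of exponent less than 1 in `z.1 - z₀.1` and in `z.2 - g z.1`. -/
theorem exists_lintegral_inv_abs_add_abs_lt_top_prod {P Q : ℝ × ℝ → ℝ} {z₀ : ℝ × ℝ}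
    (hP : ContDiffAt ℝ ω P z₀)
    (hQ : ContDiffAt ℝ ω Q z₀) (hP0 : P z₀ = 0) (hd : fderiv ℝ P z₀ (0, 1) ≠ 0)
    (hiso : ∀ᶠ z in 𝓝[≠] z₀, ¬(P z = 0 ∧ Q z = 0)) :
    ∃ U ∈ 𝓝 z₀, ∫⁻ z in U, (ENNReal.ofReal (|P z| + |Q z|))⁻¹ < ⊤ := by
  obtain ⟨c, hc, g, k, h⟩ := eventually_le_abs_add_abs hP hQ hP0 hd hiso
  obtain ⟨I, hI, J, hJ, hIJ⟩ := mem_nhds_prod_iff.1 h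
  obtain ⟨a, ha, haI⟩ := Metric.mem_nhds_iff.1 hI
  obtain ⟨b, hb, hbJ⟩ := Metric.mem_nhds_iff.1 hJ
  set I' := Metric.ball z₀.1 a
  set J' := Metric.ball z₀.2 b
  -- `s` solves `k (1 - s) = s`, so raising the two lower bounds to the powers `s` and `1 - s` gives
  -- both factors the same exponent `s < 1`.
  set s : ℝ := k / (k + 1) with hs
  have hs0 : 0 ≤ s := by positivity
  have hs1 : s < 1 := by rw [hs, div_lt_one (by positivity)]; linarith
  have hIfin : volume I' < ⊤ := measure_ball_lt_top
  have hJfin : volume J' < ⊤ := measure_ball_lt_top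
  obtain ⟨C, hC, hCle⟩ := exists_lintegral_rpow_neg_sub_le hs0 hs1 hJfin
  obtain ⟨D, hD, hDle⟩ := exists_lintegral_rpow_neg_sub_le hs0 hs1 hIfin
  refine ⟨I' ×ˢ J', prod_mem_nhds (Metric.ball_mem_nhds _ ha) (Metric.ball_mem_nhds _ hb), ?_⟩
  have key : ∀ z ∈ I' ×ˢ J', (ENNReal.ofReal (|P z| + |Q z|))⁻¹ ≤
      (ENNReal.ofReal c)⁻¹ * (ENNReal.ofReal |z.1 - z₀.1| ^ (-s) *
        ENNReal.ofReal |z.2 - g z.1| ^ (-s)) := by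
    intro z hz
    obtain ⟨h1, h2⟩ := hIJ (Set.prod_mono haI hbJ hz)
    set A := |P z| + |Q z| with hA
    have hA0 : 0 ≤ A := by positivity
    rw [ENNReal.rpow_neg, ENNReal.rpow_neg,
      ← ENNReal.mul_inv (Or.inr (by finiteness)) (Or.inl (by finiteness)),
      ← ENNReal.mul_inv (Or.inl (by simpa using hc)) (Or.inl (by finiteness))]
    refine ENNReal.inv_le_inv.2 ?_
    rw [ENNReal.ofReal_rpow_of_nonneg (abs_nonneg _) hs0,
      ENNReal.ofReal_rpow_of_nonneg (abs_nonneg _) hs0, ← ENNReal.ofReal_mul (by positivity),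
      ← ENNReal.ofReal_mul hc.le]
    refine ENNReal.ofReal_le_ofReal ?_
    have e1 : (c * |z.2 - g z.1|) ^ s ≤ A ^ s := Real.rpow_le_rpow (by positivity) h1 hs0
    have e2 : (c * |z.1 - z₀.1| ^ k) ^ (1 - s) ≤ A ^ (1 - s) :=
      Real.rpow_le_rpow (by positivity) h2 (by linarith)
    have e3 : A ^ s * A ^ (1 - s) = A := by
      rw [← Real.rpow_add_of_nonneg hA0 hs0 (by linarith)]; simp
    have e4 : (|z.1 - z₀.1| ^ k) ^ (1 - s) = |z.1 - z₀.1| ^ s := by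
      rw [← Real.rpow_natCast, ← Real.rpow_mul (abs_nonneg _)]
      congr 1
      rw [hs]; field_simp; ring
    have e5 : c ^ s * c ^ (1 - s) = c := by
      rw [← Real.rpow_add hc]; simp
    rw [Real.mul_rpow hc.le (abs_nonneg _)] at e1
    rw [Real.mul_rpow hc.le (by positivity), e4] at e2
    calc c * (|z.1 - z₀.1| ^ s * |z.2 - g z.1| ^ s)
        = (c ^ s * |z.2 - g z.1| ^ s) * (c ^ (1 - s) * |z.1 - z₀.1| ^ s) := by
          linear_combination (-|z.1 - z₀.1| ^ s * |z.2 - g z.1| ^ s) * e5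
      _ ≤ A ^ s * A ^ (1 - s) := by gcongr
      _ = A := e3
  calc ∫⁻ z in I' ×ˢ J', (ENNReal.ofReal (|P z| + |Q z|))⁻¹
      ≤ ∫⁻ z in I' ×ˢ J', (ENNReal.ofReal c)⁻¹ * (ENNReal.ofReal |z.1 - z₀.1| ^ (-s) *
        ENNReal.ofReal |z.2 - g z.1| ^ (-s)) :=
        setLIntegral_mono' (measurableSet_ball.prod measurableSet_ball) key
    _ ≤ ∫⁻ y in I', ∫⁻ x in J', (ENNReal.ofReal c)⁻¹ * (ENNReal.ofReal |y - z₀.1| ^ (-s) *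
        ENNReal.ofReal |x - g y| ^ (-s)) := by
        rw [Measure.volume_eq_prod, ← Measure.prod_restrict]
        -- This half of Tonelli's theorem needs no measurability, hence none of `g`.
        exact lintegral_prod_le _
    _ ≤ ∫⁻ y in I', (ENNReal.ofReal c)⁻¹ * (ENNReal.ofReal |y - z₀.1| ^ (-s) * C) := by
        refine lintegral_mono fun y ↦ ?_
        rw [lintegral_const_mul _ (by fun_prop), lintegral_const_mul _ (by fun_prop)]
        gcongr
        exact hCle _
    _ = (ENNReal.ofReal c)⁻¹ * ((∫⁻ y in I', ENNReal.ofReal |y - z₀.1| ^ (-s)) * C) := by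
        rw [lintegral_const_mul _ (by fun_prop), lintegral_mul_const _ (by fun_prop)]
    _ < ⊤ := by
        refine ENNReal.mul_lt_top (by simpa using hc) (ENNReal.mul_lt_top ?_ hC)
        exact (hDle _).trans_lt hD

/-- The coordinates `(s, t) ↦ (s, t)` on `ℝ²`. -/
noncomputable def planeMap : (ℝ × ℝ) →L[ℝ] EuclideanSpace ℝ (Fin 2) :=
  (ContinuousLinearMap.fst ℝ ℝ ℝ).smulRight (EuclideanSpace.single 0 1) +
    (ContinuousLinearMap.snd ℝ ℝ ℝ).smulRight (EuclideanSpace.single 1 1)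

theorem planeMap_eq : (planeMap : ℝ × ℝ → EuclideanSpace ℝ (Fin 2)) =
    ((MeasurableEquiv.finTwoArrow (α := ℝ)).symm.trans (MeasurableEquiv.toLp 2 (Fin 2 → ℝ))) := by
  ext z i
  fin_cases i <;> simp [planeMap, MeasurableEquiv.finTwoArrow]

theorem measurableEmbedding_planeMap : MeasurableEmbedding planeMap := by
  rw [planeMap_eq]; exact MeasurableEquiv.measurableEmbedding _

theorem measurePreserving_planeMap : MeasurePreserving planeMap := by
  rw [planeMap_eq, MeasurableEquiv.coe_trans]
  exact (PiLp.volume_preserving_toLp (Fin 2)).comp (volume_preserving_finTwoArrow ℝ).symm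

/-- `T` will be one of the two orderings of the coordinates, chosen so that the direction in which
the derivative is nonzero becomes the second one. -/
theorem exists_lintegral_inv_abs_add_abs_lt_top_of_equiv {P Q : EuclideanSpace ℝ (Fin 2) → ℝ}
    {x₀ : EuclideanSpace ℝ (Fin 2)} (T : (ℝ × ℝ) →L[ℝ] EuclideanSpace ℝ (Fin 2))
    (hT : MeasurableEmbedding T) (hT' : MeasurePreserving T)
    (hTo : IsOpenMap T) (hTs : Function.Surjective T)
    (hP : ContDiffAt ℝ ω P x₀) (hQ : ContDiffAt ℝ ω Q x₀) (hP0 : P x₀ = 0)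
    (hd : fderiv ℝ P x₀ (T (0, 1)) ≠ 0)
    (hiso : ∀ᶠ x in 𝓝[≠] x₀, ¬(P x = 0 ∧ Q x = 0)) :
    ∃ U ∈ 𝓝 x₀, ∫⁻ x in U, (ENNReal.ofReal (|P x| + |Q x|))⁻¹ < ⊤ := by
  obtain ⟨z₀, rfl⟩ := hTs x₀
  obtain ⟨U, hU, hlt⟩ := exists_lintegral_inv_abs_add_abs_lt_top_prod (P := P ∘ T) (Q := Q ∘ T)
    (z₀ := z₀) (hP.comp z₀ T.contDiff.contDiffAt) (hQ.comp z₀ T.contDiff.contDiffAt) hP0 (by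
      rw [fderiv_comp z₀ (hP.differentiableAt (by simp)) T.differentiableAt, T.fderiv]
      exact hd) (by
      rw [eventually_nhdsWithin_iff] at hiso ⊢
      filter_upwards [T.continuous.continuousAt.eventually hiso] with z hz hne
      exact hz fun h ↦ hne (hT.injective h))
  refine ⟨T '' U, hTo.image_mem_nhds hU, ?_⟩
  rwa [← hT'.setLIntegral_comp_emb hT]

/-- The inverse of an analytic planar vector field with an isolated zero, not all of whose first
derivatives vanish there, is locally integrable. -/
theorem exists_lintegral_inv_abs_add_abs_lt_top {P Q : EuclideanSpace ℝ (Fin 2) → ℝ}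
    {x₀ : EuclideanSpace ℝ (Fin 2)} (hP : ContDiffAt ℝ ω P x₀) (hQ : ContDiffAt ℝ ω Q x₀)
    (hd : P x₀ = 0 → Q x₀ = 0 →
      fderiv ℝ Q x₀ (EuclideanSpace.single 0 1) ≠ fderiv ℝ P x₀ (EuclideanSpace.single 1 1))
    (hiso : P x₀ = 0 → Q x₀ = 0 → ∀ᶠ x in 𝓝[≠] x₀, ¬(P x = 0 ∧ Q x = 0)) :
    ∃ U ∈ 𝓝 x₀, ∫⁻ x in U, (ENNReal.ofReal (|P x| + |Q x|))⁻¹ < ⊤ := by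
  by_cases h0 : P x₀ = 0 ∧ Q x₀ = 0
  · have hTs : Function.Surjective planeMap := by
      rw [planeMap_eq]; exact MeasurableEquiv.surjective _
    have hTo : IsOpenMap planeMap := planeMap.isOpenMap hTs
    rcases ne_or_eq (fderiv ℝ P x₀ (EuclideanSpace.single 1 1)) 0 with h | h
    · exact exists_lintegral_inv_abs_add_abs_lt_top_of_equiv planeMap measurableEmbedding_planeMap
        measurePreserving_planeMap hTo hTs hP hQ h0.1 (by simpa [planeMap] using h) (hiso h0.1 h0.2)
    -- Since `∂₁P = 0`, the hypothesis forces `∂₀Q ≠ 0`; both the functions and the coordinates are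
    -- exchanged.
    · have h' : fderiv ℝ Q x₀ (EuclideanSpace.single 0 1) ≠ 0 := h ▸ hd h0.1 h0.2
      simp_rw [add_comm |P _|]
      refine exists_lintegral_inv_abs_add_abs_lt_top_of_equiv
        (planeMap.comp (ContinuousLinearEquiv.prodComm ℝ ℝ ℝ : ℝ × ℝ →L[ℝ] ℝ × ℝ))
        (measurableEmbedding_planeMap.comp MeasurableEquiv.prodComm.measurableEmbedding)
        (measurePreserving_planeMap.comp Measure.measurePreserving_swap)
        (hTo.comp (ContinuousLinearEquiv.prodComm ℝ ℝ ℝ).toHomeomorph.isOpenMap)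
        (hTs.comp (ContinuousLinearEquiv.prodComm ℝ ℝ ℝ).surjective) hQ hP h0.2
        (by simpa [planeMap] using h') ?_
      simpa only [and_comm] using hiso h0.1 h0.2
  · have hpos : 0 < |P x₀| + |Q x₀| := by
      rcases not_and_or.1 h0 with h | h
      · have := abs_pos.2 h; positivity
      · have := abs_pos.2 h; positivity
    have hc : ContinuousAt (fun x ↦ |P x| + |Q x|) x₀ := hP.continuousAt.abs.add hQ.continuousAt.abs
    have hev := hc.eventually_const_lt (half_lt_self hpos)
    obtain ⟨r, hr, hball⟩ := Metric.mem_nhds_iff.1 hev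
    refine ⟨Metric.ball x₀ r, Metric.ball_mem_nhds _ hr, ?_⟩
    calc ∫⁻ x in Metric.ball x₀ r, (ENNReal.ofReal (|P x| + |Q x|))⁻¹
        ≤ ∫⁻ x in Metric.ball x₀ r, (ENNReal.ofReal ((|P x₀| + |Q x₀|) / 2))⁻¹ :=
          setLIntegral_mono' measurableSet_ball fun x hx ↦
            ENNReal.inv_le_inv.2 (ENNReal.ofReal_le_ofReal (hball hx).le)
      _ < ⊤ := by
          rw [setLIntegral_const]
          refine ENNReal.mul_lt_top ?_ measure_ball_lt_top
          simpa using hpos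

end Integrability

/-! ## Linear algebra of a contact plane -/

section Algebra

variable {V : Type*} [NormedAddCommGroup V] [NormedSpace ℝ V]

/-- The algebraic data of a normalized contact structure at a point: the contact form `w`, its
exterior derivative `d`, the Reeb vector `R` and the sub-Riemannian metric `h`, extended by zero
along `R`. -/
structure IsContactData (w : V →L[ℝ] ℝ) (d h : V →L[ℝ] V →L[ℝ] ℝ) (R : V) : Prop where
  d_self : ∀ u, d u u = 0
  w_reeb : w R = 1
  d_reeb : ∀ u, d R u = 0
  h_symm : ∀ u v, h u v = h v u
  h_reeb : ∀ u, h R u = 0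
  h_pos : ∀ u, w u = 0 → u ≠ 0 → 0 < h u u
  normalized : ∀ u v, w u = 0 → w v = 0 → d u v ^ 2 = h u u * h v v - h u v ^ 2

/-- The quarter turn `J` of the contact plane: `h (J z) u = d z u`, in terms of a basis `a`, `c` of
the contact plane. -/
noncomputable def quarterTurn (d h : V →L[ℝ] V →L[ℝ] ℝ) (a c z : V) : V :=
  (d a c)⁻¹ • (h z a • c - h z c • a)

namespace IsContactData

variable {w : V →L[ℝ] ℝ} {d h : V →L[ℝ] V →L[ℝ] ℝ} {R : V}

theorem d_swap (H : IsContactData w d h R) (u v : V) : d v u = -d u v := by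
  have h1 := H.d_self (u + v)
  simp only [map_add, add_apply, H.d_self] at h1
  linarith

theorem d_reeb' (H : IsContactData w d h R) (u : V) : d u R = 0 := by
  rw [H.d_swap, H.d_reeb, neg_zero]

theorem h_reeb' (H : IsContactData w d h R) (u : V) : h u R = 0 := by
  rw [H.h_symm, H.h_reeb]

/-- Two vectors of the contact plane with `d a c ≠ 0` form a basis of it. -/
theorem eq_combination (H : IsContactData w d h R) {a c u : V} (ha : w a = 0) (hc : w c = 0)
    (hac : d a c ≠ 0) (hu : w u = 0) : u = (d u c / d a c) • a + (d a u / d a c) • c := by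
  -- The coefficients are Cramer's rule for `d`. The error `e` satisfies `d a e = d e c = 0`, so by
  -- the normalization `e` and `c` have zero Gram determinant and are parallel; pairing with `a`
  -- then gives `e = 0`. No dimension count is needed.
  set e := u - (d u c / d a c) • a - (d a u / d a c) • c with he
  have hwe : w e = 0 := by simp [he, ha, hc, hu]
  have hda : d a e = 0 := by
    simp only [he, map_sub, map_smul, smul_eq_mul, H.d_self]; field_simp; ring
  have hec : d e c = 0 := by
    simp only [he, map_sub, map_smul, sub_apply, smul_apply, smul_eq_mul, H.d_self]
    field_simp; ring
  have hc0 : c ≠ 0 := by rintro rfl; simp at hac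
  have hcc := H.h_pos c hc hc0
  have h1 := H.normalized e c hwe hc
  rw [hec] at h1
  have h2 : h c c • e = h e c • c := by
    rw [← sub_eq_zero]
    by_contra hne
    have := H.h_pos (h c c • e - h e c • c) (by simp [hwe, hc]) hne
    simp only [map_sub, map_smul, sub_apply, smul_apply, smul_eq_mul,
      H.h_symm c e] at this
    nlinarith
  have h3 : h e c = 0 := by
    have := congrArg (d a) h2
    rw [map_smul, map_smul, hda] at this
    simpa [hac] using this
  rw [h3, zero_smul, smul_eq_zero] at h2
  have h4 : e = 0 := h2.resolve_left hcc.ne'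
  rw [he] at h4
  rw [← sub_eq_zero, ← h4]; abel

theorem w_quarterTurn {a c : V} (ha : w a = 0) (hc : w c = 0) (z : V) :
    w (quarterTurn d h a c z) = 0 := by
  simp [quarterTurn, ha, hc]

/-- `R`, `a` and `c` span the space, so identities between linear forms reduce to three evaluations.
-/
theorem horizontal_ext (H : IsContactData w d h R) {a c : V} (ha : w a = 0) (hc : w c = 0)
    (hac : d a c ≠ 0) {α β : V →L[ℝ] ℝ} (hR : α R = β R) (h1 : α a = β a) (h2 : α c = β c) :
    α = β := by
  ext u
  have hu := H.eq_combination ha hc hac (u := u - w u • R) (by simp [H.w_reeb])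
  rw [← sub_add_cancel u (w u • R), hu]
  simp [hR, h1, h2]

theorem d_quarterTurn (H : IsContactData w d h R) {a c : V} (ha : w a = 0) (hc : w c = 0)
    (hac : d a c ≠ 0) (z u : V) : d u (quarterTurn d h a c z) = h u z := by
  have : -d (quarterTurn d h a c z) = h z := by
    refine H.horizontal_ext ha hc hac ?_ ?_ ?_
    · simp [H.d_reeb', H.h_reeb']
    · rw [neg_apply, ← H.d_swap]
      simp only [quarterTurn, map_sub, map_smul, smul_eq_mul, H.d_self]; field_simp; ring
    · rw [neg_apply, ← H.d_swap]
      simp only [quarterTurn, map_sub, map_smul, smul_eq_mul, H.d_self, H.d_swap a c]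
      field_simp; ring
  rw [H.d_swap, H.h_symm, ← this]; rfl

/-- In the basis `a`, `c` this comes down to the Gram determinant of `a`, `c` being `(d a c) ^ 2`,
which is the normalization. With `d_quarterTurn` it shows that the quarter turn preserves the length
of `z`. -/
theorem h_quarterTurn (H : IsContactData w d h R) {a c z : V} (ha : w a = 0) (hc : w c = 0)
    (hac : d a c ≠ 0) (hz : w z = 0) (u : V) : h (quarterTurn d h a c z) u = d z u := by
  have hn := H.normalized a c ha hc
  have hZ := H.eq_combination ha hc hac hz
  have e1 := congrArg (fun x ↦ h x a) hZ
  have e2 := congrArg (fun x ↦ h x c) hZ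
  simp only [map_add, map_smul, add_apply, smul_apply, smul_eq_mul] at e1 e2
  have : h (quarterTurn d h a c z) = d z := by
    refine H.horizontal_ext ha hc hac ?_ ?_ ?_
    · simp [H.d_reeb', H.h_reeb']
    · simp only [quarterTurn, map_sub, map_smul, sub_apply, smul_apply,
        smul_eq_mul]
      rw [e1, e2, H.d_swap a z, H.h_symm c a]
      field_simp
      linear_combination d a z * hn
    · simp only [quarterTurn, map_sub, map_smul, sub_apply, smul_apply,
        smul_eq_mul]
      rw [e1, e2, H.h_symm c a]
      field_simp
      linear_combination (-d z c) * hn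
  rw [this]

end IsContactData

/-! ## The second fundamental form at a point -/

/-- The second fundamental form at a point, in terms of the value `B` and the derivative `B'` of the
metric, the tangent vectors `p`, `q` and the second derivative `s` of the parametrization. -/
noncomputable def secondFormLin (B : V →L[ℝ] V →L[ℝ] ℝ) (B' : V → V → V → ℝ) (p q s ν : V) : ℝ :=
  B s ν + (B' p q ν + B' q p ν - B' ν p q) / 2

/-- The mean curvature at a point, in terms of the value `B` and the derivative `B'` of the metric,
and the first and second derivatives of the parametrization. -/
noncomputable def meanCurvatureLin (B : V →L[ℝ] V →L[ℝ] ℝ) (B' : V → V → V → ℝ)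
    (p₀ p₁ s₀₀ s₀₁ s₁₁ ν : V) : ℝ :=
  (B p₀ p₀ * secondFormLin B B' p₁ p₁ s₁₁ ν - 2 * B p₀ p₁ * secondFormLin B B' p₀ p₁ s₀₁ ν
    + B p₁ p₁ * secondFormLin B B' p₀ p₀ s₀₀ ν) / (B p₀ p₀ * B p₁ p₁ - B p₀ p₁ ^ 2)

/-- The metric `h + ε⁻¹ w ⊗ w`. -/
noncomputable def dilatedMetric (h : V →L[ℝ] V →L[ℝ] ℝ) (w : V →L[ℝ] ℝ) (ε : ℝ) :
    V →L[ℝ] V →L[ℝ] ℝ :=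
  h + ε⁻¹ • w.smulRight w

/-- The derivative of `h + ε⁻¹ w ⊗ w`. -/
noncomputable def dilatedMetricDeriv (h' : V → V → V → ℝ) (w : V →L[ℝ] ℝ)
    (w' : V →L[ℝ] V →L[ℝ] ℝ) (ε : ℝ) (e u v : V) : ℝ :=
  h' e u v + ε⁻¹ * (w u * w' e v + w' e u * w v)

@[simp] theorem dilatedMetric_apply (h : V →L[ℝ] V →L[ℝ] ℝ) (w : V →L[ℝ] ℝ) (ε : ℝ) (u v : V) :
    dilatedMetric h w ε u v = h u v + ε⁻¹ * (w u * w v) := by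
  simp [dilatedMetric]

theorem secondFormLin_smul {B : V →L[ℝ] V →L[ℝ] ℝ} {B' : V → V → V → ℝ}
    (h₁ : ∀ (t : ℝ) e u v, B' (t • e) u v = t * B' e u v)
    (h₃ : ∀ (t : ℝ) e u v, B' e u (t • v) = t * B' e u v)
    (p q s ν : V) (t : ℝ) : secondFormLin B B' p q s (t • ν) = t * secondFormLin B B' p q s ν := by
  simp only [secondFormLin, map_smul, smul_eq_mul, h₁, h₃]; ring

theorem meanCurvatureLin_smul {B : V →L[ℝ] V →L[ℝ] ℝ} {B' : V → V → V → ℝ}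
    (h₁ : ∀ (t : ℝ) e u v, B' (t • e) u v = t * B' e u v)
    (h₃ : ∀ (t : ℝ) e u v, B' e u (t • v) = t * B' e u v)
    (p₀ p₁ s₀₀ s₀₁ s₁₁ ν : V) (t : ℝ) : meanCurvatureLin B B' p₀ p₁ s₀₀ s₀₁ s₁₁ (t • ν) =
      t * meanCurvatureLin B B' p₀ p₁ s₀₀ s₀₁ s₁₁ ν := by
  simp only [meanCurvatureLin, secondFormLin_smul h₁ h₃]; ring

/-- The part of the second fundamental form of `h + ε⁻¹ w ⊗ w` that does not contribute a
divergence as `ε → 0`. -/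
noncomputable def regularForm (h : V →L[ℝ] V →L[ℝ] ℝ) (h' : V → V → V → ℝ)
    (w : V →L[ℝ] ℝ) (w' : V →L[ℝ] V →L[ℝ] ℝ) (κ : ℝ) (p q s ν : V) : ℝ :=
  secondFormLin h h' p q s ν - κ * (w s + (w' p q + w' q p) / 2)

/-- The `ε⁻¹` part of the second fundamental form is `(w q * h p z + w p * h q z) / 2`. Its trace
vanishes identically: `h z ·` is dual to the horizontal vector `z`, and `w z = 0`. The identity
holds for any `κ`; the choice `κ = d p₀ p₁` is what makes the vector normal to the surface. -/
theorem meanCurvatureLin_dilated {w : V →L[ℝ] ℝ} {w' h : V →L[ℝ] V →L[ℝ] ℝ}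
    {h' : V → V → V → ℝ} {R : V} (H : IsContactData w (w' - w'.flip) h R)
    {ε : ℝ} (hε : ε ≠ 0) {a c : V} (ha : w a = 0) (hc : w c = 0)
    (hac : (w' - w'.flip) a c ≠ 0) {p₀ p₁ s₀₀ s₀₁ s₁₁ z Y : V} {κ : ℝ}
    (hz : z = w p₁ • p₀ - w p₀ • p₁) (hY : Y = quarterTurn (w' - w'.flip) h a c z) :
    meanCurvatureLin (dilatedMetric h w ε) (dilatedMetricDeriv h' w w' ε) p₀ p₁ s₀₀ s₀₁ s₁₁
      (Y - (ε * κ) • R) =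
    ((ε * h p₀ p₀ + w p₀ ^ 2) * regularForm h h' w w' κ p₁ p₁ s₁₁ (Y - (ε * κ) • R)
      - 2 * (ε * h p₀ p₁ + w p₀ * w p₁) * regularForm h h' w w' κ p₀ p₁ s₀₁ (Y - (ε * κ) • R)
      + (ε * h p₁ p₁ + w p₁ ^ 2) * regularForm h h' w w' κ p₀ p₀ s₀₀ (Y - (ε * κ) • R))
      / (ε * (h p₀ p₀ * h p₁ p₁ - h p₀ p₁ ^ 2) + h z z) := by
  set ν := Y - (ε * κ) • R with hν
  have hwY : w Y = 0 := by rw [hY]; exact IsContactData.w_quarterTurn ha hc z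
  have hwν : w ν = -(ε * κ) := by simp [hν, hwY, H.w_reeb]
  have hd : ∀ u, w' u ν - w' ν u = h u z := by
    intro u
    have h1 := H.d_quarterTurn ha hc hac z u
    rw [← hY] at h1
    have h2 := H.d_reeb' u
    have : (w' - w'.flip) u ν = h u z := by
      rw [hν, map_sub, map_smul, h1, h2]; simp
    simpa using this
  -- The factor `w ν = -ε κ` absorbs one `ε⁻¹`. The derivatives of `w` left over enter
  -- antisymmetrized, as `d p ν` and `d q ν`, which are `h p z` and `h q z`.
  have key : ∀ p q s, secondFormLin (dilatedMetric h w ε) (dilatedMetricDeriv h' w w' ε) p q s ν =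
      regularForm h h' w w' κ p q s ν + ε⁻¹ * ((w q * h p z + w p * h q z) / 2) := by
    intro p q s
    simp only [secondFormLin, regularForm, dilatedMetric_apply, dilatedMetricDeriv, hwν,
      ← hd]
    field_simp
    ring
  have h01 := H.h_symm p₁ p₀
  have e0 : h p₀ z = w p₁ * h p₀ p₀ - w p₀ * h p₀ p₁ := by simp [hz]
  have e1 : h p₁ z = w p₁ * h p₀ p₁ - w p₀ * h p₁ p₁ := by simp [hz, h01]
  have ez : h z z = w p₁ ^ 2 * h p₀ p₀ - 2 * w p₀ * w p₁ * h p₀ p₁ + w p₀ ^ 2 * h p₁ p₁ := by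
    have : h z z = w p₁ * h p₀ z - w p₀ * h p₁ z := by
      calc h z z = h z (w p₁ • p₀ - w p₀ • p₁) := by rw [← hz]
        _ = _ := by
          rw [map_sub, map_smul, map_smul, H.h_symm z, H.h_symm z, smul_eq_mul, smul_eq_mul]
    rw [this, e0, e1]; ring
  -- Numerator and denominator are multiplied by `ε`: the Gram determinant of the dilated metric
  -- times `ε` is that of `h` times `ε`, plus `h z z`.
  rw [meanCurvatureLin, key, key, key, ← mul_div_mul_left _ _ hε]
  simp only [dilatedMetric_apply, e0, e1, ez]
  congr 1
  · field_simp; ring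
  · field_simp; ring

/-- The limit, as `ε → 0`, of the mean curvatures, for the normal `Y / √(h z z)`. -/
noncomputable def limitCurvature (h : V →L[ℝ] V →L[ℝ] ℝ) (h' : V → V → V → ℝ)
    (w : V →L[ℝ] ℝ) (w' : V →L[ℝ] V →L[ℝ] ℝ) (p₀ p₁ s₀₀ s₀₁ s₁₁ Y : V) (κ Δ : ℝ) : ℝ :=
  (w p₀ ^ 2 * regularForm h h' w w' κ p₁ p₁ s₁₁ Y
    - 2 * (w p₀ * w p₁) * regularForm h h' w w' κ p₀ p₁ s₀₁ Y
    + w p₁ ^ 2 * regularForm h h' w w' κ p₀ p₀ s₀₀ Y) / (Δ * √Δ)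

/-- After the cancellation the formula is continuous at `ε = 0`, its denominators there being `h z
z` and `√(h z z)`, so the limit is its value at `0`. -/
theorem tendsto_meanCurvatureLin_dilated {w : V →L[ℝ] ℝ} {w' h : V →L[ℝ] V →L[ℝ] ℝ}
    {h' : V → V → V → ℝ} (h₁ : ∀ u v, Continuous fun e ↦ h' e u v)
    (h₃ : ∀ e u, Continuous fun v ↦ h' e u v)
    (hs₁ : ∀ (t : ℝ) e u v, h' (t • e) u v = t * h' e u v)
    (hs₃ : ∀ (t : ℝ) e u v, h' e u (t • v) = t * h' e u v) {R : V} (H : IsContactData w (w' - w'.flip) h R)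
    {a c : V} (ha : w a = 0) (hc : w c = 0)
    (hac : (w' - w'.flip) a c ≠ 0) {p₀ p₁ s₀₀ s₀₁ s₁₁ z Y : V} {κ : ℝ}
    (hz : z = w p₁ • p₀ - w p₀ • p₁) (hY : Y = quarterTurn (w' - w'.flip) h a c z)
    (hpos : 0 < h z z) :
    Tendsto (fun ε ↦ meanCurvatureLin (dilatedMetric h w ε) (dilatedMetricDeriv h' w w' ε)
      p₀ p₁ s₀₀ s₀₁ s₁₁ ((√(h z z + ε * κ ^ 2))⁻¹ • (Y - (ε * κ) • R))) (𝓝[>] 0)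
      (𝓝 (limitCurvature h h' w w' p₀ p₁ s₀₀ s₀₁ s₁₁ Y κ (h z z))) := by
  set F : ℝ → ℝ := fun ε ↦ (√(h z z + ε * κ ^ 2))⁻¹ *
    (((ε * h p₀ p₀ + w p₀ ^ 2) * regularForm h h' w w' κ p₁ p₁ s₁₁ (Y - (ε * κ) • R)
      - 2 * (ε * h p₀ p₁ + w p₀ * w p₁) * regularForm h h' w w' κ p₀ p₁ s₀₁ (Y - (ε * κ) • R)
      + (ε * h p₁ p₁ + w p₁ ^ 2) * regularForm h h' w w' κ p₀ p₀ s₀₀ (Y - (ε * κ) • R))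
      / (ε * (h p₀ p₀ * h p₁ p₁ - h p₀ p₁ ^ 2) + h z z)) with hF
  have hreg : ∀ p q s, ContinuousAt (fun ε : ℝ ↦ regularForm h h' w w' κ p q s (Y - (ε * κ) • R))
      0 := by
    intro p q s
    have e1 := h₁ p q
    have e2 := h₃ p q
    have e3 := h₃ q p
    unfold regularForm secondFormLin
    fun_prop
  have hFc : ContinuousAt F 0 := by
    have h1 := hreg p₁ p₁ s₁₁
    have h2 := hreg p₀ p₁ s₀₁
    have h3 := hreg p₀ p₀ s₀₀
    refine ContinuousAt.mul (ContinuousAt.inv₀ (by fun_prop) ?_) (ContinuousAt.div ?_ (by fun_prop) ?_)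
    · simpa using (Real.sqrt_pos.2 hpos).ne'
    · fun_prop
    · simpa using hpos.ne'
  have hF0 : F 0 = limitCurvature h h' w w' p₀ p₁ s₀₀ s₀₁ s₁₁ Y κ (h z z) := by
    simp only [hF, limitCurvature, zero_mul, add_zero, zero_add, zero_smul, sub_zero]
    rw [inv_mul_eq_div, div_div]
  rw [← hF0]
  refine (hFc.tendsto.mono_left nhdsWithin_le_nhds).congr' ?_
  filter_upwards [self_mem_nhdsWithin] with ε hε
  rw [meanCurvatureLin_smul
    (fun t e u v ↦ by simp only [dilatedMetricDeriv, hs₁, map_smul, smul_eq_mul, smul_apply]; ring)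
    (fun t e u v ↦ by simp only [dilatedMetricDeriv, hs₃, map_smul, smul_eq_mul]; ring),
    meanCurvatureLin_dilated H (ne_of_gt hε) ha hc hac hz hY]

end Algebra

/-! ### The Riemannian unit normal in closed form -/

section UnitNormal

variable {V : Type*} [NormedAddCommGroup V] [NormedSpace ℝ V]
  {w : V →L[ℝ] ℝ} {d h : V →L[ℝ] V →L[ℝ] ℝ} {R : V}

/-- The conditions defining the unit normal of the plane spanned by `p₀`, `p₁`, for the metric
`h + ε⁻¹ w ⊗ w` and the orientation `s • (w ∧ d)`. -/
structure IsUnitNormalLin (w : V →L[ℝ] ℝ) (d h : V →L[ℝ] V →L[ℝ] ℝ) (ε s : ℝ) (p₀ p₁ ν : V) :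
    Prop where
  orth₀ : dilatedMetric h w ε ν p₀ = 0
  orth₁ : dilatedMetric h w ε ν p₁ = 0
  norm : dilatedMetric h w ε ν ν = 1
  pos : 0 < s * (w ν * d p₀ p₁ + w p₀ * d p₁ ν + w p₁ * d ν p₀)

/-- Orthogonality to `z` puts the horizontal part of the normal on the line of `Y`; orthogonality to
`p₀` and `p₁` fixes its Reeb component. The norm and the orientation then determine the scalar.
Uniqueness identifies a normal that is only specified by its properties. -/
theorem isUnitNormalLin_iff (H : IsContactData w d h R) {a c p₀ p₁ z Y : V} (ha : w a = 0)
    (hc : w c = 0) (hac : d a c ≠ 0) (hz : z = w p₁ • p₀ - w p₀ • p₁)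
    (hY : Y = quarterTurn d h a c z) (hpos : 0 < h z z) {ε s : ℝ} (hε : 0 < ε) (hs : s ^ 2 = 1)
    (ν : V) :
    IsUnitNormalLin w d h ε s p₀ p₁ ν ↔
      ν = (-s) • (√(h z z + ε * d p₀ p₁ ^ 2))⁻¹ • (Y - (ε * d p₀ p₁) • R) := by
  set κ := d p₀ p₁ with hκ
  have hwz : w z = 0 := by simp [hz]; ring
  have hwY : w Y = 0 := by rw [hY]; exact IsContactData.w_quarterTurn ha hc z
  have hdY : ∀ u, d u Y = h u z := fun u ↦ by rw [hY]; exact H.d_quarterTurn ha hc hac z u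
  have hhY : ∀ u, h Y u = d z u := fun u ↦ by rw [hY]; exact H.h_quarterTurn ha hc hac hwz u
  have hYY : h Y Y = h z z := by rw [hhY, hdY]
  have hz0 : d z p₀ = w p₀ * κ := by
    rw [hz, map_sub, map_smul, map_smul]; simp [H.d_self, hκ, H.d_swap p₀ p₁]
  have hz1 : d z p₁ = w p₁ * κ := by
    rw [hz, map_sub, map_smul, map_smul]; simp [H.d_self, hκ]
  -- The orientation form on `t • (Y - ε κ R)`, `p₀`, `p₁` has the sign of `-t`; this is the source
  -- of the factor `-s` in the normal.
  have horient : ∀ t : ℝ, w (t • (Y - (ε * κ) • R)) * κ + w p₀ * d p₁ (t • (Y - (ε * κ) • R))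
      + w p₁ * d (t • (Y - (ε * κ) • R)) p₀ = -t * (h z z + ε * κ ^ 2) := by
    intro t
    have ez : h z z = w p₁ * h p₀ z - w p₀ * h p₁ z := by
      calc h z z = h z (w p₁ • p₀ - w p₀ • p₁) := by rw [← hz]
        _ = _ := by
          rw [map_sub, map_smul, map_smul, H.h_symm z, H.h_symm z, smul_eq_mul, smul_eq_mul]
    rw [H.d_swap p₀ (t • (Y - (ε * κ) • R))]
    simp only [map_smul, map_sub, smul_eq_mul, hwY, H.w_reeb, hdY, H.d_reeb', ez]
    ring
  have hnorm : ∀ t : ℝ, dilatedMetric h w ε (t • (Y - (ε * κ) • R)) (t • (Y - (ε * κ) • R)) =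
      t ^ 2 * (h z z + ε * κ ^ 2) := by
    intro t
    simp only [dilatedMetric_apply, map_smul, map_sub, smul_eq_mul, hwY, H.w_reeb, smul_apply,
      sub_apply, H.h_reeb, H.h_reeb', hYY]
    field_simp
    ring
  have hD : 0 < h z z + ε * κ ^ 2 := by positivity
  have hsq := Real.sq_sqrt hD.le
  have hsp := Real.sqrt_pos.2 hD
  constructor
  · intro hν
    have hdzY : d z Y ≠ 0 := by rw [hdY]; exact hpos.ne'
    set μ := ν - w ν • R with hμ
    have hwμ : w μ = 0 := by simp [hμ, H.w_reeb]
    have hμ2 := H.eq_combination hwz hwY hdzY hwμ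
    have hhμ : ∀ u, h μ u = h ν u := fun u ↦ by simp [hμ, H.h_reeb]
    have h0 : h ν p₀ = -(ε⁻¹ * (w ν * w p₀)) := by
      have := hν.orth₀; rw [dilatedMetric_apply] at this; linarith
    have h1 : h ν p₁ = -(ε⁻¹ * (w ν * w p₁)) := by
      have := hν.orth₁; rw [dilatedMetric_apply] at this; linarith
    -- `d μ Y = h μ z`, and the two orthogonality relations cancel in it because `w z = 0`. As `d z
    -- Y = h z z ≠ 0`, the vectors `z`, `Y` form a basis of the contact plane and `μ` is a multiple
    -- of `Y`.
    have hμz : d μ Y = 0 := by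
      rw [hdY, hhμ, hz, map_sub, map_smul, map_smul, h0, h1, smul_eq_mul, smul_eq_mul]; ring
    set t := d z μ / d z Y with ht
    have hμY : μ = t • Y := by rw [hμ2, hμz]; simp
    have hwν : w ν = -(ε * t * κ) := by
      have e0 : t * (w p₀ * κ) = -(ε⁻¹ * (w ν * w p₀)) := by
        rw [← h0, ← hhμ, hμY, map_smul, smul_apply, hhY, hz0, smul_eq_mul]
      have e1 : t * (w p₁ * κ) = -(ε⁻¹ * (w ν * w p₁)) := by
        rw [← h1, ← hhμ, hμY, map_smul, smul_apply, hhY, hz1, smul_eq_mul]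
      have e0' : w p₀ * (ε * t * κ + w ν) = 0 := by field_simp at e0; linarith
      have e1' : w p₁ * (ε * t * κ + w ν) = 0 := by field_simp at e1; linarith
      -- Orthogonality to `pᵢ` only gives the relation multiplied by `w pᵢ`; one of these factors is
      -- nonzero since `z ≠ 0`.
      have hne : w p₀ ≠ 0 ∨ w p₁ ≠ 0 := by
        by_contra! hcon
        rw [hz, hcon.1, hcon.2] at hpos
        simp at hpos
      have : ε * t * κ + w ν = 0 := by
        rcases hne with hne | hne
        · exact (mul_eq_zero.1 e0').resolve_left hne
        · exact (mul_eq_zero.1 e1').resolve_left hne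
      linarith
    have hνt : ν = t • (Y - (ε * κ) • R) := by
      have : ν = μ + w ν • R := by simp [hμ]
      rw [this, hμY, hwν, smul_sub, smul_smul, sub_eq_add_neg, ← neg_smul]
      congr 2; ring
    have hn := hν.norm
    have hp := hν.pos
    rw [hνt, hnorm] at hn
    rw [hνt, horient] at hp
    have hts : s * t < 0 := by nlinarith
    have h2 : (s * t * √(h z z + ε * κ ^ 2)) ^ 2 = 1 := by
      rw [mul_pow, mul_pow, hs, hsq]; linarith
    have h3 : s * t * √(h z z + ε * κ ^ 2) = -1 := by
      have : s * t * √(h z z + ε * κ ^ 2) < 0 := mul_neg_of_neg_of_pos hts hsp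
      nlinarith
    have ht' : t = -s * (√(h z z + ε * κ ^ 2))⁻¹ := by
      field_simp
      have : s * (s * t * √(h z z + ε * κ ^ 2)) = s * (-1) := by rw [h3]
      linear_combination this + (-t * √(h z z + ε * κ ^ 2)) * hs
    rw [hνt, smul_smul, ← ht']
  · intro hν
    rw [smul_smul] at hν
    set t := -s * (√(h z z + ε * κ ^ 2))⁻¹ with ht
    refine ⟨?_, ?_, ?_, ?_⟩
    · rw [hν, dilatedMetric_apply]
      simp only [map_smul, map_sub, smul_apply, sub_apply, smul_eq_mul, hwY, H.w_reeb, hhY, hz0,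
        H.h_reeb]
      field_simp; ring
    · rw [hν, dilatedMetric_apply]
      simp only [map_smul, map_sub, smul_apply, sub_apply, smul_eq_mul, hwY, H.w_reeb, hhY, hz1,
        H.h_reeb]
      field_simp; ring
    · rw [hν, hnorm, ht, mul_pow, inv_pow, hsq, neg_sq, hs, one_mul]
      exact inv_mul_cancel₀ hD.ne'
    · rw [hν, horient, ht]
      have : s * (-(-s * (√(h z z + ε * κ ^ 2))⁻¹) * (h z z + ε * κ ^ 2)) =
          s ^ 2 * ((√(h z z + ε * κ ^ 2))⁻¹ * (h z z + ε * κ ^ 2)) := by ring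
      rw [this, hs, one_mul]
      positivity

end UnitNormal

/-! ### Stability of positive definiteness -/

section PosDef

variable {X F : Type*} [TopologicalSpace X] [NormedAddCommGroup F] [NormedSpace ℝ F]
  [FiniteDimensional ℝ F]

/-- A continuous family of bilinear forms that is positive definite at a point is uniformly
positive definite nearby. -/
theorem eventually_le_of_posDef {Q : X → F →L[ℝ] F →L[ℝ] ℝ} {x₀ : X} (hQ : ContinuousAt Q x₀)
    (hpos : ∀ u, u ≠ 0 → 0 < Q x₀ u u) :
    ∃ c > 0, ∀ᶠ x in 𝓝 x₀, ∀ u, c * ‖u‖ ^ 2 ≤ Q x u u := by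
  obtain ⟨c, hc, hle⟩ : ∃ c > 0, ∀ u, c * ‖u‖ ^ 2 ≤ Q x₀ u u := by
    have : ProperSpace F := FiniteDimensional.proper ℝ F
    rcases (Metric.sphere (0 : F) 1).eq_empty_or_nonempty with he | hne
    · refine ⟨1, one_pos, fun u ↦ ?_⟩
      by_cases hu : u = 0
      · simp [hu]
      · exfalso
        have : ‖u‖⁻¹ • u ∈ Metric.sphere (0 : F) 1 := by
          rw [mem_sphere_zero_iff_norm, norm_smul, norm_inv, norm_norm,
            inv_mul_cancel₀ (norm_ne_zero_iff.2 hu)]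
        rw [he] at this; exact this
    · obtain ⟨v, hv, hmin⟩ := (isCompact_sphere (0 : F) 1).exists_isMinOn hne
        (f := fun u ↦ Q x₀ u u) (by fun_prop)
      have hv1 : ‖v‖ = 1 := mem_sphere_zero_iff_norm.1 hv
      refine ⟨Q x₀ v v, hpos v (by rintro rfl; simp at hv1), fun u ↦ ?_⟩
      by_cases hu : u = 0
      · simp [hu]
      · have hu' := norm_pos_iff.2 hu
        have hm : ‖u‖⁻¹ • u ∈ Metric.sphere (0 : F) 1 := by
          rw [mem_sphere_zero_iff_norm, norm_smul, norm_inv, norm_norm, inv_mul_cancel₀ hu'.ne']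
        have := hmin hm
        simp only [mem_ofPred_eq, map_smul, smul_apply, smul_eq_mul] at this
        calc Q x₀ v v * ‖u‖ ^ 2 ≤ (‖u‖⁻¹ * (‖u‖⁻¹ * Q x₀ u u)) * ‖u‖ ^ 2 := by gcongr
          _ = Q x₀ u u := by field_simp
  -- `c` is the minimum of the quadratic form on the unit sphere; a perturbation of norm below `c /
  -- 2` leaves half of it.
  refine ⟨c / 2, half_pos hc, ?_⟩
  have hev : ∀ᶠ x in 𝓝 x₀, ‖Q x - Q x₀‖ < c / 2 := by
    have : ContinuousAt (fun x ↦ ‖Q x - Q x₀‖) x₀ := (hQ.sub continuousAt_const).norm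
    exact this.eventually_lt_const (by simpa using half_pos hc)
  filter_upwards [hev] with x hx u
  have h1 : ‖(Q x - Q x₀) u u‖ ≤ ‖Q x - Q x₀‖ * ‖u‖ * ‖u‖ := (Q x - Q x₀).le_opNorm₂ u u
  have h2 : ‖Q x - Q x₀‖ * ‖u‖ * ‖u‖ ≤ c / 2 * ‖u‖ * ‖u‖ := by gcongr
  have h3 := neg_abs_le ((Q x - Q x₀) u u)
  rw [Real.norm_eq_abs] at h1
  have h4 : (Q x - Q x₀) u u = Q x u u - Q x₀ u u := rfl
  nlinarith [hle u]

end PosDef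

/-! ### Second derivatives and changes of coordinates at a point -/

section Transition

variable {E F G : Type*} [NormedAddCommGroup E] [NormedSpace ℝ E] [NormedAddCommGroup F]
  [NormedSpace ℝ F] [NormedAddCommGroup G] [NormedSpace ℝ G]

theorem fderiv_fderiv_apply {f : E → F} {x : E} (hf : ContDiffAt ℝ 2 f x) (u v : E) :
    fderiv ℝ (fun z ↦ fderiv ℝ f z v) x u = fderiv ℝ (fderiv ℝ f) x u v := by
  have : DifferentiableAt ℝ (fderiv ℝ f) x :=
    (hf.fderiv_right (m := 1) (by norm_num)).differentiableAt (by norm_num)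
  rw [(this.hasFDerivAt.clm_apply (hasFDerivAt_const v x)).fderiv]
  simp

theorem fderiv_fderiv_symm {f : E → F} {x : E} (hf : ContDiffAt ℝ 2 f x) (u v : E) :
    fderiv ℝ (fderiv ℝ f) x u v = fderiv ℝ (fderiv ℝ f) x v u :=
  (hf.isSymmSndFDerivAt (by simp)).eq u v

theorem fderiv_fderiv_comp {g : F → G} {f : E → F} {x : E} (hg : ContDiffAt ℝ 2 g (f x))
    (hf : ContDiffAt ℝ 2 f x) (u v : E) :
    fderiv ℝ (fderiv ℝ (g ∘ f)) x u v =
      fderiv ℝ (fderiv ℝ g) (f x) (fderiv ℝ f x u) (fderiv ℝ f x v) +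
        fderiv ℝ g (f x) (fderiv ℝ (fderiv ℝ f) x u v) := by
  have hf' : DifferentiableAt ℝ (fderiv ℝ f) x :=
    (hf.fderiv_right (m := 1) (by norm_num)).differentiableAt (by norm_num)
  have hg' : DifferentiableAt ℝ (fderiv ℝ g) (f x) :=
    (hg.fderiv_right (m := 1) (by norm_num)).differentiableAt (by norm_num)
  have hev : fderiv ℝ (g ∘ f) =ᶠ[𝓝 x] fun z ↦ (fderiv ℝ g (f z)).comp (fderiv ℝ f z) := by
    have h1 := hf.eventually (by simp)
    have h2 := hf.continuousAt.eventually (hg.eventually (by simp))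
    filter_upwards [h1, h2] with z hz1 hz2
    exact fderiv_comp z (hz2.differentiableAt (by simp)) (hz1.differentiableAt (by simp))
  rw [hev.fderiv_eq]
  have hfd := (hf.differentiableAt (by simp)).hasFDerivAt
  have := (hg'.hasFDerivAt.comp x hfd).clm_comp hf'.hasFDerivAt
  simp only [Function.comp_def] at this
  rw [this.fderiv]
  simp [add_comm]

/-- In the Christoffel combination the terms containing `T₂` cancel in pairs, except two equal ones
that sum to `2 B (T₂ p q) (T ν)`. This is the term by which the second derivative of the composed
parametrization changes. -/
theorem secondFormLin_pullback {B : G →L[ℝ] G →L[ℝ] ℝ} {B' : G → G → G → ℝ} (T : F →L[ℝ] G)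
    (T₂ : F → F → G) (hB : ∀ u v, B u v = B v u) (hT₂ : ∀ u v, T₂ u v = T₂ v u)
    {C : F →L[ℝ] F →L[ℝ] ℝ} {C' : F → F → F → ℝ} (hC : ∀ u v, C u v = B (T u) (T v))
    (hC' : ∀ e u v, C' e u v = B' (T e) (T u) (T v) + B (T₂ e u) (T v) + B (T u) (T₂ e v))
    (p q s ν : F) : secondFormLin C C' p q s ν =
      secondFormLin B B' (T p) (T q) (T s + T₂ p q) (T ν) := by
  simp only [secondFormLin, hC, hC', map_add, add_apply, hT₂ q p, hT₂ ν p, hT₂ ν q,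
    hB (T q), hB (T p)]
  ring

/-- The `tᵢⱼ` are the tangential terms produced by the second derivative of the reparametrization;
they are orthogonal to `ν` and drop out. Both fundamental forms then transform as quadratic forms,
so numerator and denominator are both multiplied by the squared Jacobian determinant. -/
theorem meanCurvatureLin_reparam {B : F →L[ℝ] F →L[ℝ] ℝ} {B' : F → F → F → ℝ}
    (hB : ∀ u v, B u v = B v u)
    (h1a : ∀ e e' u v, B' (e + e') u v = B' e u v + B' e' u v)
    (h1s : ∀ (t : ℝ) e u v, B' (t • e) u v = t * B' e u v)
    (h2a : ∀ e u u' v, B' e (u + u') v = B' e u v + B' e u' v)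
    (h2s : ∀ (t : ℝ) e u v, B' e (t • u) v = t * B' e u v)
    (h3a : ∀ e u v v', B' e u (v + v') = B' e u v + B' e u v')
    (h3s : ∀ (t : ℝ) e u v, B' e u (t • v) = t * B' e u v)
    {a b c d : ℝ} (hdet : a * d - b * c ≠ 0) {p₀ p₁ s₀₀ s₀₁ s₁₁ t₀₀ t₀₁ t₁₁ ν : F}
    (h00 : B t₀₀ ν = 0) (h01 : B t₀₁ ν = 0) (h11 : B t₁₁ ν = 0)
    (hBsym : ∀ e u v, B' e u v = B' e v u) :
    meanCurvatureLin B B' (a • p₀ + b • p₁) (c • p₀ + d • p₁)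
      (a ^ 2 • s₀₀ + (2 * a * b) • s₀₁ + b ^ 2 • s₁₁ + t₀₀)
      ((a * c) • s₀₀ + (a * d + b * c) • s₀₁ + (b * d) • s₁₁ + t₀₁)
      (c ^ 2 • s₀₀ + (2 * c * d) • s₀₁ + d ^ 2 • s₁₁ + t₁₁) ν =
    meanCurvatureLin B B' p₀ p₁ s₀₀ s₀₁ s₁₁ ν := by
  simp only [meanCurvatureLin]
  have e1 : secondFormLin B B' (a • p₀ + b • p₁) (a • p₀ + b • p₁)
      (a ^ 2 • s₀₀ + (2 * a * b) • s₀₁ + b ^ 2 • s₁₁ + t₀₀) ν =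
      a ^ 2 * secondFormLin B B' p₀ p₀ s₀₀ ν + 2 * a * b * secondFormLin B B' p₀ p₁ s₀₁ ν
        + b ^ 2 * secondFormLin B B' p₁ p₁ s₁₁ ν := by
    simp only [secondFormLin, map_add, map_smul, add_apply, smul_apply, smul_eq_mul, h1a, h1s, h2a,
      h2s, h3a, h3s, h00, hBsym ν p₁ p₀]
    ring
  have e2 : secondFormLin B B' (a • p₀ + b • p₁) (c • p₀ + d • p₁)
      ((a * c) • s₀₀ + (a * d + b * c) • s₀₁ + (b * d) • s₁₁ + t₀₁) ν =
      a * c * secondFormLin B B' p₀ p₀ s₀₀ ν + (a * d + b * c) * secondFormLin B B' p₀ p₁ s₀₁ ν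
        + b * d * secondFormLin B B' p₁ p₁ s₁₁ ν := by
    simp only [secondFormLin, map_add, map_smul, add_apply, smul_apply, smul_eq_mul, h1a, h1s, h2a,
      h2s, h3a, h3s, h01, hBsym ν p₁ p₀]
    ring
  have e3 : secondFormLin B B' (c • p₀ + d • p₁) (c • p₀ + d • p₁)
      (c ^ 2 • s₀₀ + (2 * c * d) • s₀₁ + d ^ 2 • s₁₁ + t₁₁) ν =
      c ^ 2 * secondFormLin B B' p₀ p₀ s₀₀ ν + 2 * c * d * secondFormLin B B' p₀ p₁ s₀₁ ν
        + d ^ 2 * secondFormLin B B' p₁ p₁ s₁₁ ν := by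
    simp only [secondFormLin, map_add, map_smul, add_apply, smul_apply, smul_eq_mul, h1a, h1s, h2a,
      h2s, h3a, h3s, h11, hBsym ν p₁ p₀]
    ring
  rw [e1, e2, e3]
  simp only [map_add, map_smul, add_apply, smul_apply, smul_eq_mul, hB p₁ p₀]
  rw [← mul_div_mul_left _ (B p₀ p₀ * B p₁ p₁ - B p₀ p₁ ^ 2) (pow_ne_zero 2 hdet)]
  congr 1 <;> ring

end Transition

/-! ### Invariance of the mean curvature of a parametrized surface -/

section Param

theorem meanCurvatureParam_eq_lin {G : EuclideanSpace ℝ (Fin 3) → EuclideanSpace ℝ (Fin 3) →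
      EuclideanSpace ℝ (Fin 3) → ℝ}
    {f : EuclideanSpace ℝ (Fin 2) → EuclideanSpace ℝ (Fin 3)} {x : EuclideanSpace ℝ (Fin 2)}
    (hf : ContDiffAt ℝ 2 f x)
    {B : EuclideanSpace ℝ (Fin 3) →L[ℝ] EuclideanSpace ℝ (Fin 3) →L[ℝ] ℝ}
    {B' : EuclideanSpace ℝ (Fin 3) → EuclideanSpace ℝ (Fin 3) → EuclideanSpace ℝ (Fin 3) → ℝ}
    (hB : ∀ a b, G (f x) a b = B a b)
    (hB' : ∀ a b e, fderiv ℝ (fun y ↦ G y a b) (f x) e = B' e a b)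
    (ν : EuclideanSpace ℝ (Fin 3)) :
    meanCurvatureParam G f x ν = meanCurvatureLin B B'
      (fderiv ℝ f x (EuclideanSpace.single 0 1)) (fderiv ℝ f x (EuclideanSpace.single 1 1))
      (fderiv ℝ (fderiv ℝ f) x (EuclideanSpace.single 0 1) (EuclideanSpace.single 0 1))
      (fderiv ℝ (fderiv ℝ f) x (EuclideanSpace.single 0 1) (EuclideanSpace.single 1 1))
      (fderiv ℝ (fderiv ℝ f) x (EuclideanSpace.single 1 1) (EuclideanSpace.single 1 1)) ν := by
  simp only [meanCurvatureParam, meanCurvatureLin, firstForm, secondForm, secondFormLin, hB, hB',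
    fderiv_fderiv_apply hf]

theorem eq_single_add_single (u : EuclideanSpace ℝ (Fin 2)) :
    u = u 0 • EuclideanSpace.single 0 (1 : ℝ) + u 1 • EuclideanSpace.single 1 (1 : ℝ) := by
  ext i; fin_cases i <;> simp

theorem det_ne_zero_of_injective
    {L : EuclideanSpace ℝ (Fin 2) →L[ℝ] EuclideanSpace ℝ (Fin 2)} (hL : Function.Injective L) :
    L (EuclideanSpace.single 0 1) 0 * L (EuclideanSpace.single 1 1) 1 -
      L (EuclideanSpace.single 0 1) 1 * L (EuclideanSpace.single 1 1) 0 ≠ 0 := by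
  intro h
  set a := L (EuclideanSpace.single 0 1) with ha
  set b := L (EuclideanSpace.single 1 1) with hb
  -- `L` sends this vector to one whose coordinates are `0` or, up to sign, the determinant.
  have key : ∀ i, b i • EuclideanSpace.single (0 : Fin 2) (1 : ℝ) - a i • EuclideanSpace.single 1 1
      = (0 : EuclideanSpace ℝ (Fin 2)) := by
    intro i
    apply hL
    rw [map_zero, map_sub, map_smul, map_smul, ← ha, ← hb]
    ext j
    fin_cases i <;> fin_cases j <;> simp <;> linarith
  have ha0 : ∀ i, a i = 0 := fun i ↦ by
    have := congrArg (fun v ↦ v 1) (key i)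
    simpa using this
  have : a = 0 := by ext i; simp [ha0]
  rw [ha, map_eq_zero_iff L hL] at this
  have := congrArg (fun v ↦ v 0) this
  simp at this

set_option maxHeartbeats 1600000 in
/-- The mean curvature of a parametrized surface does not depend on the coordinates of the ambient
space, nor on the parametrization. -/
theorem meanCurvatureParam_transition
    {G G' : EuclideanSpace ℝ (Fin 3) → EuclideanSpace ℝ (Fin 3) → EuclideanSpace ℝ (Fin 3) → ℝ}
    {f f' : EuclideanSpace ℝ (Fin 2) → EuclideanSpace ℝ (Fin 3)}
    {σ : EuclideanSpace ℝ (Fin 2) → EuclideanSpace ℝ (Fin 2)}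
    {τ : EuclideanSpace ℝ (Fin 3) → EuclideanSpace ℝ (Fin 3)}
    {x : EuclideanSpace ℝ (Fin 2)} (hf' : ContDiffAt ℝ 2 f' x) (hf : ContDiffAt ℝ 2 f (σ x))
    (hσ : ContDiffAt ℝ 2 σ x) (hτ : ContDiffAt ℝ 2 τ (f' x)) (hfτ : τ ∘ f' =ᶠ[𝓝 x] f ∘ σ)
    (hσi : Function.Injective (fderiv ℝ σ x))
    {B : EuclideanSpace ℝ (Fin 3) → EuclideanSpace ℝ (Fin 3) →L[ℝ] EuclideanSpace ℝ (Fin 3) →L[ℝ] ℝ}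
    (hB : DifferentiableAt ℝ B (f (σ x))) (hGB : ∀ᶠ y in 𝓝 (f (σ x)), ∀ a b, G y a b = B y a b)
    (hG' : ∀ᶠ y in 𝓝 (f' x), ∀ a b, G' y a b = G (τ y) (fderiv ℝ τ y a) (fderiv ℝ τ y b))
    (hsymm : ∀ᶠ y in 𝓝 (f (σ x)), ∀ a b, B y a b = B y b a)
    {ν : EuclideanSpace ℝ (Fin 3)}
    (hν : ∀ u, B (f (σ x)) (fderiv ℝ f (σ x) u) (fderiv ℝ τ (f' x) ν) = 0) :
    meanCurvatureParam G' f' x ν = meanCurvatureParam G f (σ x) (fderiv ℝ τ (f' x) ν) := by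
  have hx : τ (f' x) = f (σ x) := hfτ.self_of_nhds
  set T := fderiv ℝ τ (f' x) with hT
  have hτ' : DifferentiableAt ℝ (fderiv ℝ τ) (f' x) :=
    (hτ.fderiv_right (m := 1) (by norm_num)).differentiableAt (by norm_num)
  have hτt : Tendsto τ (𝓝 (f' x)) (𝓝 (f (σ x))) := by
    rw [← hx]; exact hτ.continuousAt
  have hG'B : ∀ᶠ y in 𝓝 (f' x), ∀ a b,
      G' y a b = B (τ y) (fderiv ℝ τ y a) (fderiv ℝ τ y b) := by
    filter_upwards [hG', hτt.eventually hGB] with y h1 h2 a b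
    rw [h1, h2]
  have hBτ : HasFDerivAt (fun y ↦ B (τ y)) ((fderiv ℝ B (f (σ x))).comp T) (f' x) := by
    refine HasFDerivAt.comp (g := B) (f' x) ?_ (hτ.differentiableAt (by simp)).hasFDerivAt
    rw [hx]; exact hB.hasFDerivAt
  have hderiv : ∀ a b e, fderiv ℝ (fun y ↦ G' y a b) (f' x) e =
      fderiv ℝ B (f (σ x)) (T e) (T a) (T b)
        + B (f (σ x)) (fderiv ℝ (fderiv ℝ τ) (f' x) e a) (T b)
        + B (f (σ x)) (T a) (fderiv ℝ (fderiv ℝ τ) (f' x) e b) := by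
    intro a b e
    have h1 : (fun y ↦ G' y a b) =ᶠ[𝓝 (f' x)]
        fun y ↦ B (τ y) (fderiv ℝ τ y a) (fderiv ℝ τ y b) := hG'B.mono fun y h ↦ h a b
    rw [h1.fderiv_eq]
    have ha := hτ'.hasFDerivAt.clm_apply (hasFDerivAt_const a (f' x))
    have hb := hτ'.hasFDerivAt.clm_apply (hasFDerivAt_const b (f' x))
    rw [((hBτ.clm_apply ha).clm_apply hb).fderiv]
    simp [hx, ← hT]
    ring
  have hderivG : ∀ a b e, fderiv ℝ (fun y ↦ G y a b) (f (σ x)) e = fderiv ℝ B (f (σ x)) e a b := by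
    intro a b e
    have h1 : (fun y ↦ G y a b) =ᶠ[𝓝 (f (σ x))] fun y ↦ B y a b := hGB.mono fun y h ↦ h a b
    rw [h1.fderiv_eq, ((hB.hasFDerivAt.clm_apply (hasFDerivAt_const a _)).clm_apply
      (hasFDerivAt_const b _)).fderiv]
    simp
  have hs := hsymm.self_of_nhds
  have hs' : ∀ e u v, fderiv ℝ B (f (σ x)) e u v = fderiv ℝ B (f (σ x)) e v u := by
    intro e u v
    rw [← hderivG, ← hderivG]
    have h1 : (fun y ↦ G y u v) =ᶠ[𝓝 (f (σ x))] fun y ↦ G y v u := by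
      filter_upwards [hGB, hsymm] with y h1 h2
      rw [h1, h2, h1]
    rw [h1.fderiv_eq]
  have hp : ∀ u, T (fderiv ℝ f' x u) = fderiv ℝ f (σ x) (fderiv ℝ σ x u) := by
    intro u
    have := hfτ.fderiv_eq (𝕜 := ℝ)
    rw [fderiv_comp x (hτ.differentiableAt (by simp)) (hf'.differentiableAt (by simp)),
      fderiv_comp x (hf.differentiableAt (by simp)) (hσ.differentiableAt (by simp))] at this
    exact congrArg (fun L ↦ L u) this
  -- The second-order chain rule applied to both sides of `τ ∘ f' = f ∘ σ`.
  have hpp : ∀ u v, T (fderiv ℝ (fderiv ℝ f') x u v) +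
      fderiv ℝ (fderiv ℝ τ) (f' x) (fderiv ℝ f' x u) (fderiv ℝ f' x v) =
      fderiv ℝ (fderiv ℝ f) (σ x) (fderiv ℝ σ x u) (fderiv ℝ σ x v) +
        fderiv ℝ f (σ x) (fderiv ℝ (fderiv ℝ σ) x u v) := by
    intro u v
    rw [← fderiv_fderiv_comp hf hσ, ← (hfτ.fderiv (𝕜 := ℝ)).fderiv_eq, fderiv_fderiv_comp hτ hf',
      add_comm]
  rw [meanCurvatureParam_eq_lin hf' (B := (B (f (σ x))).bilinearComp T T)
    (B' := fun e a b ↦ fderiv ℝ B (f (σ x)) (T e) (T a) (T b)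
        + B (f (σ x)) (fderiv ℝ (fderiv ℝ τ) (f' x) e a) (T b)
        + B (f (σ x)) (T a) (fderiv ℝ (fderiv ℝ τ) (f' x) e b))
    (fun a b ↦ by rw [hG'B.self_of_nhds, hx]; rfl) hderiv,
    meanCurvatureParam_eq_lin hf (fun a b ↦ hGB.self_of_nhds a b) hderivG]
  have hpull : ∀ p q s, secondFormLin ((B (f (σ x))).bilinearComp T T)
      (fun e a b ↦ fderiv ℝ B (f (σ x)) (T e) (T a) (T b)
        + B (f (σ x)) (fderiv ℝ (fderiv ℝ τ) (f' x) e a) (T b)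
        + B (f (σ x)) (T a) (fderiv ℝ (fderiv ℝ τ) (f' x) e b)) p q s ν =
      secondFormLin (B (f (σ x))) (fun e u v ↦ fderiv ℝ B (f (σ x)) e u v) (T p) (T q)
        (T s + fderiv ℝ (fderiv ℝ τ) (f' x) p q) (T ν) := fun p q s ↦
    secondFormLin_pullback (B' := fun e u v ↦ fderiv ℝ B (f (σ x)) e u v)
      (C := (B (f (σ x))).bilinearComp T T) T (fun u v ↦ fderiv ℝ (fderiv ℝ τ) (f' x) u v) hs
      (fun u v ↦ fderiv_fderiv_symm hτ u v) (fun u v ↦ rfl) (fun e u v ↦ rfl) p q s ν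
  have hdet := det_ne_zero_of_injective hσi
  set e₀ : EuclideanSpace ℝ (Fin 2) := EuclideanSpace.single 0 1 with he₀
  set e₁ : EuclideanSpace ℝ (Fin 2) := EuclideanSpace.single 1 1 with he₁
  set a := fderiv ℝ σ x e₀ 0
  set b := fderiv ℝ σ x e₀ 1
  set c := fderiv ℝ σ x e₁ 0
  set d := fderiv ℝ σ x e₁ 1
  have hσ0 : fderiv ℝ σ x e₀ = a • e₀ + b • e₁ := eq_single_add_single _
  have hσ1 : fderiv ℝ σ x e₁ = c • e₀ + d • e₁ := eq_single_add_single _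
  have h10 := fderiv_fderiv_symm hf e₁ e₀
  rw [← meanCurvatureLin_reparam (a := a) (b := b) (c := c) (d := d) hs (by simp) (by simp)
    (by simp) (by simp) (by simp) (by simp) hdet
    (hν (fderiv ℝ (fderiv ℝ σ) x e₀ e₀)) (hν (fderiv ℝ (fderiv ℝ σ) x e₀ e₁))
    (hν (fderiv ℝ (fderiv ℝ σ) x e₁ e₁)) hs']
  have q00 : T (fderiv ℝ (fderiv ℝ f') x e₀ e₀) +
      fderiv ℝ (fderiv ℝ τ) (f' x) (fderiv ℝ f' x e₀) (fderiv ℝ f' x e₀) =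
      a ^ 2 • fderiv ℝ (fderiv ℝ f) (σ x) e₀ e₀ + (2 * a * b) • fderiv ℝ (fderiv ℝ f) (σ x) e₀ e₁
      + b ^ 2 • fderiv ℝ (fderiv ℝ f) (σ x) e₁ e₁ +
      fderiv ℝ f (σ x) (fderiv ℝ (fderiv ℝ σ) x e₀ e₀) := by
    rw [hpp, hσ0]
    simp only [map_add, map_smul, add_apply, smul_apply, h10]
    module
  have q01 : T (fderiv ℝ (fderiv ℝ f') x e₀ e₁) +
      fderiv ℝ (fderiv ℝ τ) (f' x) (fderiv ℝ f' x e₀) (fderiv ℝ f' x e₁) =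
      (a * c) • fderiv ℝ (fderiv ℝ f) (σ x) e₀ e₀
      + (a * d + b * c) • fderiv ℝ (fderiv ℝ f) (σ x) e₀ e₁
      + (b * d) • fderiv ℝ (fderiv ℝ f) (σ x) e₁ e₁ +
      fderiv ℝ f (σ x) (fderiv ℝ (fderiv ℝ σ) x e₀ e₁) := by
    rw [hpp, hσ0, hσ1]
    simp only [map_add, map_smul, add_apply, smul_apply, h10]
    module
  have q11 : T (fderiv ℝ (fderiv ℝ f') x e₁ e₁) +
      fderiv ℝ (fderiv ℝ τ) (f' x) (fderiv ℝ f' x e₁) (fderiv ℝ f' x e₁) =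
      c ^ 2 • fderiv ℝ (fderiv ℝ f) (σ x) e₀ e₀ + (2 * c * d) • fderiv ℝ (fderiv ℝ f) (σ x) e₀ e₁
      + d ^ 2 • fderiv ℝ (fderiv ℝ f) (σ x) e₁ e₁ +
      fderiv ℝ f (σ x) (fderiv ℝ (fderiv ℝ σ) x e₁ e₁) := by
    rw [hpp, hσ1]
    simp only [map_add, map_smul, add_apply, smul_apply, h10]
    module
  have p0 : T (fderiv ℝ f' x e₀) = a • fderiv ℝ f (σ x) e₀ + b • fderiv ℝ f (σ x) e₁ := by
    rw [hp, hσ0, map_add, map_smul, map_smul]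
  have p1 : T (fderiv ℝ f' x e₁) = c • fderiv ℝ f (σ x) e₀ + d • fderiv ℝ f (σ x) e₁ := by
    rw [hp, hσ1, map_add, map_smul, map_smul]
  rw [← q00, ← q01, ← q11, ← p0, ← p1]
  simp only [meanCurvatureLin, hpull]
  rfl

end Param

/-! ### Contact structures and surfaces in coordinates -/

section Chart

/-- The exterior derivative of a one-form on a vector space. -/
noncomputable def dForm {V : Type*} [NormedAddCommGroup V] [NormedSpace ℝ V] (w : V → V →L[ℝ] ℝ)
    (y : V) : V →L[ℝ] V →L[ℝ] ℝ :=
  fderiv ℝ w y - (fderiv ℝ w y).flip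

/-- A normalized analytic contact structure near the point `y₀` of a vector space. -/
structure IsContactGerm {V : Type*} [NormedAddCommGroup V] [NormedSpace ℝ V]
    (w : V → V →L[ℝ] ℝ) (h : V → V →L[ℝ] V →L[ℝ] ℝ) (R : V → V) (y₀ : V) : Prop where
  form : ContDiffAt ℝ ω w y₀
  metric : ContDiffAt ℝ ω h y₀
  reeb : ContDiffAt ℝ ω R y₀
  data : ∀ᶠ y in 𝓝 y₀, IsContactData (w y) (dForm w y) (h y) (R y)
  frame : ∃ a c, w y₀ a = 0 ∧ w y₀ c = 0 ∧ dForm w y₀ a c ≠ 0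

/-- The projection of the constant vector `a` to the contact planes. -/
noncomputable def horizontalPart {V : Type*} [NormedAddCommGroup V] [NormedSpace ℝ V]
    (w : V → V →L[ℝ] ℝ) (R : V → V) (a y : V) : V :=
  a - w y a • R y

variable {V : Type*} [NormedAddCommGroup V] [NormedSpace ℝ V]

local notation "E2" => EuclideanSpace ℝ (Fin 2)

/-- The partial derivatives of a parametrization. -/
noncomputable def partialDeriv (f : E2 → V) (i : Fin 2) (x : E2) : V :=
  fderiv ℝ f x (EuclideanSpace.single i 1)

/-- The second partial derivatives of a parametrization. -/
noncomputable def partialDeriv₂ (f : E2 → V) (i j : Fin 2) (x : E2) : V :=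
  fderiv ℝ (fderiv ℝ f) x (EuclideanSpace.single i 1) (EuclideanSpace.single j 1)

/-- The tangent vector field of a parametrized surface that spans the characteristic foliation. -/
noncomputable def charField (w : V → V →L[ℝ] ℝ) (f : E2 → V) (x : E2) : V :=
  w (f x) (partialDeriv f 1 x) • partialDeriv f 0 x
    - w (f x) (partialDeriv f 0 x) • partialDeriv f 1 x

/-- The rotated characteristic vector field, in terms of the frame of the contact planes given by
the constant vectors `a` and `c`. -/
noncomputable def rotField (w : V → V →L[ℝ] ℝ) (h : V → V →L[ℝ] V →L[ℝ] ℝ) (R : V → V) (a c : V)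
    (f : E2 → V) (x : E2) : V :=
  quarterTurn (dForm w (f x)) (h (f x)) (horizontalPart w R a (f x)) (horizontalPart w R c (f x))
    (charField w f x)

/-- The limit of the mean curvatures of a parametrized surface, up to sign. -/
noncomputable def chartCurvature (w : V → V →L[ℝ] ℝ) (h : V → V →L[ℝ] V →L[ℝ] ℝ) (R : V → V)
    (a c : V) (f : E2 → V) (x : E2) : ℝ :=
  limitCurvature (h (f x)) (fun e u v ↦ fderiv ℝ h (f x) e u v) (w (f x)) (fderiv ℝ w (f x))
    (partialDeriv f 0 x) (partialDeriv f 1 x) (partialDeriv₂ f 0 0 x) (partialDeriv₂ f 0 1 x)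
    (partialDeriv₂ f 1 1 x) (rotField w h R a c f x)
    (dForm w (f x) (partialDeriv f 0 x) (partialDeriv f 1 x))
    (h (f x) (charField w f x) (charField w f x))

variable {w : V → V →L[ℝ] ℝ} {h : V → V →L[ℝ] V →L[ℝ] ℝ} {R : V → V} {f : E2 → V} {x₀ : E2}

/-- A frame at `y₀` is extended by constants and projected to the contact planes; by continuity it
stays a frame nearby. This makes the quarter turn a continuous field near `y₀`. -/
theorem IsContactGerm.exists_frame {y₀ : V} (H : IsContactGerm w h R y₀) :
    ∃ a c, ∀ᶠ y in 𝓝 y₀, w y (horizontalPart w R a y) = 0 ∧ w y (horizontalPart w R c y) = 0 ∧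
      dForm w y (horizontalPart w R a y) (horizontalPart w R c y) ≠ 0 := by
  obtain ⟨a, c, ha, hc, hac⟩ := H.frame
  refine ⟨a, c, ?_⟩
  have hw := H.form.continuousAt
  have hR := H.reeb.continuousAt
  have hw' : ContinuousAt (fderiv ℝ w) y₀ :=
    (H.form.fderiv_right (m := 0) (by simp)).continuousAt
  have hflip : ContinuousAt (fun y ↦ (fderiv ℝ w y).flip) y₀ :=
    (ContinuousLinearMap.flipₗᵢ ℝ V V ℝ).continuous.continuousAt.comp hw'
  have hcont : ContinuousAt (fun y ↦ dForm w y (horizontalPart w R a y) (horizontalPart w R c y))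
      y₀ := by
    unfold dForm horizontalPart
    fun_prop
  have h0 : dForm w y₀ (horizontalPart w R a y₀) (horizontalPart w R c y₀) ≠ 0 := by
    simpa [horizontalPart, ha, hc] using hac
  filter_upwards [hcont.eventually_ne h0, H.data] with y h1 h2
  exact ⟨by simp [horizontalPart, h2.w_reeb], by simp [horizontalPart, h2.w_reeb], h1⟩

/-- The form `h + w ⊗ w` is positive definite, and so is its pullback by the injective differential
of `f`, uniformly near `x₀`. On the coordinate vector `(w p₁, -w p₀)`, whose image is the
characteristic field, the term `w ⊗ w` vanishes. -/
theorem exists_le_charField [FiniteDimensional ℝ V] (H : IsContactGerm w h R (f x₀))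
    (hf : ContDiffAt ℝ ω f x₀) (hinj : Function.Injective (fderiv ℝ f x₀)) :
    ∃ C > 0, ∀ᶠ x in 𝓝 x₀,
      C * (w (f x) (partialDeriv f 0 x) ^ 2 + w (f x) (partialDeriv f 1 x) ^ 2) ≤
        h (f x) (charField w f x) (charField w f x) := by
  have hw : ContinuousAt (fun x ↦ w (f x)) x₀ := H.form.continuousAt.comp hf.continuousAt
  have hh : ContinuousAt (fun x ↦ h (f x)) x₀ :=
    ContinuousAt.comp (g := h) H.metric.continuousAt hf.continuousAt
  have hD : ContinuousAt (fderiv ℝ f) x₀ := (hf.fderiv_right (m := 0) (by simp)).continuousAt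
  have hQ : ContinuousAt (fun x ↦ ((h (f x) + (w (f x)).smulRight (w (f x))).bilinearComp
      (fderiv ℝ f x) (fderiv ℝ f x))) x₀ := by
    have e : (fun x ↦ ((h (f x) + (w (f x)).smulRight (w (f x))).bilinearComp
      (fderiv ℝ f x) (fderiv ℝ f x))) = fun x ↦ ((ContinuousLinearMap.compL ℝ E2 V ℝ).flip
        (fderiv ℝ f x)).comp ((h (f x) + ContinuousLinearMap.smulRightL ℝ V (V →L[ℝ] ℝ) (w (f x))
          (w (f x))).comp (fderiv ℝ f x)) := by
      ext x u v; simp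
    rw [e]
    have hfl : ContinuousAt (fun x ↦ (ContinuousLinearMap.compL ℝ E2 V ℝ).flip (fderiv ℝ f x)) x₀ :=
      ((ContinuousLinearMap.compL ℝ E2 V ℝ).flip.continuous.continuousAt).comp hD
    have hsm : ContinuousAt (fun x ↦ ContinuousLinearMap.smulRightL ℝ V (V →L[ℝ] ℝ) (w (f x))
        (w (f x))) x₀ :=
      (((ContinuousLinearMap.smulRightL ℝ V (V →L[ℝ] ℝ)).continuous.continuousAt).comp hw).clm_apply
        hw
    exact hfl.clm_comp (ContinuousAt.clm_comp (hh.add hsm) hD)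
  have hdata := H.data.self_of_nhds
  obtain ⟨C, hC, hle⟩ := eventually_le_of_posDef hQ (fun u hu ↦ by
    set v := fderiv ℝ f x₀ u with hv
    have hv0 : v ≠ 0 := by rw [hv]; exact (map_ne_zero_iff _ hinj).2 hu
    simp only [ContinuousLinearMap.bilinearComp_apply, ← hv, add_apply,
      ContinuousLinearMap.smulRight_apply, smul_apply, smul_eq_mul]
    have hwv : w (f x₀) (v - w (f x₀) v • R (f x₀)) = 0 := by simp [hdata.w_reeb]
    have hh : h (f x₀) v v =
        h (f x₀) (v - w (f x₀) v • R (f x₀)) (v - w (f x₀) v • R (f x₀)) := by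
      simp [hdata.h_reeb, hdata.h_reeb']
    by_cases h0 : v - w (f x₀) v • R (f x₀) = 0
    · have : w (f x₀) v ≠ 0 := by
        intro h1; rw [h1, zero_smul, sub_zero] at h0; exact hv0 h0
      rw [hh, h0]; simp only [map_zero]
      have := mul_self_pos.2 this
      simpa using this
    · rw [hh]
      exact add_pos_of_pos_of_nonneg (hdata.h_pos _ hwv h0) (mul_self_nonneg _))
  refine ⟨C, hC, ?_⟩
  filter_upwards [hle] with x hx
  have := hx (w (f x) (partialDeriv f 1 x) • EuclideanSpace.single 0 1
    - w (f x) (partialDeriv f 0 x) • EuclideanSpace.single 1 1)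
  have e1 : fderiv ℝ f x (w (f x) (partialDeriv f 1 x) • EuclideanSpace.single 0 1
    - w (f x) (partialDeriv f 0 x) • EuclideanSpace.single 1 1) = charField w f x := by
    simp [charField, partialDeriv]
  have e2 : w (f x) (charField w f x) = 0 := by simp [charField]; ring
  rw [ContinuousLinearMap.bilinearComp_apply, e1] at this
  simp only [add_apply, ContinuousLinearMap.smulRight_apply, smul_apply, smul_eq_mul, e2] at this
  refine le_trans (le_of_eq ?_) (this.trans (le_of_eq (by ring)))
  rw [EuclideanSpace.norm_sq_eq]
  congr 1
  simp [add_comm]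

theorem ContDiffAt.partialDeriv {n : WithTop ℕ∞} {x : E2} (hf : ContDiffAt ℝ ω f x) (i : Fin 2) :
    ContDiffAt ℝ n (partialDeriv f i) x :=
  ((hf.fderiv_right (m := ω) (by simp)).clm_apply contDiffAt_const).of_le le_top

theorem ContDiffAt.continuousAt_partialDeriv₂ {x : E2} (hf : ContDiffAt ℝ ω f x) (i j : Fin 2) :
    ContinuousAt (partialDeriv₂ f i j) x :=
  ((((hf.fderiv_right (m := ω) (by simp)).fderiv_right (m := ω) (by simp)).clm_apply
    contDiffAt_const).clm_apply contDiffAt_const).continuousAt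

theorem continuousAt_dForm {y : V} (hw : ContDiffAt ℝ ω w y) : ContinuousAt (dForm w) y := by
  have hw' : ContinuousAt (fderiv ℝ w) y := (hw.fderiv_right (m := 0) (by simp)).continuousAt
  exact hw'.sub ((ContinuousLinearMap.flipₗᵢ ℝ V V ℝ).continuous.continuousAt.comp hw')

theorem continuousAt_charField {x : E2} (hw : ContDiffAt ℝ ω w (f x)) (hf : ContDiffAt ℝ ω f x) :
    ContinuousAt (charField w f) x := by
  have h1 : ContinuousAt (fun x ↦ w (f x)) x := hw.continuousAt.comp hf.continuousAt
  have h2 := (ContDiffAt.partialDeriv (n := 0) hf 0).continuousAt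
  have h3 := (ContDiffAt.partialDeriv (n := 0) hf 1).continuousAt
  unfold charField
  fun_prop

theorem continuousAt_rotField {x : E2} {a c : V} (hw : ContDiffAt ℝ ω w (f x))
    (hh : ContDiffAt ℝ ω h (f x)) (hR : ContDiffAt ℝ ω R (f x)) (hf : ContDiffAt ℝ ω f x)
    (hac : dForm w (f x) (horizontalPart w R a (f x)) (horizontalPart w R c (f x)) ≠ 0) :
    ContinuousAt (rotField w h R a c f) x := by
  have h1 : ContinuousAt (fun x ↦ w (f x)) x := hw.continuousAt.comp hf.continuousAt
  have h2 : ContinuousAt (fun x ↦ h (f x)) x :=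
    ContinuousAt.comp (g := h) hh.continuousAt hf.continuousAt
  have h3 : ContinuousAt (fun x ↦ R (f x)) x := ContinuousAt.comp hR.continuousAt hf.continuousAt
  have h4 : ContinuousAt (fun x ↦ dForm w (f x)) x :=
    ContinuousAt.comp (g := dForm w) (continuousAt_dForm hw) hf.continuousAt
  have h5 := continuousAt_charField hw hf
  have h6 : ContinuousAt (fun x ↦ horizontalPart w R a (f x)) x := by
    unfold horizontalPart; fun_prop
  have h7 : ContinuousAt (fun x ↦ horizontalPart w R c (f x)) x := by
    unfold horizontalPart; fun_prop
  have h8 : ContinuousAt (fun x ↦ dForm w (f x) (horizontalPart w R a (f x))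
      (horizontalPart w R c (f x))) x := by fun_prop
  unfold rotField quarterTurn
  exact (h8.inv₀ hac).smul (by fun_prop)

theorem continuousAt_regularForm {x : E2} (hw : ContDiffAt ℝ ω w (f x))
    (hh : ContDiffAt ℝ ω h (f x)) (hf : ContDiffAt ℝ ω f x) {Y : E2 → V} (hY : ContinuousAt Y x)
    {κ : E2 → ℝ} (hκ : ContinuousAt κ x) (i j : Fin 2) :
    ContinuousAt (fun x ↦ regularForm (h (f x)) (fun e u v ↦ fderiv ℝ h (f x) e u v) (w (f x))
      (fderiv ℝ w (f x)) (κ x) (partialDeriv f i x) (partialDeriv f j x) (partialDeriv₂ f i j x)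
      (Y x)) x := by
  have h1 : ContinuousAt (fun x ↦ w (f x)) x := hw.continuousAt.comp hf.continuousAt
  have h2 : ContinuousAt (fun x ↦ h (f x)) x :=
    ContinuousAt.comp (g := h) hh.continuousAt hf.continuousAt
  have h3 : ContinuousAt (fun x ↦ fderiv ℝ w (f x)) x :=
    ContinuousAt.comp (g := fderiv ℝ w) (hw.fderiv_right (m := 0) (by simp)).continuousAt
      hf.continuousAt
  have h4 : ContinuousAt (fun x ↦ fderiv ℝ h (f x)) x :=
    ContinuousAt.comp (g := fderiv ℝ h) (hh.fderiv_right (m := 0) (by simp)).continuousAt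
      hf.continuousAt
  have h5 := (ContDiffAt.partialDeriv (n := 0) hf i).continuousAt
  have h6 := (ContDiffAt.partialDeriv (n := 0) hf j).continuousAt
  have h7 := ContDiffAt.continuousAt_partialDeriv₂ hf i j
  unfold regularForm secondFormLin
  fun_prop

/-- The Gram determinant of the tangent vectors at a characteristic point does not vanish. -/
theorem dForm_partialDeriv_ne_zero (H : IsContactGerm w h R (f x₀))
    (hinj : Function.Injective (fderiv ℝ f x₀))
    (h0 : w (f x₀) (partialDeriv f 0 x₀) = 0) (h1 : w (f x₀) (partialDeriv f 1 x₀) = 0) :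
    dForm w (f x₀) (partialDeriv f 0 x₀) (partialDeriv f 1 x₀) ≠ 0 := by
  intro hκ
  have hd := H.data.self_of_nhds
  set p := partialDeriv f 0 x₀ with hp
  set q := partialDeriv f 1 x₀ with hq
  have hn := hd.normalized p q h0 h1
  rw [hκ] at hn
  have hp0 : p ≠ 0 := by
    rw [hp, partialDeriv, Ne, map_eq_zero_iff _ hinj]
    intro e
    have := congrArg (fun v : E2 ↦ v 0) e
    simp at this
  have hpp := hd.h_pos p h0 hp0
  -- With `κ = 0` the Gram determinant vanishes, so this horizontal vector has length zero; it would
  -- be a linear relation between `p` and `q`, against injectivity.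
  have hx : h (f x₀) p p • q - h (f x₀) p q • p = 0 := by
    by_contra hne
    have := hd.h_pos _ (by simp [h0, h1]) hne
    simp only [map_sub, map_smul, sub_apply, smul_apply, smul_eq_mul, hd.h_symm q p] at this
    nlinarith
  rw [hp, hq, partialDeriv, partialDeriv, ← map_smul, ← map_smul, ← map_sub,
    map_eq_zero_iff _ hinj] at hx
  have := congrArg (fun v : E2 ↦ v 1) hx
  simp only [PiLp.sub_apply, PiLp.smul_apply] at this
  simp at this
  exact hpp.ne' this

theorem fderiv_form_partialDeriv (hw : ContDiffAt ℝ ω w (f x₀)) (hf : ContDiffAt ℝ ω f x₀)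
    (i j : Fin 2) :
    fderiv ℝ (fun x ↦ w (f x) (partialDeriv f i x)) x₀ (EuclideanSpace.single j 1) =
      fderiv ℝ w (f x₀) (partialDeriv f j x₀) (partialDeriv f i x₀)
        + w (f x₀) (partialDeriv₂ f j i x₀) := by
  have e1 : HasFDerivAt (fun x ↦ w (f x)) ((fderiv ℝ w (f x₀)).comp (fderiv ℝ f x₀)) x₀ :=
    HasFDerivAt.comp (g := w) x₀ (hw.differentiableAt (by simp)).hasFDerivAt
      (hf.differentiableAt (by simp)).hasFDerivAt
  have e2 : HasFDerivAt (fderiv ℝ f) (fderiv ℝ (fderiv ℝ f) x₀) x₀ :=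
    ((hf.fderiv_right (m := ω) (by simp)).differentiableAt (by simp)).hasFDerivAt
  have e3 := e1.clm_apply (e2.clm_apply (hasFDerivAt_const (EuclideanSpace.single i (1 : ℝ)) x₀))
  have e4 := e3.fderiv
  simp only [partialDeriv] at e4 ⊢
  rw [e4]
  simp [partialDeriv₂, add_comm]

/-- The difference of the two sides is the coefficient of the pullback of `dw` to the surface, the
second derivatives of `f` cancelling by symmetry. At a characteristic point it is nonzero by the
contact condition. -/
theorem fderiv_form_ne (H : IsContactGerm w h R (f x₀)) (hf : ContDiffAt ℝ ω f x₀)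
    (hinj : Function.Injective (fderiv ℝ f x₀))
    (h0 : w (f x₀) (partialDeriv f 0 x₀) = 0) (h1 : w (f x₀) (partialDeriv f 1 x₀) = 0) :
    fderiv ℝ (fun x ↦ w (f x) (partialDeriv f 1 x)) x₀ (EuclideanSpace.single 0 1) ≠
      fderiv ℝ (fun x ↦ w (f x) (partialDeriv f 0 x)) x₀ (EuclideanSpace.single 1 1) := by
  have h2 := dForm_partialDeriv_ne_zero H hinj h0 h1
  rw [fderiv_form_partialDeriv H.form hf, fderiv_form_partialDeriv H.form hf]
  have h3 : partialDeriv₂ f 0 1 x₀ = partialDeriv₂ f 1 0 x₀ :=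
    fderiv_fderiv_symm (hf.of_le le_top) _ _
  rw [h3]
  intro h4
  apply h2
  simp only [dForm, sub_apply, ContinuousLinearMap.flip_apply]
  linarith

end Chart

/-! ### The limit curvature in a chart and its integrability -/

section ChartLimit

local notation "E2" => EuclideanSpace ℝ (Fin 2)
local notation "E3" => EuclideanSpace ℝ (Fin 3)

variable {w : E3 → E3 →L[ℝ] ℝ} {h : E3 → E3 →L[ℝ] E3 →L[ℝ] ℝ} {R : E3 → E3} {f : E2 → E3} {x₀ : E2}

/-- Convergence of the mean curvatures of a parametrized surface as `ε → 0`. -/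
theorem eventually_tendsto_meanCurvatureParam (H : IsContactGerm w h R (f x₀))
    (hf : ContDiffAt ℝ ω f x₀) (hinj : Function.Injective (fderiv ℝ f x₀)) {a c : E3}
    (hac : ∀ᶠ y in 𝓝 (f x₀), w y (horizontalPart w R a y) = 0 ∧ w y (horizontalPart w R c y) = 0 ∧
      dForm w y (horizontalPart w R a y) (horizontalPart w R c y) ≠ 0) :
    ∀ᶠ x in 𝓝 x₀, ¬(w (f x) (partialDeriv f 0 x) = 0 ∧ w (f x) (partialDeriv f 1 x) = 0) →
      ∀ s : ℝ, s ^ 2 = 1 → ∃ ν : ℝ → E3,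
        (∀ ε > 0, ∀ v, IsUnitNormalLin (w (f x)) (dForm w (f x)) (h (f x)) ε s (partialDeriv f 0 x)
          (partialDeriv f 1 x) v ↔ v = ν ε) ∧
        Tendsto (fun ε ↦ meanCurvatureParam (fun y u v ↦ dilatedMetric (h y) (w y) ε u v) f x (ν ε))
          (𝓝[>] 0) (𝓝 (-s * chartCurvature w h R a c f x)) := by
  obtain ⟨C, hC, hle⟩ := exists_le_charField H hf hinj
  filter_upwards [hle, hf.eventually (by simp), hf.continuousAt.eventually hac,
    hf.continuousAt.eventually H.data, hf.continuousAt.eventually (H.form.eventually (by simp)),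
    hf.continuousAt.eventually (H.metric.eventually (by simp))]
    with x hx hfx ⟨ha, hc, hd⟩ hdata hwx hhx hne s hs
  set z := charField w f x with hz
  set p := partialDeriv f 0 x with hp
  set q := partialDeriv f 1 x with hq
  have hpos : 0 < h (f x) z z := by
    refine lt_of_lt_of_le ?_ hx
    rcases not_and_or.1 hne with h0 | h0
    · have := pow_pos (abs_pos.2 h0) 2
      rw [sq_abs] at this
      positivity
    · have := pow_pos (abs_pos.2 h0) 2
      rw [sq_abs] at this
      positivity
  -- The explicit normal of `isUnitNormalLin_iff`; its sign `-s` factors out of the curvature by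
  -- linearity in the normal.
  refine ⟨fun ε ↦ (-s) • (√(h (f x) z z + ε * dForm w (f x) p q ^ 2))⁻¹ •
    (rotField w h R a c f x - (ε * dForm w (f x) p q) • R (f x)), fun ε hε v ↦
    isUnitNormalLin_iff hdata ha hc hd rfl rfl hpos hε hs v, ?_⟩
  have hlim := (tendsto_meanCurvatureLin_dilated (h' := fun e u v ↦ fderiv ℝ h (f x) e u v)
    (fun u v ↦ by fun_prop) (fun e u ↦ by fun_prop) (fun t e u v ↦ by simp) (fun t e u v ↦ by simp)
    hdata (p₀ := p) (p₁ := q) (s₀₀ := partialDeriv₂ f 0 0 x) (s₀₁ := partialDeriv₂ f 0 1 x)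
    (s₁₁ := partialDeriv₂ f 1 1 x) ha hc hd (hz ▸ rfl)
    (Y := rotField w h R a c f x) (κ := dForm w (f x) p q) rfl hpos).const_mul (-s)
  refine hlim.congr fun ε ↦ ?_
  have hw' := (hwx.differentiableAt (by simp)).hasFDerivAt
  have hh' := (hhx.differentiableAt (by simp)).hasFDerivAt
  rw [meanCurvatureParam_eq_lin (hfx.of_le le_top) (B := dilatedMetric (h (f x)) (w (f x)) ε)
    (B' := dilatedMetricDeriv (fun e u v ↦ fderiv ℝ h (f x) e u v) (w (f x)) (fderiv ℝ w (f x)) ε)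
    (fun a b ↦ rfl) (fun a b e ↦ by
      simp only [dilatedMetric_apply]
      have ha := hw'.clm_apply (hasFDerivAt_const a (f x))
      have hb := hw'.clm_apply (hasFDerivAt_const b (f x))
      have hab := (hh'.clm_apply (hasFDerivAt_const a (f x))).clm_apply (hasFDerivAt_const b (f x))
      rw [HasFDerivAt.fderiv (f := fun y ↦ h y a b + ε⁻¹ * (w y a * w y b))
        (hab.add ((ha.mul hb).const_mul ε⁻¹))]
      simp [dilatedMetricDeriv]
      ring)]
  exact (meanCurvatureLin_smul
    (fun t e u v ↦ by simp only [dilatedMetricDeriv, map_smul, smul_eq_mul, smul_apply]; ring)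
    (fun t e u v ↦ by simp only [dilatedMetricDeriv, map_smul, smul_eq_mul]; ring)
    _ _ _ _ _ _ (-s)).symm

/-- This matches the value `0` assigned to the curvature at characteristic points, so that the chart
formula holds near `p₀` without exception. -/
theorem chartCurvature_eq_zero {a c : E3} {x : E2} (h0 : w (f x) (partialDeriv f 0 x) = 0)
    (h1 : w (f x) (partialDeriv f 1 x) = 0) : chartCurvature w h R a c f x = 0 := by
  simp [chartCurvature, limitCurvature, h0, h1]

/-- The limit of the mean curvatures of a parametrized surface is integrable near an isolated
characteristic point. -/
theorem exists_integrableOn_chartCurvature (H : IsContactGerm w h R (f x₀))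
    (hf : ContDiffAt ℝ ω f x₀) (hinj : Function.Injective (fderiv ℝ f x₀)) {a c : E3}
    (hac : ∀ᶠ y in 𝓝 (f x₀), w y (horizontalPart w R a y) = 0 ∧ w y (horizontalPart w R c y) = 0 ∧
      dForm w y (horizontalPart w R a y) (horizontalPart w R c y) ≠ 0)
    (hiso : w (f x₀) (partialDeriv f 0 x₀) = 0 → w (f x₀) (partialDeriv f 1 x₀) = 0 →
      ∀ᶠ x in 𝓝[≠] x₀,
        ¬(w (f x) (partialDeriv f 0 x) = 0 ∧ w (f x) (partialDeriv f 1 x) = 0)) :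
    ∃ U ∈ 𝓝 x₀, IntegrableOn (chartCurvature w h R a c f) U := by
  have hwf : ContDiffAt ℝ ω (fun x ↦ w (f x)) x₀ := ContDiffAt.comp (g := w) x₀ H.form hf
  obtain ⟨U, hU, hlt⟩ := exists_lintegral_inv_abs_add_abs_lt_top
    (P := fun x ↦ w (f x) (partialDeriv f 0 x)) (Q := fun x ↦ w (f x) (partialDeriv f 1 x))
    (hwf.clm_apply (ContDiffAt.partialDeriv hf 0)) (hwf.clm_apply (ContDiffAt.partialDeriv hf 1))
    (fderiv_form_ne H hf hinj) hiso
  obtain ⟨C, hC, hle⟩ := exists_le_charField H hf hinj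
  set Num : E2 → ℝ := fun x ↦
    w (f x) (partialDeriv f 0 x) ^ 2 * regularForm (h (f x)) (fun e u v ↦ fderiv ℝ h (f x) e u v)
      (w (f x)) (fderiv ℝ w (f x)) (dForm w (f x) (partialDeriv f 0 x) (partialDeriv f 1 x))
      (partialDeriv f 1 x) (partialDeriv f 1 x) (partialDeriv₂ f 1 1 x) (rotField w h R a c f x)
    - 2 * (w (f x) (partialDeriv f 0 x) * w (f x) (partialDeriv f 1 x)) *
      regularForm (h (f x)) (fun e u v ↦ fderiv ℝ h (f x) e u v)
      (w (f x)) (fderiv ℝ w (f x)) (dForm w (f x) (partialDeriv f 0 x) (partialDeriv f 1 x))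
      (partialDeriv f 0 x) (partialDeriv f 1 x) (partialDeriv₂ f 0 1 x) (rotField w h R a c f x)
    + w (f x) (partialDeriv f 1 x) ^ 2 *
      regularForm (h (f x)) (fun e u v ↦ fderiv ℝ h (f x) e u v)
      (w (f x)) (fderiv ℝ w (f x)) (dForm w (f x) (partialDeriv f 0 x) (partialDeriv f 1 x))
      (partialDeriv f 0 x) (partialDeriv f 0 x) (partialDeriv₂ f 0 0 x) (rotField w h R a c f x)
    with hNum
  set Δ : E2 → ℝ := fun x ↦ h (f x) (charField w f x) (charField w f x) with hΔ
  have hH : ∀ x, chartCurvature w h R a c f x = Num x / (Δ x * √(Δ x)) := fun x ↦ rfl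
  have hall : ∀ᶠ x in 𝓝 x₀, ContDiffAt ℝ ω f x ∧ ContDiffAt ℝ ω w (f x) ∧
      ContDiffAt ℝ ω h (f x) ∧ ContDiffAt ℝ ω R (f x) ∧
      dForm w (f x) (horizontalPart w R a (f x)) (horizontalPart w R c (f x)) ≠ 0 := by
    filter_upwards [hf.eventually (by simp), hf.continuousAt.eventually hac,
      hf.continuousAt.eventually (H.form.eventually (by simp)),
      hf.continuousAt.eventually (H.metric.eventually (by simp)),
      hf.continuousAt.eventually (H.reeb.eventually (by simp))] with x h1 h2 h3 h4 h5
    exact ⟨h1, h3, h4, h5, h2.2.2⟩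
  have hκc : ∀ x, ContDiffAt ℝ ω f x → ContDiffAt ℝ ω w (f x) →
      ContinuousAt (fun x ↦ dForm w (f x) (partialDeriv f 0 x) (partialDeriv f 1 x)) x := by
    intro x hf hw
    have h4 : ContinuousAt (fun x ↦ dForm w (f x)) x :=
      ContinuousAt.comp (g := dForm w) (continuousAt_dForm hw) hf.continuousAt
    exact (h4.clm_apply (ContDiffAt.partialDeriv (n := 0) hf 0).continuousAt).clm_apply
      (ContDiffAt.partialDeriv (n := 0) hf 1).continuousAt
  have hwc : ∀ x i, ContDiffAt ℝ ω f x → ContDiffAt ℝ ω w (f x) →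
      ContinuousAt (fun x ↦ w (f x) (partialDeriv f i x)) x := by
    intro x i hf hw
    have h1 : ContinuousAt (fun x ↦ w (f x)) x := hw.continuousAt.comp hf.continuousAt
    exact h1.clm_apply (ContDiffAt.partialDeriv (n := 0) hf i).continuousAt
  have hNumc : ∀ᶠ x in 𝓝 x₀, ContinuousAt Num x := by
    filter_upwards [hall] with x ⟨h1, h2, h3, h4, h5⟩
    have hY := continuousAt_rotField h2 h3 h4 h1 h5
    have r := continuousAt_regularForm h2 h3 h1 hY (hκc x h1 h2)
    have w0 := hwc x 0 h1 h2
    have w1 := hwc x 1 h1 h2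
    exact (((w0.pow 2).mul (r 1 1)).sub ((continuousAt_const.mul (w0.mul w1)).mul (r 0 1))).add
      ((w1.pow 2).mul (r 0 0))
  have hΔc : ∀ᶠ x in 𝓝 x₀, ContinuousAt Δ x := by
    filter_upwards [hall] with x ⟨h1, h2, h3, h4, h5⟩
    have h6 : ContinuousAt (fun x ↦ h (f x)) x :=
      ContinuousAt.comp (g := h) h3.continuousAt h1.continuousAt
    have h7 := continuousAt_charField h2 h1
    exact (h6.clm_apply h7).clm_apply h7
  -- The numerator is a quadratic form in the two components of `w`, with coefficients continuous
  -- and hence bounded near `x₀`.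
  have hbound : ∃ K > 0, ∀ᶠ x in 𝓝 x₀, |Num x| ≤
      K * (|w (f x) (partialDeriv f 0 x)| + |w (f x) (partialDeriv f 1 x)|) ^ 2 := by
    obtain ⟨h1, h2, h3, h4, h5⟩ := hall.self_of_nhds
    have hY := continuousAt_rotField h2 h3 h4 h1 h5
    have r := continuousAt_regularForm h2 h3 h1 hY (hκc x₀ h1 h2)
    have hev : ∀ i j, ∃ K > 0, ∀ᶠ x in 𝓝 x₀, |regularForm (h (f x))
      (fun e u v ↦ fderiv ℝ h (f x) e u v)
      (w (f x)) (fderiv ℝ w (f x)) (dForm w (f x) (partialDeriv f 0 x) (partialDeriv f 1 x))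
      (partialDeriv f i x) (partialDeriv f j x) (partialDeriv₂ f i j x)
      (rotField w h R a c f x)| ≤ K := by
      intro i j
      refine ⟨_, ?_, ((r i j).abs.eventually_lt_const (lt_add_one _)).mono fun x hx ↦ hx.le⟩
      positivity
    obtain ⟨K₁, hK₁, e₁⟩ := hev 1 1
    obtain ⟨K₂, hK₂, e₂⟩ := hev 0 1
    obtain ⟨K₃, hK₃, e₃⟩ := hev 0 0
    refine ⟨K₁ + K₂ + K₃, by positivity, ?_⟩
    filter_upwards [e₁, e₂, e₃] with x b₁ b₂ b₃
    simp only [hNum]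
    set α := w (f x) (partialDeriv f 0 x)
    set β := w (f x) (partialDeriv f 1 x)
    refine (abs_add_le _ _).trans ?_
    refine (add_le_add_left (abs_sub _ _) _).trans ?_
    simp only [abs_mul, abs_pow, abs_two]
    have hα := abs_nonneg α
    have hβ := abs_nonneg β
    have hαβ := mul_nonneg hα hβ
    have c₁ := mul_le_mul_of_nonneg_left b₁ (sq_nonneg |α|)
    have c₂ := mul_le_mul_of_nonneg_left b₂ (mul_nonneg zero_le_two hαβ)
    have c₃ := mul_le_mul_of_nonneg_left b₃ (sq_nonneg |β|)
    have d₁ := mul_nonneg hK₁.le (sq_nonneg |β|)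
    have d₂ := mul_nonneg hK₁.le hαβ
    have d₃ := mul_nonneg hK₂.le (sq_nonneg |α|)
    have d₄ := mul_nonneg hK₂.le (sq_nonneg |β|)
    have d₅ := mul_nonneg hK₃.le (sq_nonneg |α|)
    have d₆ := mul_nonneg hK₃.le hαβ
    nlinarith
  obtain ⟨K, hK, hbd⟩ := hbound
  obtain ⟨r, hr, hball⟩ := Metric.mem_nhds_iff.1
    (inter_mem hU (((hNumc.and hΔc).and (hle.and hbd))))
  refine ⟨Metric.ball x₀ r, Metric.ball_mem_nhds _ hr, ?_, ?_⟩
  -- The quotient may be discontinuous at the characteristic point, so measurability is derived from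
  -- the continuity of numerator and denominator.
  · have m1 : ContinuousOn Num (Metric.ball x₀ r) := fun x hx ↦
      (hball hx).2.1.1.continuousWithinAt
    have m2 : ContinuousOn Δ (Metric.ball x₀ r) := fun x hx ↦
      (hball hx).2.1.2.continuousWithinAt
    have m3 : AEMeasurable Num (volume.restrict (Metric.ball x₀ r)) :=
      m1.aemeasurable measurableSet_ball
    have m4 : AEMeasurable Δ (volume.restrict (Metric.ball x₀ r)) :=
      m2.aemeasurable measurableSet_ball
    exact (m3.div (m4.mul m4.sqrt)).aestronglyMeasurable
  -- With `ρ = |P| + |Q|` one has `ρ² ≤ 2 (P² + Q²)`, whence `Δ ≥ (C / 2) ρ²`. Dividing the bound `K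
  -- ρ²` by `((C / 2) ρ²)^(3/2)` leaves `L / ρ`.
  · set L : ℝ := K / ((C / 2) * √(C / 2)) with hL
    have hLpos : 0 < L := by positivity
    have key : ∀ x ∈ Metric.ball x₀ r, ‖chartCurvature w h R a c f x‖ₑ ≤ ENNReal.ofReal L *
        (ENNReal.ofReal (|w (f x) (partialDeriv f 0 x)| + |w (f x) (partialDeriv f 1 x)|))⁻¹ := by
      intro x hx
      obtain ⟨-, -, hx1, hx2⟩ := hball hx
      set ρ := |w (f x) (partialDeriv f 0 x)| + |w (f x) (partialDeriv f 1 x)| with hρ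
      -- At `ρ = 0` the right-hand side is infinite, and the curvature is `0` anyway.
      rcases (show 0 ≤ ρ by positivity).eq_or_lt with h0 | h0
      · have e0 : w (f x) (partialDeriv f 0 x) = 0 := by
          rw [← abs_eq_zero]
          linarith [abs_nonneg (w (f x) (partialDeriv f 0 x)),
            abs_nonneg (w (f x) (partialDeriv f 1 x))]
        have e1 : w (f x) (partialDeriv f 1 x) = 0 := by
          rw [← abs_eq_zero]
          linarith [abs_nonneg (w (f x) (partialDeriv f 0 x)),
            abs_nonneg (w (f x) (partialDeriv f 1 x))]
        rw [chartCurvature_eq_zero e0 e1]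
        simp
      · rw [← ENNReal.ofReal_inv_of_pos h0, ← ENNReal.ofReal_mul hLpos.le,
          Real.enorm_eq_ofReal_abs]
        refine ENNReal.ofReal_le_ofReal ?_
        have hΔ' : C / 2 * ρ ^ 2 ≤ Δ x := by
          refine le_trans ?_ hx1
          rw [hρ, add_sq, sq_abs, sq_abs]
          nlinarith [sq_nonneg (|w (f x) (partialDeriv f 0 x)| - |w (f x) (partialDeriv f 1 x)|),
            sq_abs (w (f x) (partialDeriv f 0 x)), sq_abs (w (f x) (partialDeriv f 1 x))]
        have hsq : √(C / 2) * ρ ≤ √(Δ x) := by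
          rw [← Real.sqrt_sq h0.le, ← Real.sqrt_mul (by positivity)]
          exact Real.sqrt_le_sqrt hΔ'
        have hC2 : 0 < √(C / 2) := Real.sqrt_pos.2 (by positivity)
        have hden : (C / 2 * ρ ^ 2) * (√(C / 2) * ρ) ≤ Δ x * √(Δ x) :=
          mul_le_mul hΔ' hsq (by positivity) (le_trans (by positivity) hΔ')
        have hden0 : 0 < (C / 2 * ρ ^ 2) * (√(C / 2) * ρ) := by positivity
        rw [hH, abs_div, abs_of_pos (hden0.trans_le hden)]
        calc |Num x| / (Δ x * √(Δ x)) ≤ K * ρ ^ 2 / ((C / 2 * ρ ^ 2) * (√(C / 2) * ρ)) := by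
              gcongr
          _ = L * ρ⁻¹ := by rw [hL]; field_simp
    rw [hasFiniteIntegral_iff_enorm]
    calc ∫⁻ x in Metric.ball x₀ r, ‖chartCurvature w h R a c f x‖ₑ
        ≤ ∫⁻ x in Metric.ball x₀ r, ENNReal.ofReal L *
          (ENNReal.ofReal (|w (f x) (partialDeriv f 0 x)| + |w (f x) (partialDeriv f 1 x)|))⁻¹ :=
          setLIntegral_mono' measurableSet_ball key
      _ = ENNReal.ofReal L * ∫⁻ x in Metric.ball x₀ r,
          (ENNReal.ofReal (|w (f x) (partialDeriv f 0 x)| + |w (f x) (partialDeriv f 1 x)|))⁻¹ :=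
          lintegral_const_mul' _ _ ENNReal.ofReal_ne_top
      _ ≤ ENNReal.ofReal L * ∫⁻ x in U,
          (ENNReal.ofReal (|w (f x) (partialDeriv f 0 x)| + |w (f x) (partialDeriv f 1 x)|))⁻¹ := by
          gcongr
          exact fun x hx ↦ (hball hx).1
      _ < ⊤ := ENNReal.mul_lt_top ENNReal.ofReal_lt_top hlt

end ChartLimit

/-! ### Tensor fields in manifold charts -/

section ManifoldChart

variable {n : ℕ} {X : Type*} [TopologicalSpace X] [ChartedSpace (EuclideanSpace ℝ (Fin n)) X]
  [IsManifold (𝓡 n) ω X]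

theorem mfderiv_extChartAt_coordVec {c : X} {x : EuclideanSpace ℝ (Fin n)}
    (hx : x ∈ (extChartAt (𝓡 n) c).target) (v : EuclideanSpace ℝ (Fin n)) :
    mfderiv (𝓡 n) 𝓘(ℝ, EuclideanSpace ℝ (Fin n)) (extChartAt (𝓡 n) c)
      ((extChartAt (𝓡 n) c).symm x) (coordVec c x v) = v := by
  have : IsManifold (𝓡 n) 1 X := IsManifold.of_le (n := ω) le_top
  have h := mfderiv_extChartAt_comp_mfderivWithin_extChartAt_symm (I := 𝓡 n) hx
  rw [ModelWithCorners.range_eq_univ, mfderivWithin_univ] at h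
  exact congrArg (fun L ↦ L v) h

theorem coordVec_mfderiv_extChartAt {c : X} {x : EuclideanSpace ℝ (Fin n)}
    (hx : x ∈ (extChartAt (𝓡 n) c).target)
    (u : TangentSpace (𝓡 n) ((extChartAt (𝓡 n) c).symm x)) :
    coordVec c x (mfderiv (𝓡 n) 𝓘(ℝ, EuclideanSpace ℝ (Fin n)) (extChartAt (𝓡 n) c)
      ((extChartAt (𝓡 n) c).symm x) u) = u := by
  have : IsManifold (𝓡 n) 1 X := IsManifold.of_le (n := ω) le_top
  have h := mfderivWithin_extChartAt_symm_comp_mfderiv_extChartAt (I := 𝓡 n) hx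
  rw [ModelWithCorners.range_eq_univ, mfderivWithin_univ] at h
  exact congrArg (fun L ↦ L u) h

/-- The vector field with constant coordinates is analytic. -/
theorem contMDiffOn_coordVec (c : X) (v : EuclideanSpace ℝ (Fin n)) :
    ContMDiffOn 𝓘(ℝ, EuclideanSpace ℝ (Fin n)) ((𝓡 n).prod 𝓘(ℝ, EuclideanSpace ℝ (Fin n))) ω
      (fun x ↦ TotalSpace.mk' (EuclideanSpace ℝ (Fin n)) (E := fun q : X ↦ TangentSpace (𝓡 n) q)
        ((extChartAt (𝓡 n) c).symm x) (coordVec c x v)) (extChartAt (𝓡 n) c).target := by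
  have : IsManifold (𝓡 n) 1 X := IsManifold.of_le (n := ω) le_top
  have h1 : ContMDiffOn 𝓘(ℝ, EuclideanSpace ℝ (Fin n)) (𝓡 n) ω (extChartAt (𝓡 n) c).symm
    (extChartAt (𝓡 n) c).target := contMDiffOn_extChartAt_symm c
  set e := trivializationAt (EuclideanSpace ℝ (Fin n)) (TangentSpace (𝓡 n) (M := X)) c
  have h2 := e.contMDiffOn_symm (IB := 𝓡 n) (n := ω)
  have h3 : ContMDiffOn 𝓘(ℝ, EuclideanSpace ℝ (Fin n)) ((𝓡 n).prod 𝓘(ℝ, EuclideanSpace ℝ (Fin n))) ω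
      (fun x ↦ ((extChartAt (𝓡 n) c).symm x, v)) (extChartAt (𝓡 n) c).target :=
    h1.prodMk contMDiffOn_const
  have hs : ∀ x ∈ (extChartAt (𝓡 n) c).target,
      (extChartAt (𝓡 n) c).symm x ∈ (chartAt (EuclideanSpace ℝ (Fin n)) c).source := by
    intro x hx
    rw [← extChartAt_source (𝓡 n)]
    exact (extChartAt (𝓡 n) c).map_target hx
  refine (h2.comp h3 fun x hx ↦ ?_).congr fun x hx ↦ ?_
  · rw [mem_preimage, e.mem_target]
    exact hs x hx
  -- The coordinate vector field is the constant `v` carried back by the tangent bundle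
  -- trivialization at `c`.
  · have h4 := TangentBundle.symmL_trivializationAt (I := 𝓡 n) (hs x hx)
    rw [ModelWithCorners.range_eq_univ, mfderivWithin_univ,
      (extChartAt (𝓡 n) c).right_inv hx] at h4
    have h5 : coordVec c x v = e.symm ((extChartAt (𝓡 n) c).symm x) v :=
      (congrArg (fun L ↦ L v) h4).symm.trans (e.symmL_apply (R := ℝ) (hs x hx) v)
    have h6 := e.mk_symm (b := (extChartAt (𝓡 n) c).symm x) (hs x hx) v
    simp only [Function.comp_apply]
    rw [← h6, h5]

/-- Evaluating on the analytic coordinate fields turns regularity of a bundle section into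
regularity of ordinary functions. -/
theorem contDiffOn_form {E' : Type*} [NormedAddCommGroup E'] [NormedSpace ℝ E'] {k : WithTop ℕ∞}
    {α : ∀ q : X, TangentSpace (𝓡 n) q →L[ℝ] E'}
    (hα : ContMDiff (𝓡 n) ((𝓡 n).prod 𝓘(ℝ, EuclideanSpace ℝ (Fin n) →L[ℝ] E')) k
    (fun q ↦ TotalSpace.mk' (EuclideanSpace ℝ (Fin n) →L[ℝ] E')
      (E := fun q : X ↦ TangentSpace (𝓡 n) q →L[ℝ] Trivial X E' q) q (α q)))
    (c : X) (v : EuclideanSpace ℝ (Fin n)) :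
    ContDiffOn ℝ k (fun x ↦ α ((extChartAt (𝓡 n) c).symm x) (coordVec c x v))
      (extChartAt (𝓡 n) c).target := by
  have h1 : ContMDiffOn 𝓘(ℝ, EuclideanSpace ℝ (Fin n)) (𝓡 n) k (extChartAt (𝓡 n) c).symm
    (extChartAt (𝓡 n) c).target := (contMDiffOn_extChartAt_symm (n := ω) c).of_le le_top
  have h2 := ContMDiffOn.clm_bundle_apply (E₁ := fun q : X ↦ TangentSpace (𝓡 n) q)
    (E₂ := Trivial X E') (F₂ := E') (b := (extChartAt (𝓡 n) c).symm)
    (ϕ := fun x ↦ α ((extChartAt (𝓡 n) c).symm x)) (v := fun x ↦ coordVec c x v)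
    (hα.comp_contMDiffOn h1) ((contMDiffOn_coordVec c v).of_le le_top)
  intro x hx
  exact (contMDiffWithinAt_totalSpace.1 (h2 x hx)).2.contDiffWithinAt

theorem contDiffOn_bilin {k : WithTop ℕ∞}
    {α : ∀ q : X, TangentSpace (𝓡 n) q →L[ℝ] TangentSpace (𝓡 n) q →L[ℝ] ℝ}
    (hα : ContMDiff (𝓡 n)
      ((𝓡 n).prod 𝓘(ℝ, EuclideanSpace ℝ (Fin n) →L[ℝ] EuclideanSpace ℝ (Fin n) →L[ℝ] ℝ)) k
      (fun q ↦ TotalSpace.mk' (EuclideanSpace ℝ (Fin n) →L[ℝ] EuclideanSpace ℝ (Fin n) →L[ℝ] ℝ)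
        (E := fun q : X ↦ TangentSpace (𝓡 n) q →L[ℝ] TangentSpace (𝓡 n) q →L[ℝ] Trivial X ℝ q)
        q (α q)))
    (c : X) (u v : EuclideanSpace ℝ (Fin n)) :
    ContDiffOn ℝ k (fun x ↦ α ((extChartAt (𝓡 n) c).symm x) (coordVec c x u) (coordVec c x v))
      (extChartAt (𝓡 n) c).target := by
  have h1 : ContMDiffOn 𝓘(ℝ, EuclideanSpace ℝ (Fin n)) (𝓡 n) k (extChartAt (𝓡 n) c).symm
    (extChartAt (𝓡 n) c).target := (contMDiffOn_extChartAt_symm (n := ω) c).of_le le_top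
  have h2 := ContMDiffOn.clm_bundle_apply₂ (E₁ := fun q : X ↦ TangentSpace (𝓡 n) q)
    (E₂ := fun q : X ↦ TangentSpace (𝓡 n) q)
    (E₃ := Trivial X ℝ) (F₃ := ℝ) (b := (extChartAt (𝓡 n) c).symm)
    (ψ := fun x ↦ α ((extChartAt (𝓡 n) c).symm x)) (v := fun x ↦ coordVec c x u)
    (w := fun x ↦ coordVec c x v)
    (hα.comp_contMDiffOn h1) ((contMDiffOn_coordVec c u).of_le le_top)
    ((contMDiffOn_coordVec c v).of_le le_top)
  intro x hx
  exact (contMDiffWithinAt_totalSpace.1 (h2 x hx)).2.contDiffWithinAt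

/-- The chart expression of a one-form. -/
noncomputable def formChart (α : ∀ q : X, TangentSpace (𝓡 n) q →L[ℝ] ℝ) (c : X)
    (x : EuclideanSpace ℝ (Fin n)) : EuclideanSpace ℝ (Fin n) →L[ℝ] ℝ :=
  (α ((extChartAt (𝓡 n) c).symm x)).comp
    (mfderiv 𝓘(ℝ, EuclideanSpace ℝ (Fin n)) (𝓡 n) (extChartAt (𝓡 n) c).symm x)

theorem formChart_apply (α : ∀ q : X, TangentSpace (𝓡 n) q →L[ℝ] ℝ) (c : X)
    (x v : EuclideanSpace ℝ (Fin n)) :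
    formChart α c x v = α ((extChartAt (𝓡 n) c).symm x) (coordVec c x v) := rfl

/-- The chart expression of a field of bilinear forms. -/
noncomputable def bilinChart
    (α : ∀ q : X, TangentSpace (𝓡 n) q →L[ℝ] TangentSpace (𝓡 n) q →L[ℝ] ℝ) (c : X)
    (x : EuclideanSpace ℝ (Fin n)) :
    EuclideanSpace ℝ (Fin n) →L[ℝ] EuclideanSpace ℝ (Fin n) →L[ℝ] ℝ :=
  let L : EuclideanSpace ℝ (Fin n) →L[ℝ] EuclideanSpace ℝ (Fin n) :=
    mfderiv 𝓘(ℝ, EuclideanSpace ℝ (Fin n)) (𝓡 n) (extChartAt (𝓡 n) c).symm x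
  let a : EuclideanSpace ℝ (Fin n) →L[ℝ] EuclideanSpace ℝ (Fin n) →L[ℝ] ℝ :=
    α ((extChartAt (𝓡 n) c).symm x)
  a.bilinearComp L L

theorem bilinChart_apply
    (α : ∀ q : X, TangentSpace (𝓡 n) q →L[ℝ] TangentSpace (𝓡 n) q →L[ℝ] ℝ) (c : X)
    (x u v : EuclideanSpace ℝ (Fin n)) :
    bilinChart α c x u v =
      α ((extChartAt (𝓡 n) c).symm x) (coordVec c x u) (coordVec c x v) := rfl

theorem contDiffOn_formChart {k : WithTop ℕ∞} {α : ∀ q : X, TangentSpace (𝓡 n) q →L[ℝ] ℝ}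
    (hα : ContMDiff (𝓡 n) ((𝓡 n).prod 𝓘(ℝ, EuclideanSpace ℝ (Fin n) →L[ℝ] ℝ)) k
    (fun q ↦ TotalSpace.mk' (EuclideanSpace ℝ (Fin n) →L[ℝ] ℝ)
      (E := fun q : X ↦ TangentSpace (𝓡 n) q →L[ℝ] Trivial X ℝ q) q (α q)))
    (c : X) : ContDiffOn ℝ k (formChart α c) (extChartAt (𝓡 n) c).target :=
  contDiffOn_clm_apply.2 fun v ↦ contDiffOn_form hα c v

theorem contDiffOn_bilinChart {k : WithTop ℕ∞}
    {α : ∀ q : X, TangentSpace (𝓡 n) q →L[ℝ] TangentSpace (𝓡 n) q →L[ℝ] ℝ}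
    (hα : ContMDiff (𝓡 n)
      ((𝓡 n).prod 𝓘(ℝ, EuclideanSpace ℝ (Fin n) →L[ℝ] EuclideanSpace ℝ (Fin n) →L[ℝ] ℝ)) k
      (fun q ↦ TotalSpace.mk' (EuclideanSpace ℝ (Fin n) →L[ℝ] EuclideanSpace ℝ (Fin n) →L[ℝ] ℝ)
        (E := fun q : X ↦ TangentSpace (𝓡 n) q →L[ℝ] TangentSpace (𝓡 n) q →L[ℝ] Trivial X ℝ q)
        q (α q)))
    (c : X) : ContDiffOn ℝ k (bilinChart α c) (extChartAt (𝓡 n) c).target :=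
  contDiffOn_clm_apply.2 fun u ↦ contDiffOn_clm_apply.2 fun v ↦ contDiffOn_bilin hα c u v

/-- The differential of the preferred chart at `c`, at the point `q`. -/
noncomputable def chartDiff (c q : X) : TangentSpace (𝓡 n) q →L[ℝ] EuclideanSpace ℝ (Fin n) :=
  mfderiv (𝓡 n) 𝓘(ℝ, EuclideanSpace ℝ (Fin n)) (extChartAt (𝓡 n) c) q

theorem chartDiff_injective {c q : X} (hq : q ∈ (extChartAt (𝓡 n) c).source) :
    Function.Injective (chartDiff (n := n) c q) := by
  have h := (extChartAt (𝓡 n) c).map_source hq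
  have h2 := (extChartAt (𝓡 n) c).left_inv hq
  -- Writing `q` as the point with coordinates `x` puts the chart differential and its inverse over
  -- the same tangent space.
  generalize extChartAt (𝓡 n) c q = x at h h2
  subst h2
  exact Function.LeftInverse.injective (coordVec_mfderiv_extChartAt h)

theorem chartDiff_surjective {c q : X} (hq : q ∈ (extChartAt (𝓡 n) c).source) :
    Function.Surjective (chartDiff (n := n) c q) := by
  have h := (extChartAt (𝓡 n) c).map_source hq
  have h2 := (extChartAt (𝓡 n) c).left_inv hq
  generalize extChartAt (𝓡 n) c q = x at h h2
  subst h2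
  exact Function.RightInverse.surjective (mfderiv_extChartAt_coordVec h)

theorem formChart_chartDiff (α : ∀ q : X, TangentSpace (𝓡 n) q →L[ℝ] ℝ) {c q : X}
    (hq : q ∈ (extChartAt (𝓡 n) c).source) (u : TangentSpace (𝓡 n) q) :
    formChart α c (extChartAt (𝓡 n) c q) (chartDiff (n := n) c q u) = α q u := by
  have h := (extChartAt (𝓡 n) c).map_source hq
  have h2 := (extChartAt (𝓡 n) c).left_inv hq
  generalize extChartAt (𝓡 n) c q = x at h h2 ⊢
  subst h2
  rw [formChart_apply]
  exact congrArg _ (coordVec_mfderiv_extChartAt h u)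

theorem bilinChart_chartDiff
    (α : ∀ q : X, TangentSpace (𝓡 n) q →L[ℝ] TangentSpace (𝓡 n) q →L[ℝ] ℝ) {c q : X}
    (hq : q ∈ (extChartAt (𝓡 n) c).source) (u v : TangentSpace (𝓡 n) q) :
    bilinChart α c (extChartAt (𝓡 n) c q) (chartDiff (n := n) c q u) (chartDiff (n := n) c q v) = α q u v := by
  have h := (extChartAt (𝓡 n) c).map_source hq
  have h2 := (extChartAt (𝓡 n) c).left_inv hq
  generalize extChartAt (𝓡 n) c q = x at h h2 ⊢
  subst h2
  rw [bilinChart_apply]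
  exact congrArg₂ (fun a b ↦ α _ a b) (coordVec_mfderiv_extChartAt h u)
    (coordVec_mfderiv_extChartAt h v)

/-! ### Change of charts -/

/-- The transition map from the preferred chart at `q` to the preferred chart at `c`. -/
noncomputable def transition (c q : X) : EuclideanSpace ℝ (Fin n) → EuclideanSpace ℝ (Fin n) :=
  extChartAt (𝓡 n) c ∘ (extChartAt (𝓡 n) q).symm

theorem transition_self {c q : X} : transition (n := n) c q (extChartAt (𝓡 n) q q) = extChartAt (𝓡 n) c q := by
  simp [transition]

theorem eventually_symm_mem_source {c q : X} (hq : q ∈ (extChartAt (𝓡 n) c).source) :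
    ∀ᶠ x in 𝓝 (extChartAt (𝓡 n) q q), x ∈ (extChartAt (𝓡 n) q).target ∧
      (extChartAt (𝓡 n) q).symm x ∈ (extChartAt (𝓡 n) c).source := by
  have h0 : ∀ᶠ x in 𝓝 (extChartAt (𝓡 n) q q), x ∈ (extChartAt (𝓡 n) q).target :=
    extChartAt_target_mem_nhds q
  refine h0.and ?_
  have h1 : ContinuousAt (extChartAt (𝓡 n) q).symm (extChartAt (𝓡 n) q q) :=
    continuousAt_extChartAt_symm (I := 𝓡 n) q
  refine h1.eventually ?_
  rw [(extChartAt (𝓡 n) q).left_inv (mem_extChartAt_source (I := 𝓡 n) q)]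
  exact (isOpen_extChartAt_source c).mem_nhds hq

theorem contDiffAt_transition {c q : X} {x : EuclideanSpace ℝ (Fin n)}
    (hx : x ∈ (extChartAt (𝓡 n) q).target)
    (hx' : (extChartAt (𝓡 n) q).symm x ∈ (extChartAt (𝓡 n) c).source) :
    ContDiffAt ℝ ω (transition (n := n) c q) x := by
  rw [← contMDiffAt_iff_contDiffAt]
  have h1 : ContMDiffAt 𝓘(ℝ, EuclideanSpace ℝ (Fin n)) (𝓡 n) ω (extChartAt (𝓡 n) q).symm x :=
    (contMDiffOn_extChartAt_symm q).contMDiffAt ((isOpen_extChartAt_target q).mem_nhds hx)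
  exact ContMDiffAt.comp x (contMDiffAt_extChartAt' (by rwa [extChartAt_source] at hx')) h1

theorem fderiv_transition {c q : X} {x : EuclideanSpace ℝ (Fin n)}
    (hx : x ∈ (extChartAt (𝓡 n) q).target)
    (hx' : (extChartAt (𝓡 n) q).symm x ∈ (extChartAt (𝓡 n) c).source)
    (v : EuclideanSpace ℝ (Fin n)) :
    fderiv ℝ (transition (n := n) c q) x v = chartDiff c ((extChartAt (𝓡 n) q).symm x) (coordVec q x v) := by
  have h1 : ContMDiffAt 𝓘(ℝ, EuclideanSpace ℝ (Fin n)) (𝓡 n) ω (extChartAt (𝓡 n) q).symm x :=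
    (contMDiffOn_extChartAt_symm q).contMDiffAt ((isOpen_extChartAt_target q).mem_nhds hx)
  have h2 : ContMDiffAt (𝓡 n) 𝓘(ℝ, EuclideanSpace ℝ (Fin n)) ω (extChartAt (𝓡 n) c)
      ((extChartAt (𝓡 n) q).symm x) := contMDiffAt_extChartAt' (by rwa [extChartAt_source] at hx')
  rw [← mfderiv_eq_fderiv]
  have := mfderiv_comp x (h2.mdifferentiableAt (by simp)) (h1.mdifferentiableAt (by simp))
  exact congrArg (fun L ↦ L v) this

theorem formChart_transition (α : ∀ q : X, TangentSpace (𝓡 n) q →L[ℝ] ℝ) {c q : X}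
    {x : EuclideanSpace ℝ (Fin n)} (hx : x ∈ (extChartAt (𝓡 n) q).target)
    (hx' : (extChartAt (𝓡 n) q).symm x ∈ (extChartAt (𝓡 n) c).source)
    (v : EuclideanSpace ℝ (Fin n)) :
    formChart α q x v = formChart α c (transition (n := n) c q x) (fderiv ℝ (transition (n := n) c q) x v) := by
  rw [fderiv_transition hx hx', transition, Function.comp_apply, formChart_chartDiff α hx']
  rfl

/-- Pointwise objects are defined in the chart preferred at their own base point; this passes to the
fixed chart at `c`. -/
theorem chartDiff_eq_fderiv_transition {c q : X} (hq : q ∈ (extChartAt (𝓡 n) c).source)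
    (u : TangentSpace (𝓡 n) q) :
    chartDiff (n := n) c q u = fderiv ℝ (transition (n := n) c q) (extChartAt (𝓡 n) q q) (coords u) := by
  have hs := mem_extChartAt_source (I := 𝓡 n) q
  have h1 : ContMDiffAt (𝓡 n) 𝓘(ℝ, EuclideanSpace ℝ (Fin n)) ω (extChartAt (𝓡 n) q) q :=
    contMDiffAt_extChartAt
  have h2 : ContDiffAt ℝ ω (transition (n := n) c q) (extChartAt (𝓡 n) q q) :=
    contDiffAt_transition (mem_extChartAt_target q)
      (by rwa [(extChartAt (𝓡 n) q).left_inv hs])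
  have h3 : extChartAt (𝓡 n) c =ᶠ[𝓝 q] transition (n := n) c q ∘ extChartAt (𝓡 n) q := by
    filter_upwards [extChartAt_source_mem_nhds (I := 𝓡 n) q] with z hz
    rw [Function.comp_apply, transition, Function.comp_apply, (extChartAt (𝓡 n) q).left_inv hz]
  have h4 := mfderiv_comp q (h2.contMDiffAt.mdifferentiableAt (by simp))
    (h1.mdifferentiableAt (by simp))
  rw [← h3.mfderiv_eq, mfderiv_eq_fderiv] at h4
  exact congrArg (fun L ↦ L u) h4

/-- The exterior derivative does not depend on the chart. -/
theorem extDerivForm_eq {α : ∀ q : X, TangentSpace (𝓡 n) q →L[ℝ] ℝ}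
    {c q : X} (hα : ContDiffAt ℝ ω (formChart α c) (extChartAt (𝓡 n) c q))
    (hq : q ∈ (extChartAt (𝓡 n) c).source) (u v : TangentSpace (𝓡 n) q) :
    extDerivForm α q u v =
      dForm (formChart α c) (extChartAt (𝓡 n) c q) (chartDiff (n := n) c q u) (chartDiff (n := n) c q v) := by
  set y := extChartAt (𝓡 n) q q
  set τ := transition (n := n) c q with hτ
  have hs := mem_extChartAt_source (I := 𝓡 n) q
  have hτc : ContDiffAt ℝ ω τ y := contDiffAt_transition (mem_extChartAt_target q)
      (by rwa [(extChartAt (𝓡 n) q).left_inv hs])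
  have hτy : τ y = extChartAt (𝓡 n) c q := transition_self
  -- The second derivative of the transition map enters symmetrically in `a`, `b` and disappears on
  -- antisymmetrizing.
  have key : ∀ a b : EuclideanSpace ℝ (Fin n),
      fderiv ℝ (fun x ↦ α ((extChartAt (𝓡 n) q).symm x) (coordVec q x a)) y b =
        fderiv ℝ (formChart α c) (extChartAt (𝓡 n) c q) (fderiv ℝ τ y b) (fderiv ℝ τ y a) +
          formChart α c (extChartAt (𝓡 n) c q) (fderiv ℝ (fderiv ℝ τ) y b a) := by
    intro a b
    have h1 : (fun x ↦ α ((extChartAt (𝓡 n) q).symm x) (coordVec q x a)) =ᶠ[𝓝 y]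
        fun x ↦ formChart α c (τ x) (fderiv ℝ τ x a) := by
      filter_upwards [eventually_symm_mem_source hq] with x hx
      exact formChart_transition α hx.1 hx.2 a
    rw [h1.fderiv_eq]
    have h2 : HasFDerivAt (fun x ↦ formChart α c (τ x))
        ((fderiv ℝ (formChart α c) (extChartAt (𝓡 n) c q)).comp (fderiv ℝ τ y)) y := by
      refine HasFDerivAt.comp (g := formChart α c) y ?_ (hτc.differentiableAt (by simp)).hasFDerivAt
      rw [hτy]
      exact (hα.differentiableAt (by simp)).hasFDerivAt
    have h3 : HasFDerivAt (fderiv ℝ τ) (fderiv ℝ (fderiv ℝ τ) y) y :=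
      ((hτc.fderiv_right (m := ω) (by simp)).differentiableAt (by simp)).hasFDerivAt
    rw [(h2.clm_apply (h3.clm_apply (hasFDerivAt_const a y))).fderiv]
    simp [hτy, add_comm]
  rw [extDerivForm, key, key, chartDiff_eq_fderiv_transition hq, chartDiff_eq_fderiv_transition hq,
    fderiv_fderiv_symm (hτc.of_le le_top) (coords u) (coords v)]
  simp only [dForm, sub_apply, ContinuousLinearMap.flip_apply]
  ring

end ManifoldChart

/-! ### The contact structure, its Reeb field and its metrics in charts -/

section ContactChart

local notation "E3" => EuclideanSpace ℝ (Fin 3)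

/-- The vector dual to a two-form on `ℝ³`. -/
noncomputable def curlVec (d : E3 →L[ℝ] E3 →L[ℝ] ℝ) : E3 :=
  d (EuclideanSpace.single 1 1) (EuclideanSpace.single 2 1) • EuclideanSpace.single 0 1
    + d (EuclideanSpace.single 2 1) (EuclideanSpace.single 0 1) • EuclideanSpace.single 1 1
    + d (EuclideanSpace.single 0 1) (EuclideanSpace.single 1 1) • EuclideanSpace.single 2 1

/-- The Reeb vector of the contact form `w` with exterior derivative `d`. -/
noncomputable def reebVec (w : E3 →L[ℝ] ℝ) (d : E3 →L[ℝ] E3 →L[ℝ] ℝ) : E3 :=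
  (w (curlVec d))⁻¹ • curlVec d

/-- The bilinear form that agrees with `m` on `ker w` and vanishes on `R`. -/
noncomputable def horizontalMetric (w : E3 →L[ℝ] ℝ) (m : E3 →L[ℝ] E3 →L[ℝ] ℝ) (R : E3) :
    E3 →L[ℝ] E3 →L[ℝ] ℝ :=
  m.bilinearComp (ContinuousLinearMap.id ℝ E3 - w.smulRight R)
    (ContinuousLinearMap.id ℝ E3 - w.smulRight R)

@[simp] theorem horizontalMetric_apply (w : E3 →L[ℝ] ℝ) (m : E3 →L[ℝ] E3 →L[ℝ] ℝ) (R u v : E3) :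
    horizontalMetric w m R u v = m (u - w u • R) (v - w v • R) := by
  simp [horizontalMetric]

/-- The algebraic conditions on a contact form `w`, its exterior derivative `d` and a bilinear form
`m` extending the sub-Riemannian metric, at a point. -/
structure IsContactTriple (w : E3 →L[ℝ] ℝ) (d m : E3 →L[ℝ] E3 →L[ℝ] ℝ) : Prop where
  d_self : ∀ u, d u u = 0
  contact : ∀ u, w u = 0 → (∀ v, w v = 0 → d u v = 0) → u = 0
  m_symm : ∀ u v, m u v = m v u
  m_pos : ∀ u, w u = 0 → u ≠ 0 → 0 < m u u
  normalized : ∀ u v, w u = 0 → w v = 0 → d u v ^ 2 = m u u * m v v - m u v ^ 2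

theorem eq_sum_single (u : E3) : u = u 0 • EuclideanSpace.single 0 1
    + u 1 • EuclideanSpace.single 1 1 + u 2 • EuclideanSpace.single 2 1 := by
  ext i
  fin_cases i <;> simp

/-- An alternating form on `ℝ³` is the volume form with `curlVec d` in its first slot, so a second
copy of that vector gives zero. -/
theorem curlVec_left {d : E3 →L[ℝ] E3 →L[ℝ] ℝ} (hd : ∀ u, d u u = 0) (u : E3) :
    d (curlVec d) u = 0 := by
  have hs : ∀ u v, d v u = -d u v := fun u v ↦ by
    have h1 := hd (u + v)
    simp only [map_add, add_apply, hd] at h1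
    linarith
  rw [eq_sum_single u]
  simp only [curlVec, map_add, map_smul, add_apply, smul_apply, smul_eq_mul, hd,
    hs (EuclideanSpace.single 0 1) (EuclideanSpace.single 1 1),
    hs (EuclideanSpace.single 0 1) (EuclideanSpace.single 2 1),
    hs (EuclideanSpace.single 1 1) (EuclideanSpace.single 2 1)]
  ring

theorem exists_ne_zero_apply_eq_zero (w : E3 →L[ℝ] ℝ) : ∃ u, u ≠ 0 ∧ w u = 0 := by
  by_cases h : w (EuclideanSpace.single 0 1) = 0
  · refine ⟨EuclideanSpace.single 0 1, fun h0 ↦ ?_, h⟩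
    simpa using congrArg (fun x : E3 ↦ x 0) h0
  · refine ⟨w (EuclideanSpace.single 1 1) • EuclideanSpace.single 0 1
      - w (EuclideanSpace.single 0 1) • EuclideanSpace.single 1 1, fun h0 ↦ h ?_, ?_⟩
    · simpa using congrArg (fun x : E3 ↦ x 1) h0
    · simp [mul_comm]

namespace IsContactTriple

variable {w : E3 →L[ℝ] ℝ} {d m : E3 →L[ℝ] E3 →L[ℝ] ℝ}

theorem exists_frame (H : IsContactTriple w d m) : ∃ a c, w a = 0 ∧ w c = 0 ∧ d a c ≠ 0 := by
  obtain ⟨a, ha, hwa⟩ := exists_ne_zero_apply_eq_zero w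
  by_contra! h
  exact ha (H.contact a hwa fun v hv ↦ h a v hwa hv)

/-- If it vanished, `curlVec d` would be a horizontal vector in the kernel of `d`, hence zero; then
`d = 0`, which is excluded by the contact condition. Thus the formula for the Reeb vector makes
sense. -/
theorem apply_curlVec_ne_zero (H : IsContactTriple w d m) : w (curlVec d) ≠ 0 := by
  intro h
  have h0 := H.contact _ h fun v _ ↦ curlVec_left H.d_self v
  have h1 : d = 0 := by
    have e0 := congrArg (fun x : E3 ↦ x 0) h0
    have e1 := congrArg (fun x : E3 ↦ x 1) h0
    have e2 := congrArg (fun x : E3 ↦ x 2) h0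
    simp [curlVec] at e0 e1 e2
    have hs : ∀ u v, d v u = -d u v := fun u v ↦ by
      have h1 := H.d_self (u + v)
      simp only [map_add, add_apply, H.d_self] at h1
      linarith
    ext u v
    rw [eq_sum_single u, eq_sum_single v]
    simp only [map_add, map_smul, add_apply, smul_apply, smul_eq_mul, H.d_self,
      hs (EuclideanSpace.single 0 1) (EuclideanSpace.single 1 1),
      hs (EuclideanSpace.single 2 1) (EuclideanSpace.single 0 1),
      hs (EuclideanSpace.single 1 1) (EuclideanSpace.single 2 1), e0, e1, e2]
    simp
  obtain ⟨a, c, -, -, hac⟩ := H.exists_frame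
  simp [h1] at hac

theorem isContactData (H : IsContactTriple w d m) :
    IsContactData w d (horizontalMetric w m (reebVec w d)) (reebVec w d) := by
  have hR : w (reebVec w d) = 1 := by
    rw [reebVec, map_smul, smul_eq_mul, inv_mul_cancel₀ H.apply_curlVec_ne_zero]
  refine ⟨H.d_self, hR, fun u ↦ ?_, fun u v ↦ ?_, fun u ↦ ?_, fun u hu hu0 ↦ ?_,
    fun u v hu hv ↦ ?_⟩
  · simp [reebVec, curlVec_left H.d_self]
  · simp only [horizontalMetric_apply]; exact H.m_symm _ _
  · simp [hR]
  · simpa [hu] using H.m_pos u hu hu0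
  · simpa [hu, hv] using H.normalized u v hu hv

/-- The difference of two Reeb vectors is horizontal and in the kernel of `d`. -/
theorem eq_reebVec (H : IsContactTriple w d m) {v : E3} (h1 : w v = 1) (h2 : ∀ u, d v u = 0) :
    v = reebVec w d := by
  rw [← sub_eq_zero]
  refine H.contact _ ?_ fun u _ ↦ ?_
  · rw [map_sub, h1, H.isContactData.w_reeb, sub_self]
  · rw [map_sub, sub_apply, h2, H.isContactData.d_reeb, sub_self]

end IsContactTriple

variable {M : Type*} [TopologicalSpace M] [ChartedSpace E3 M]
  [IsManifold (𝓡 3) ω M] (K : AnalyticContactStructure M)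

namespace AnalyticContactStructure

/-- The Reeb field in the preferred chart at `c`. -/
noncomputable def chartReeb (c : M) (y : E3) : E3 :=
  reebVec (formChart K.form c y) (dForm (formChart K.form c) y)

/-- The sub-Riemannian metric, extended by zero along the Reeb field, in the preferred chart
at `c`. -/
noncomputable def chartMetric (c : M) (y : E3) : E3 →L[ℝ] E3 →L[ℝ] ℝ :=
  horizontalMetric (formChart K.form c y) (bilinChart K.metric c y) (K.chartReeb c y)

theorem contDiffAt_formChart {c : M} {y : E3} (hy : y ∈ (extChartAt (𝓡 3) c).target) :
    ContDiffAt ℝ ω (formChart K.form c) y :=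
  (contDiffOn_formChart K.form_analytic c).contDiffAt ((isOpen_extChartAt_target c).mem_nhds hy)

theorem extDerivForm_eq_dForm {c q : M} (hq : q ∈ (extChartAt (𝓡 3) c).source)
    (u v : TangentSpace (𝓡 3) q) : extDerivForm K.form q u v =
      dForm (formChart K.form c) (extChartAt (𝓡 3) c q) (chartDiff (n := 3) c q u)
        (chartDiff (n := 3) c q v) :=
  extDerivForm_eq (K.contDiffAt_formChart ((extChartAt (𝓡 3) c).map_source hq)) hq u v

/-- The chart differential is a linear bijection, so each axiom, quantified over tangent vectors,
transfers to coordinates. -/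
theorem isContactTriple {c q : M} (hq : q ∈ (extChartAt (𝓡 3) c).source) :
    IsContactTriple (formChart K.form c (extChartAt (𝓡 3) c q))
      (dForm (formChart K.form c) (extChartAt (𝓡 3) c q))
      (bilinChart K.metric c (extChartAt (𝓡 3) c q)) := by
  have hs := chartDiff_surjective (n := 3) hq
  have hi := chartDiff_injective (n := 3) hq
  have hw := fun u : TangentSpace (𝓡 3) q ↦ formChart_chartDiff K.form hq u
  have hm := fun u v : TangentSpace (𝓡 3) q ↦ bilinChart_chartDiff K.metric hq u v
  have hd := fun u v : TangentSpace (𝓡 3) q ↦ (K.extDerivForm_eq_dForm hq u v).symm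
  refine ⟨fun u ↦ ?_, hs.forall.2 fun u hu h ↦ ?_,
    hs.forall₂.2 fun u v ↦ ?_, hs.forall.2 fun u hu h ↦ ?_, hs.forall₂.2 fun u v hu hv ↦ ?_⟩
  · simp [dForm]
  · rw [K.contact q u ((hw u).symm.trans hu) fun v hv ↦ ?_, map_zero]
    rw [← hd]
    exact h _ ((hw v).trans hv)
  · rw [hm, hm, K.metric_symm]
  · rw [hm]
    exact K.metric_pos q u ((hw u).symm.trans hu) fun h0 ↦ h (by rw [h0, map_zero])
  · rw [hm, hm, hm, hd]
    exact K.normalized q u v ((hw u).symm.trans hu) ((hw v).symm.trans hv)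

theorem isContactTriple_chart {c : M} {y : E3} (hy : y ∈ (extChartAt (𝓡 3) c).target) :
    IsContactTriple (formChart K.form c y) (dForm (formChart K.form c) y)
      (bilinChart K.metric c y) := by
  have := K.isContactTriple ((extChartAt (𝓡 3) c).map_target hy)
  rwa [(extChartAt (𝓡 3) c).right_inv hy] at this

/-- The closed formula `curlVec d / w (curlVec d)` is analytic in the first derivatives of the form,
the denominator being nonzero. -/
theorem contDiffAt_chartReeb {c : M} {y : E3} (hy : y ∈ (extChartAt (𝓡 3) c).target) :
    ContDiffAt ℝ ω (K.chartReeb c) y := by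
  have hw := K.contDiffAt_formChart hy
  have hw' : ContDiffAt ℝ ω (fderiv ℝ (formChart K.form c)) y := hw.fderiv_right (m := ω) (by simp)
  have hd : ∀ a b, ContDiffAt ℝ ω (fun y ↦ dForm (formChart K.form c) y a b) y := fun a b ↦ by
    simp only [dForm, sub_apply, ContinuousLinearMap.flip_apply]
    fun_prop
  have hcurl : ContDiffAt ℝ ω (fun y ↦ curlVec (dForm (formChart K.form c) y)) y := by
    simp only [curlVec]
    exact (((hd _ _).smul contDiffAt_const).add ((hd _ _).smul contDiffAt_const)).add
      ((hd _ _).smul contDiffAt_const)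
  exact ((hw.clm_apply hcurl).inv (K.isContactTriple_chart hy).apply_curlVec_ne_zero).smul hcurl

theorem contDiffOn_chartMetric (c : M) :
    ContDiffOn ℝ ω (K.chartMetric c) (extChartAt (𝓡 3) c).target := by
  refine contDiffOn_clm_apply.2 fun u ↦ contDiffOn_clm_apply.2 fun v y hy ↦ ?_
  have hw := K.contDiffAt_formChart hy
  have hR := K.contDiffAt_chartReeb hy
  have hm : ContDiffAt ℝ ω (bilinChart K.metric c) y :=
    (contDiffOn_bilinChart K.metric_analytic c).contDiffAt
      ((isOpen_extChartAt_target (I := 𝓡 3) c).mem_nhds hy)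
  simp only [chartMetric, horizontalMetric_apply]
  refine ContDiffAt.contDiffWithinAt ?_
  fun_prop

theorem isContactGerm {c : M} {y : E3} (hy : y ∈ (extChartAt (𝓡 3) c).target) :
    IsContactGerm (formChart K.form c) (K.chartMetric c) (K.chartReeb c) y := by
  have hN := (isOpen_extChartAt_target (I := 𝓡 3) c).mem_nhds hy
  refine ⟨K.contDiffAt_formChart hy, (K.contDiffOn_chartMetric c).contDiffAt hN,
    K.contDiffAt_chartReeb hy, ?_, (K.isContactTriple_chart hy).exists_frame⟩
  filter_upwards [hN] with z hz
  exact (K.isContactTriple_chart hz).isContactData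

theorem reeb_spec (q : M) : K.form q (K.reeb q) = 1 ∧
    ∀ u, extDerivForm K.form q (K.reeb q) u = 0 := by
  have hq := mem_extChartAt_source (I := 𝓡 3) q
  have H := (K.isContactTriple hq).isContactData
  obtain ⟨v, hv⟩ := chartDiff_surjective (n := 3) hq
    (reebVec (formChart K.form q (extChartAt (𝓡 3) q q))
      (dForm (formChart K.form q) (extChartAt (𝓡 3) q q)))
  refine Classical.epsilon_spec (p := fun v ↦ K.form q v = 1 ∧ ∀ u, extDerivForm K.form q v u = 0)
    ⟨v, ?_, fun u ↦ ?_⟩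
  · rw [← formChart_chartDiff K.form hq, hv, H.w_reeb]
  · rw [K.extDerivForm_eq_dForm hq, hv, H.d_reeb]

/-- Uniqueness of the Reeb vector identifies the field defined by choice with the explicit chart
formula. -/
theorem chartDiff_reeb {c q : M} (hq : q ∈ (extChartAt (𝓡 3) c).source) :
    chartDiff (n := 3) c q (K.reeb q) = K.chartReeb c (extChartAt (𝓡 3) c q) := by
  refine (K.isContactTriple hq).eq_reebVec ?_ ((chartDiff_surjective (n := 3) hq).forall.2 fun u ↦ ?_)
  · rw [formChart_chartDiff K.form hq, (K.reeb_spec q).1]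
  · rw [← K.extDerivForm_eq_dForm hq, (K.reeb_spec q).2]

theorem approx_eq {c q : M} (hq : q ∈ (extChartAt (𝓡 3) c).source) (ε : ℝ)
    (u v : TangentSpace (𝓡 3) q) : K.approx ε q u v =
      dilatedMetric (K.chartMetric c (extChartAt (𝓡 3) c q))
        (formChart K.form c (extChartAt (𝓡 3) c q)) ε (chartDiff (n := 3) c q u)
        (chartDiff (n := 3) c q v) := by
  rw [dilatedMetric_apply, chartMetric, horizontalMetric_apply, formChart_chartDiff K.form hq,
    formChart_chartDiff K.form hq, ← K.chartDiff_reeb hq, ← map_smul, ← map_smul, ← map_sub,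
    ← map_sub, bilinChart_chartDiff K.metric hq]
  rfl

theorem orientForm_eq {c q : M} (hq : q ∈ (extChartAt (𝓡 3) c).source)
    (u v z : TangentSpace (𝓡 3) q) :
    K.orientForm q u v z =
      formChart K.form c (extChartAt (𝓡 3) c q) (chartDiff (n := 3) c q u) *
          dForm (formChart K.form c) (extChartAt (𝓡 3) c q) (chartDiff (n := 3) c q v)
            (chartDiff (n := 3) c q z)
        + formChart K.form c (extChartAt (𝓡 3) c q) (chartDiff (n := 3) c q v) *
          dForm (formChart K.form c) (extChartAt (𝓡 3) c q) (chartDiff (n := 3) c q z)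
            (chartDiff (n := 3) c q u)
        + formChart K.form c (extChartAt (𝓡 3) c q) (chartDiff (n := 3) c q z) *
          dForm (formChart K.form c) (extChartAt (𝓡 3) c q) (chartDiff (n := 3) c q u)
            (chartDiff (n := 3) c q v) := by
  simp only [orientForm, formChart_chartDiff K.form hq, ← K.extDerivForm_eq_dForm hq]

theorem approxCoord_transition {c q : M} {x : E3} (hx : x ∈ (extChartAt (𝓡 3) q).target)
    (hx' : (extChartAt (𝓡 3) q).symm x ∈ (extChartAt (𝓡 3) c).source) (ε : ℝ) (a b : E3) :
    K.approxCoord ε q x a b =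
      dilatedMetric (K.chartMetric c (transition (n := 3) c q x))
        (formChart K.form c (transition (n := 3) c q x)) ε
        (fderiv ℝ (transition (n := 3) c q) x a) (fderiv ℝ (transition (n := 3) c q) x b) := by
  rw [approxCoord, K.approx_eq hx', fderiv_transition hx hx', fderiv_transition hx hx']
  rfl

end AnalyticContactStructure

end ContactChart

/-! ### Immersions and their chart expressions -/

section Immersion

variable {m n : ℕ} {X : Type*} [TopologicalSpace X] [ChartedSpace (EuclideanSpace ℝ (Fin m)) X]
  [IsManifold (𝓡 m) ω X] {Y : Type*} [TopologicalSpace Y]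
  [ChartedSpace (EuclideanSpace ℝ (Fin n)) Y] [IsManifold (𝓡 n) ω Y]

/-- An immersion has a linear left inverse in suitable charts. -/
theorem exists_leftInverse_of_isImmersionAtOfComplement {F : Type*} [NormedAddCommGroup F]
    [NormedSpace ℝ F] {f : X → Y} {p : X}
    (h : Manifold.IsImmersionAtOfComplement F (𝓡 m) (𝓡 n) ω f p) :
    ∃ φ ∈ IsManifold.maximalAtlas (𝓡 m) ω X, ∃ ψ ∈ IsManifold.maximalAtlas (𝓡 n) ω Y,
      ∃ L : EuclideanSpace ℝ (Fin n) →L[ℝ] EuclideanSpace ℝ (Fin m),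
        p ∈ φ.source ∧ f p ∈ ψ.source ∧ ∀ q ∈ φ.source, L (ψ (f q)) = φ q := by
  have h2 := h.writtenInCharts
  have hd := h.domChart_mem_maximalAtlas
  have hc := h.codChart_mem_maximalAtlas
  have hp := h.mem_domChart_source
  have hfp := h.mem_codChart_source
  generalize h.domChart = φ, h.codChart = ψ, h.equiv = E at h2 hd hc hp hfp
  refine ⟨φ, hd, ψ, hc, (ContinuousLinearMap.fst ℝ (EuclideanSpace ℝ (Fin m)) F).comp
      E.symm.toContinuousLinearMap, hp, hfp, fun q hq ↦ ?_⟩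
  have h3 : ψ (f q) = E (φ q, 0) := by
    have := h2 (x := φ.extend (𝓡 m) q)
      ((φ.extend (𝓡 m)).map_source (by rwa [OpenPartialHomeomorph.extend_source]))
    rw [Function.comp_apply, Function.comp_apply, Function.comp_apply,
      OpenPartialHomeomorph.extend_left_inv _ hq] at this
    exact this
  rw [h3, ContinuousLinearMap.comp_apply]
  exact congrArg Prod.fst (E.symm_apply_apply (φ q, 0))

/-- The differential of an immersion is injective. -/
theorem mfderiv_injective_of_isImmersionAt {f : X → Y} {p : X}
    (h : Manifold.IsImmersionAt (𝓡 m) (𝓡 n) ω f p) :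
    Function.Injective (mfderiv (𝓡 m) (𝓡 n) f p) := by
  obtain ⟨φ, hφ, ψ, hψ, L, hp, hfp, h1⟩ := exists_leftInverse_of_isImmersionAtOfComplement
    h.isImmersionAtOfComplement_complement
  -- The normal form of an immersion gives a differentiable local left inverse; differentiating it
  -- yields a left inverse of the differential.
  have h4 : (φ.symm ∘ L ∘ ψ) ∘ f =ᶠ[𝓝 p] id := by
    filter_upwards [φ.open_source.mem_nhds hp] with q hq
    simp only [Function.comp_apply, h1 q hq, φ.left_inv hq, id]
  have h5 : MDifferentiableAt (𝓡 n) 𝓘(ℝ, EuclideanSpace ℝ (Fin n)) ψ (f p) :=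
    (contMDiffAt_of_mem_maximalAtlas hψ hfp).mdifferentiableAt (by simp)
  have h6 : MDifferentiableAt 𝓘(ℝ, EuclideanSpace ℝ (Fin n)) 𝓘(ℝ, EuclideanSpace ℝ (Fin m)) L
      (ψ (f p)) := L.differentiableAt.mdifferentiableAt
  have h7 : MDifferentiableAt 𝓘(ℝ, EuclideanSpace ℝ (Fin m)) (𝓡 m) φ.symm (L (ψ (f p))) := by
    rw [h1 p hp]
    exact (contMDiffAt_symm_of_mem_maximalAtlas hφ (φ.map_source hp)).mdifferentiableAt (by simp)
  have h8 : MDifferentiableAt (𝓡 n) (𝓡 m) (φ.symm ∘ L ∘ ψ) (f p) :=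
    MDifferentiableAt.comp (f p) h7 (MDifferentiableAt.comp (f p) h6 h5)
  have h9 := mfderiv_comp p h8 (h.contMDiffAt.mdifferentiableAt (by simp))
  rw [h4.mfderiv_eq, mfderiv_id] at h9
  exact Function.LeftInverse.injective (g := mfderiv (𝓡 n) (𝓡 m) (φ.symm ∘ L ∘ ψ) (f p))
    fun u ↦ (congrArg (fun A ↦ A u) h9).symm

/-- The expression of `f` in the preferred charts at `p₀` and `f p₀`. -/
noncomputable def chartExpr (f : X → Y) (p₀ : X) :
    EuclideanSpace ℝ (Fin m) → EuclideanSpace ℝ (Fin n) :=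
  extChartAt (𝓡 n) (f p₀) ∘ f ∘ (extChartAt (𝓡 m) p₀).symm

variable {f : X → Y} {p₀ p : X}

theorem chartExpr_apply (hp : p ∈ (extChartAt (𝓡 m) p₀).source) :
    chartExpr (m := m) (n := n) f p₀ (extChartAt (𝓡 m) p₀ p) = extChartAt (𝓡 n) (f p₀) (f p) := by
  simp only [chartExpr, Function.comp_apply, (extChartAt (𝓡 m) p₀).left_inv hp]

theorem contDiffAt_chartExpr (hf : ContMDiff (𝓡 m) (𝓡 n) ω f)
    (hp : p ∈ (extChartAt (𝓡 m) p₀).source) (hfp : f p ∈ (extChartAt (𝓡 n) (f p₀)).source) :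
    ContDiffAt ℝ ω (chartExpr (m := m) (n := n) f p₀) (extChartAt (𝓡 m) p₀ p) := by
  rw [← contMDiffAt_iff_contDiffAt]
  have h1 : ContMDiffAt 𝓘(ℝ, EuclideanSpace ℝ (Fin m)) (𝓡 m) ω (extChartAt (𝓡 m) p₀).symm
      (extChartAt (𝓡 m) p₀ p) := (contMDiffOn_extChartAt_symm p₀).contMDiffAt
    ((isOpen_extChartAt_target p₀).mem_nhds ((extChartAt (𝓡 m) p₀).map_source hp))
  refine ContMDiffAt.comp (I' := 𝓡 n) _ ?_ (hf.contMDiffAt.comp _ h1)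
  rw [Function.comp_apply, (extChartAt (𝓡 m) p₀).left_inv hp]
  exact contMDiffAt_extChartAt' (by rwa [extChartAt_source] at hfp)

theorem chartDiff_mfderiv (hf : ContMDiff (𝓡 m) (𝓡 n) ω f)
    (hp : p ∈ (extChartAt (𝓡 m) p₀).source) (hfp : f p ∈ (extChartAt (𝓡 n) (f p₀)).source)
    (u : TangentSpace (𝓡 m) p) :
    chartDiff (n := n) (f p₀) (f p) (mfderiv (𝓡 m) (𝓡 n) f p u) =
      fderiv ℝ (chartExpr (m := m) (n := n) f p₀) (extChartAt (𝓡 m) p₀ p)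
        (chartDiff (n := m) p₀ p u) := by
  have h1 : ContMDiffAt (𝓡 m) 𝓘(ℝ, EuclideanSpace ℝ (Fin m)) ω (extChartAt (𝓡 m) p₀) p :=
    contMDiffAt_extChartAt' (by rwa [extChartAt_source] at hp)
  have h2 : ContMDiffAt (𝓡 n) 𝓘(ℝ, EuclideanSpace ℝ (Fin n)) ω (extChartAt (𝓡 n) (f p₀)) (f p) :=
    contMDiffAt_extChartAt' (by rwa [extChartAt_source] at hfp)
  have h3 : extChartAt (𝓡 n) (f p₀) ∘ f =ᶠ[𝓝 p]
      chartExpr (m := m) (n := n) f p₀ ∘ extChartAt (𝓡 m) p₀ := by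
    filter_upwards [(isOpen_extChartAt_source (I := 𝓡 m) p₀).mem_nhds hp] with z hz
    exact (chartExpr_apply hz).symm
  have h4 := mfderiv_comp p (h2.mdifferentiableAt (by simp))
    (hf.contMDiffAt.mdifferentiableAt (by simp))
  have h5 := mfderiv_comp p
    ((contDiffAt_chartExpr hf hp hfp).contMDiffAt.mdifferentiableAt (by simp))
    (h1.mdifferentiableAt (by simp))
  rw [h3.mfderiv_eq, h5, mfderiv_eq_fderiv] at h4
  exact (congrArg (fun A ↦ A u) h4).symm

theorem fderiv_chartExpr_injective (hf : ContMDiff (𝓡 m) (𝓡 n) ω f)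
    (hinj : Function.Injective (mfderiv (𝓡 m) (𝓡 n) f p))
    (hp : p ∈ (extChartAt (𝓡 m) p₀).source) (hfp : f p ∈ (extChartAt (𝓡 n) (f p₀)).source) :
    Function.Injective
      (fderiv ℝ (chartExpr (m := m) (n := n) f p₀) (extChartAt (𝓡 m) p₀ p)) := by
  rw [injective_iff_map_eq_zero]
  refine (chartDiff_surjective (n := m) hp).forall.2 fun u hu ↦ ?_
  rw [← chartDiff_mfderiv hf hp hfp] at hu
  rw [(injective_iff_map_eq_zero _).1 hinj u
    ((injective_iff_map_eq_zero _).1 (chartDiff_injective (n := n) hfp) _ hu), map_zero]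

/-- The chart expressions of a map at nearby points are related by the transition maps. -/
theorem transition_comp_chartExpr (hf : Continuous f) (hp : p ∈ (extChartAt (𝓡 m) p₀).source) :
    transition (n := n) (f p₀) (f p) ∘ chartExpr (m := m) (n := n) f p
      =ᶠ[𝓝 (extChartAt (𝓡 m) p p)]
      chartExpr (m := m) (n := n) f p₀ ∘ transition (n := m) p₀ p := by
  have h1 : ContinuousAt (f ∘ (extChartAt (𝓡 m) p).symm) (extChartAt (𝓡 m) p p) :=
    hf.continuousAt.comp (continuousAt_extChartAt_symm (I := 𝓡 m) p)
  have h2 : ∀ᶠ x in 𝓝 (extChartAt (𝓡 m) p p),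
      f ((extChartAt (𝓡 m) p).symm x) ∈ (extChartAt (𝓡 n) (f p)).source := by
    refine h1.eventually ?_
    rw [Function.comp_apply, (extChartAt (𝓡 m) p).left_inv (mem_extChartAt_source (I := 𝓡 m) p)]
    exact extChartAt_source_mem_nhds (I := 𝓡 n) (f p)
  filter_upwards [h2, eventually_symm_mem_source (n := m) hp] with x hx hx'
  simp only [transition, chartExpr, Function.comp_apply, (extChartAt (𝓡 n) (f p)).left_inv hx,
    (extChartAt (𝓡 m) p₀).left_inv hx'.2]

theorem eventually_mem_chart (hf : Continuous f) (p₀ : X) :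
    ∀ᶠ p in 𝓝 p₀, p ∈ (extChartAt (𝓡 m) p₀).source ∧ f p ∈ (extChartAt (𝓡 n) (f p₀)).source := by
  have h0 : ∀ᶠ p in 𝓝 p₀, p ∈ (extChartAt (𝓡 m) p₀).source := extChartAt_source_mem_nhds p₀
  exact h0.and (hf.continuousAt.eventually (extChartAt_source_mem_nhds (I := 𝓡 n) (f p₀)))

end Immersion

/-! ### Characteristic points, normals and curvature of the surface in charts -/

section Surface

local notation "E2" => EuclideanSpace ℝ (Fin 2)
local notation "E3" => EuclideanSpace ℝ (Fin 3)

variable {M : Type*} [TopologicalSpace M] [ChartedSpace E3 M] [IsManifold (𝓡 3) ω M]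
  (K : AnalyticContactStructure M) {S : Type*} [TopologicalSpace S] [ChartedSpace E2 S]
  [IsManifold (𝓡 2) ω S] {ι : S → M} {p₀ p : S}

theorem fderiv_apply_eq_partialDeriv (f : E2 → E3) (x u : E2) :
    fderiv ℝ f x u = u 0 • partialDeriv f 0 x + u 1 • partialDeriv f 1 x := by
  conv_lhs => rw [eq_single_add_single u]
  simp [partialDeriv]

/-- The characteristic points, in charts. -/
theorem mem_charSet_iff (hf : ContMDiff (𝓡 2) (𝓡 3) ω ι)
    (hinj : Function.Injective (mfderiv (𝓡 2) (𝓡 3) ι p))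
    (hp : p ∈ (extChartAt (𝓡 2) p₀).source) (hfp : ι p ∈ (extChartAt (𝓡 3) (ι p₀)).source) :
    p ∈ charSet K ι ↔
      formChart K.form (ι p₀) (chartExpr (m := 2) (n := 3) ι p₀ (extChartAt (𝓡 2) p₀ p))
          (partialDeriv (chartExpr (m := 2) (n := 3) ι p₀) 0 (extChartAt (𝓡 2) p₀ p)) = 0 ∧
      formChart K.form (ι p₀) (chartExpr (m := 2) (n := 3) ι p₀ (extChartAt (𝓡 2) p₀ p))
          (partialDeriv (chartExpr (m := 2) (n := 3) ι p₀) 1 (extChartAt (𝓡 2) p₀ p)) = 0 := by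
  have hform : ∀ u : TangentSpace (𝓡 2) p, K.form (ι p) (mfderiv (𝓡 2) (𝓡 3) ι p u) =
      formChart K.form (ι p₀) (chartExpr (m := 2) (n := 3) ι p₀ (extChartAt (𝓡 2) p₀ p))
        (fderiv ℝ (chartExpr (m := 2) (n := 3) ι p₀) (extChartAt (𝓡 2) p₀ p)
          (chartDiff (n := 2) p₀ p u)) := fun u ↦ by
    rw [← chartDiff_mfderiv hf hp hfp, chartExpr_apply hp, formChart_chartDiff K.form hfp]
  have hmem : p ∈ charSet K ι ↔ ∀ u : TangentSpace (𝓡 2) p,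
      K.form (ι p) (mfderiv (𝓡 2) (𝓡 3) ι p u) = 0 := by
    constructor
    · intro h u
      have h' : LinearMap.range (mfderiv (𝓡 2) (𝓡 3) ι p).toLinearMap = K.distribution (ι p) := h
      have : mfderiv (𝓡 2) (𝓡 3) ι p u ∈ K.distribution (ι p) := by
        rw [← h']; exact ⟨u, rfl⟩
      exact this
    · intro h
      have : FiniteDimensional ℝ (TangentSpace (𝓡 3) (ι p)) :=
        inferInstanceAs (FiniteDimensional ℝ E3)
      have : FiniteDimensional ℝ (TangentSpace (𝓡 2) p) :=
        inferInstanceAs (FiniteDimensional ℝ E2)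
      have hd3 : Module.finrank ℝ (TangentSpace (𝓡 3) (ι p)) = 3 :=
        (finrank_euclideanSpace_fin : Module.finrank ℝ E3 = 3)
      have hd2 : Module.finrank ℝ (TangentSpace (𝓡 2) p) = 2 :=
        (finrank_euclideanSpace_fin : Module.finrank ℝ E2 = 2)
      -- The tangent plane lies in the contact plane and both have dimension 2, the latter as the
      -- kernel of a nonzero form in dimension 3.
      refine Submodule.eq_of_le_of_finrank_eq ?_ ?_
      · rintro _ ⟨u, rfl⟩
        exact h u
      · have h1 := LinearMap.finrank_range_of_inj
          (f := (mfderiv (𝓡 2) (𝓡 3) ι p).toLinearMap) hinj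
        have h2 := LinearMap.finrank_range_add_finrank_ker (K.form (ι p)).toLinearMap
        have h3 : LinearMap.range (K.form (ι p)).toLinearMap = ⊤ := by
          refine LinearMap.range_eq_top.2 (LinearMap.surjective ?_)
          intro h0
          exact K.form_ne_zero (ι p) (by ext u; exact congrArg (fun L ↦ L u) h0)
        rw [h3, finrank_top, Module.finrank_self, hd3] at h2
        rw [h1, hd2, AnalyticContactStructure.distribution]
        omega
  rw [hmem]
  simp only [hform]
  rw [← (chartDiff_surjective (n := 2) hp).forall (p := fun u ↦
    formChart K.form (ι p₀) (chartExpr (m := 2) (n := 3) ι p₀ (extChartAt (𝓡 2) p₀ p))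
      (fderiv ℝ (chartExpr (m := 2) (n := 3) ι p₀) (extChartAt (𝓡 2) p₀ p) u) = 0)]
  refine ⟨fun h ↦ ⟨h _, h _⟩, fun h u ↦ ?_⟩
  rw [fderiv_apply_eq_partialDeriv, map_add, map_smul, map_smul, h.1, h.2, smul_zero, smul_zero,
    add_zero]

theorem alternating_apply {B : E2 →L[ℝ] E2 →L[ℝ] ℝ} (h : ∀ u, B u u = 0) (u v : E2) :
    B u v = (u 0 * v 1 - u 1 * v 0) * B (EuclideanSpace.single 0 1) (EuclideanSpace.single 1 1) := by
  have h1 := h (EuclideanSpace.single 0 1 + EuclideanSpace.single 1 1)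
  simp only [map_add, add_apply, h, zero_add, add_zero] at h1
  conv_lhs => rw [eq_single_add_single u, eq_single_add_single v]
  simp only [map_add, map_smul, add_apply, smul_apply, smul_eq_mul, h]
  linear_combination (u 1 * v 0) * h1

/-- The coefficient of an area form in the preferred chart at `p₀`. -/
noncomputable def AreaForm.coeff (A : AreaForm S) (p₀ : S) (x : E2) : ℝ :=
  bilinChart A.form p₀ x (EuclideanSpace.single 0 1) (EuclideanSpace.single 1 1)

variable (A : AreaForm S)

theorem AreaForm.form_eq (hp : p ∈ (extChartAt (𝓡 2) p₀).source) (u v : TangentSpace (𝓡 2) p) :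
    A.form p u v =
      (chartDiff (n := 2) p₀ p u 0 * chartDiff (n := 2) p₀ p v 1
        - chartDiff (n := 2) p₀ p u 1 * chartDiff (n := 2) p₀ p v 0) *
      A.coeff p₀ (extChartAt (𝓡 2) p₀ p) := by
  rw [← bilinChart_chartDiff A.form hp]
  refine alternating_apply ((chartDiff_surjective (n := 2) hp).forall.2 fun u ↦ ?_) _ _
  rw [bilinChart_chartDiff A.form hp, A.form_self]

theorem AreaForm.coeff_ne_zero (hp : p ∈ (extChartAt (𝓡 2) p₀).source) :
    A.coeff p₀ (extChartAt (𝓡 2) p₀ p) ≠ 0 := by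
  intro h
  refine A.form_ne_zero p ?_
  ext u v
  rw [A.form_eq hp, h, mul_zero]
  rfl

theorem AreaForm.continuousAt_coeff (hp : p ∈ (extChartAt (𝓡 2) p₀).source) :
    ContinuousAt (fun q ↦ A.coeff p₀ (extChartAt (𝓡 2) p₀ q)) p := by
  have h1 : ContinuousAt (A.coeff p₀) (extChartAt (𝓡 2) p₀ p) :=
    ((contDiffOn_bilin A.form_smooth p₀ _ _).contDiffAt
      ((isOpen_extChartAt_target p₀).mem_nhds ((extChartAt (𝓡 2) p₀).map_source hp))).continuousAt
  exact ContinuousAt.comp (g := A.coeff p₀) h1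
    ((continuousOn_extChartAt (I := 𝓡 2) p₀).continuousAt
      ((isOpen_extChartAt_source p₀).mem_nhds hp))

/-- The unit normal, in charts. -/
theorem isUnitNormal_iff (hf : ContMDiff (𝓡 2) (𝓡 3) ω ι)
    (hp : p ∈ (extChartAt (𝓡 2) p₀).source) (hfp : ι p ∈ (extChartAt (𝓡 3) (ι p₀)).source)
    {s : ℝ} (hs : 0 < s * A.coeff p₀ (extChartAt (𝓡 2) p₀ p)) (ε : ℝ)
    (ν : TangentSpace (𝓡 3) (ι p)) :
    IsUnitNormal K ι A ε p ν ↔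
      IsUnitNormalLin
        (formChart K.form (ι p₀) (chartExpr (m := 2) (n := 3) ι p₀ (extChartAt (𝓡 2) p₀ p)))
        (dForm (formChart K.form (ι p₀))
          (chartExpr (m := 2) (n := 3) ι p₀ (extChartAt (𝓡 2) p₀ p)))
        (K.chartMetric (ι p₀) (chartExpr (m := 2) (n := 3) ι p₀ (extChartAt (𝓡 2) p₀ p))) ε s
        (partialDeriv (chartExpr (m := 2) (n := 3) ι p₀) 0 (extChartAt (𝓡 2) p₀ p))
        (partialDeriv (chartExpr (m := 2) (n := 3) ι p₀) 1 (extChartAt (𝓡 2) p₀ p))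
        (chartDiff (n := 3) (ι p₀) (ι p) ν) := by
  have hsurj := chartDiff_surjective (n := 2) hp
  simp only [IsUnitNormal, K.approx_eq hfp, K.orientForm_eq hfp, chartDiff_mfderiv hf hp hfp,
    A.form_eq hp, ← chartExpr_apply (m := 2) (n := 3) hp]
  set x := extChartAt (𝓡 2) p₀ p
  set f := chartExpr (m := 2) (n := 3) ι p₀
  set w := formChart K.form (ι p₀) (f x)
  have hdd : ∀ u, dForm (formChart K.form (ι p₀)) (f x) u u = 0 := fun u ↦ by simp [dForm]
  have hds : ∀ u v, dForm (formChart K.form (ι p₀)) (f x) v u =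
      -dForm (formChart K.form (ι p₀)) (f x) u v := fun u v ↦ by simp [dForm]
  set d := dForm (formChart K.form (ι p₀)) (f x)
  set B := dilatedMetric (K.chartMetric (ι p₀) (f x)) w ε
  set N := chartDiff (n := 3) (ι p₀) (ι p) ν
  set X := w N * d (partialDeriv f 0 x) (partialDeriv f 1 x)
    + w (partialDeriv f 0 x) * d (partialDeriv f 1 x) N
    + w (partialDeriv f 1 x) * d N (partialDeriv f 0 x) with hX
  -- For a fixed `N`, the orientation form on the tangent plane is alternating, hence a multiple of
  -- the coordinate determinant. Only the sign of `X` has to be compared with the area form.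
  have hor : ∀ u v : E2, w N * d (fderiv ℝ f x u) (fderiv ℝ f x v)
      + w (fderiv ℝ f x u) * d (fderiv ℝ f x v) N + w (fderiv ℝ f x v) * d N (fderiv ℝ f x u) =
      (u 0 * v 1 - u 1 * v 0) * X := fun u v ↦ by
    rw [hX]
    simp only [fderiv_apply_eq_partialDeriv f x, map_add, map_smul, add_apply, smul_apply,
      smul_eq_mul, hdd, hds (partialDeriv f 0 x) (partialDeriv f 1 x),
      hds (partialDeriv f 0 x) N, hds (partialDeriv f 1 x) N]
    ring
  simp only [hor]
  have e0 := hsurj (EuclideanSpace.single 0 1)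
  have e1 := hsurj (EuclideanSpace.single 1 1)
  obtain ⟨u₀, hu₀⟩ := e0
  obtain ⟨u₁, hu₁⟩ := e1
  constructor
  · rintro ⟨h1, h2, h3⟩
    refine ⟨?_, ?_, h2, ?_⟩
    · have := h1 u₀
      rwa [hu₀] at this
    · have := h1 u₁
      rwa [hu₁] at this
    -- The sign of the area coefficient decides which order of the coordinate vectors is positively
    -- oriented.
    · rcases pos_and_pos_or_neg_and_neg_of_mul_pos hs with ⟨hs0, hA⟩ | ⟨hs0, hA⟩
      · have := h3 u₀ u₁
        rw [hu₀, hu₁] at this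
        exact mul_pos hs0 (by simpa using this (by simpa using hA))
      · have := h3 u₁ u₀
        rw [hu₀, hu₁] at this
        exact mul_pos_of_neg_of_neg hs0 (by simpa using this (by simpa using hA))
  · rintro ⟨h1, h2, h3, h4⟩
    refine ⟨fun u ↦ ?_, h3, fun u v huv ↦ ?_⟩
    · rw [fderiv_apply_eq_partialDeriv, map_add, map_smul, map_smul, h1, h2]
      simp
    -- The product of the three positive quantities is the desired one times the squares of `s` and
    -- of the area coefficient.
    · have h5 := mul_pos (mul_pos huv h4) hs
      have h6 := mul_self_pos.2 (left_ne_zero_of_mul hs.ne')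
      have h7 := mul_self_pos.2 (right_ne_zero_of_mul hs.ne')
      refine pos_of_mul_pos_left (b := (s * s) * (A.coeff p₀ x * A.coeff p₀ x)) ?_
        (mul_pos h6 h7).le
      refine h5.trans_le (le_of_eq ?_)
      ring

/-- The mean curvature does not depend on the charts. -/
theorem meanCurvatureParam_chartExpr (hf : ContMDiff (𝓡 2) (𝓡 3) ω ι)
    (hp : p ∈ (extChartAt (𝓡 2) p₀).source) (hfp : ι p ∈ (extChartAt (𝓡 3) (ι p₀)).source) (ε : ℝ)
    {ν : TangentSpace (𝓡 3) (ι p)}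
    (hν : ∀ u : TangentSpace (𝓡 2) p, K.approx ε (ι p) ν (mfderiv (𝓡 2) (𝓡 3) ι p u) = 0) :
    meanCurvatureParam (K.approxCoord ε (ι p)) (chartExpr (m := 2) (n := 3) ι p)
        (extChartAt (𝓡 2) p p) (coords ν) =
      meanCurvatureParam (fun y u v ↦ dilatedMetric (K.chartMetric (ι p₀) y)
        (formChart K.form (ι p₀) y) ε u v) (chartExpr (m := 2) (n := 3) ι p₀)
        (extChartAt (𝓡 2) p₀ p) (chartDiff (n := 3) (ι p₀) (ι p) ν) := by
  have hs := mem_extChartAt_source (I := 𝓡 2) p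
  have hs' := mem_extChartAt_source (I := 𝓡 3) (ι p)
  have hx : chartExpr (m := 2) (n := 3) ι p (extChartAt (𝓡 2) p p) =
      extChartAt (𝓡 3) (ι p) (ι p) := chartExpr_apply hs
  have hσx : transition (n := 2) p₀ p (extChartAt (𝓡 2) p p) = extChartAt (𝓡 2) p₀ p :=
    transition_self
  have hy := (extChartAt (𝓡 3) (ι p₀)).map_source hfp
  have hfx : chartExpr (m := 2) (n := 3) ι p₀ (extChartAt (𝓡 2) p₀ p) =
      extChartAt (𝓡 3) (ι p₀) (ι p) := chartExpr_apply hp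
  have hG := K.isContactGerm hy
  have hτ : ContDiffAt ℝ ω (transition (n := 3) (ι p₀) (ι p)) (extChartAt (𝓡 3) (ι p) (ι p)) :=
    contDiffAt_transition (mem_extChartAt_target (ι p))
      (by rwa [(extChartAt (𝓡 3) (ι p)).left_inv hs'])
  have hσ : ContDiffAt ℝ ω (transition (n := 2) p₀ p) (extChartAt (𝓡 2) p p) :=
    contDiffAt_transition (mem_extChartAt_target p) (by rwa [(extChartAt (𝓡 2) p).left_inv hs])
  rw [chartDiff_eq_fderiv_transition hfp, ← hσx, ← hx]
  -- Here `σ` is the change of charts on the surface and `τ` the one on the ambient manifold.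
  refine meanCurvatureParam_transition
    (B := fun y ↦ dilatedMetric (K.chartMetric (ι p₀) y) (formChart K.form (ι p₀) y) ε)
    ((contDiffAt_chartExpr hf hs hs').of_le le_top) ?_ (hσ.of_le le_top) ?_
    (transition_comp_chartExpr hf.continuous hp) ?_ ?_ (Eventually.of_forall fun _ _ _ ↦ rfl)
    ?_ ?_ ?_
  · rw [hσx]
    exact (contDiffAt_chartExpr hf hp hfp).of_le le_top
  · rw [hx]
    exact hτ.of_le le_top
  · rw [injective_iff_map_eq_zero]
    refine (chartDiff_surjective (n := 2) hs).forall.2 fun u hu ↦ ?_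
    have h1 : chartDiff (n := 2) p₀ p u = 0 :=
      (chartDiff_eq_fderiv_transition (n := 2) hp u).trans hu
    rw [(injective_iff_map_eq_zero _).1 (chartDiff_injective (n := 2) hp) u h1, map_zero]
  · rw [hσx, hfx]
    have h1 : DifferentiableAt ℝ (fun y ↦ ContinuousLinearMap.smulRightL ℝ E3 (E3 →L[ℝ] ℝ)
        (formChart K.form (ι p₀) y) (formChart K.form (ι p₀) y))
        (extChartAt (𝓡 3) (ι p₀) (ι p)) := by
      have hw := hG.form.differentiableAt (by simp)
      exact (((ContinuousLinearMap.smulRightL ℝ E3 (E3 →L[ℝ] ℝ)).differentiableAt).comp _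
        hw).clm_apply hw
    exact (hG.metric.differentiableAt (by simp)).add (h1.const_smul ε⁻¹)
  · rw [hx]
    filter_upwards [eventually_symm_mem_source (n := 3) hfp] with y hy a b
    exact K.approxCoord_transition hy.1 hy.2 ε a b
  · rw [hσx, hfx]
    filter_upwards [hG.data] with y hy a b
    simp only [dilatedMetric_apply, hy.h_symm a b, mul_comm]
  · rw [hσx, hx]
    refine (chartDiff_surjective (n := 2) hp).forall.2 fun u ↦ ?_
    have h1 := hν u
    rw [K.approx_eq hfp, chartDiff_mfderiv hf hp hfp, chartDiff_eq_fderiv_transition hfp] at h1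
    rw [hfx]
    refine Eq.trans ?_ h1
    simp only [dilatedMetric_apply, hG.data.self_of_nhds.h_symm, mul_comm]

end Surface

/-! ### The sub-Riemannian mean curvature on the surface -/

section MeanCurvature

local notation "E2" => EuclideanSpace ℝ (Fin 2)
local notation "E3" => EuclideanSpace ℝ (Fin 3)

/-- Local integrability with respect to a smooth measure can be checked in charts. -/
theorem IsSmoothMeasure.integrableAtFilter_comp_chartAt {S : Type*} [TopologicalSpace S]
    [ChartedSpace E2 S] [MeasurableSpace S] [BorelSpace S] {σ : Measure S} (hσ : IsSmoothMeasure σ)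
    {p₀ : S} {F : E2 → ℝ} {U : Set E2} (hU : U ∈ 𝓝 (chartAt E2 p₀ p₀)) (hF : IntegrableOn F U) :
    IntegrableAtFilter (F ∘ chartAt E2 p₀) (𝓝 p₀) σ := by
  set e := chartAt E2 p₀
  have hp : p₀ ∈ e.source := mem_chart_source E2 p₀
  obtain ⟨ρ, hρ, -, hmap⟩ := hσ e (chart_mem_atlas E2 p₀)
  have hcont : ContinuousAt ρ (e p₀) :=
    (hρ.continuousOn.continuousAt (e.open_target.mem_nhds (e.map_source hp)))
  have hbd : ∀ᶠ x in 𝓝 (e p₀), ρ x < ρ (e p₀) + 1 := hcont.eventually_lt_const (lt_add_one _)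
  obtain ⟨V, hVsub, hVo, hV⟩ := mem_nhds_iff.1
    (inter_mem (inter_mem hU hbd) (e.open_target.mem_nhds (e.map_source hp)))
  have hae : AEMeasurable e (σ.restrict e.source) :=
    e.continuousOn.aemeasurable e.open_source.measurableSet
  -- On `V` the density is below `ρ (e p₀) + 1`, so the image measure is at most a constant times
  -- Lebesgue measure.
  have hle : ((σ.restrict e.source).map e).restrict V ≤
      ENNReal.ofReal (ρ (e p₀) + 1) • volume.restrict V := by
    rw [hmap, restrict_withDensity hVo.measurableSet,
      Measure.restrict_restrict_of_subset fun x hx ↦ (hVsub hx).2, ← withDensity_const]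
    refine withDensity_mono ((ae_restrict_iff' hVo.measurableSet).2 (ae_of_all _ fun x hx ↦ ?_))
    exact ENNReal.ofReal_le_ofReal (hVsub hx).1.2.le
  have hint : Integrable F (((σ.restrict e.source).map e).restrict V) :=
    ((hF.mono_set fun x hx ↦ (hVsub hx).1.1).integrable.smul_measure
      ENNReal.ofReal_ne_top).mono_measure hle
  rw [Measure.restrict_map_of_aemeasurable hae hVo.measurableSet,
    Measure.restrict_restrict' e.open_source.measurableSet] at hint
  refine ⟨e ⁻¹' V ∩ e.source, ?_, hint.comp_aemeasurable
    (hae.mono_measure (Measure.restrict_mono_set σ inter_subset_right))⟩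
  exact inter_mem ((e.continuousAt hp).preimage_mem_nhds (hVo.mem_nhds hV))
    (e.open_source.mem_nhds hp)

variable {M : Type*} [TopologicalSpace M] [ChartedSpace E3 M] [IsManifold (𝓡 3) ω M]
  (K : AnalyticContactStructure M) {S : Type*} [TopologicalSpace S] [ChartedSpace E2 S]
  [IsManifold (𝓡 2) ω S] {ι : S → M}

/-- Near each point of the surface, the mean curvatures converge at the points that are not
characteristic, and the limit is given by the chart formula. -/
theorem exists_srMeanCurvature_eq (hι : Manifold.IsSmoothEmbedding (𝓡 2) (𝓡 3) ω ι)
    (A : AreaForm S) (p₀ : S) {a c : E3}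
    (hac : ∀ᶠ y in 𝓝 (chartExpr (m := 2) (n := 3) ι p₀ (extChartAt (𝓡 2) p₀ p₀)),
      formChart K.form (ι p₀) y
          (horizontalPart (formChart K.form (ι p₀)) (K.chartReeb (ι p₀)) a y) = 0 ∧
      formChart K.form (ι p₀) y
          (horizontalPart (formChart K.form (ι p₀)) (K.chartReeb (ι p₀)) c y) = 0 ∧
      dForm (formChart K.form (ι p₀)) y
          (horizontalPart (formChart K.form (ι p₀)) (K.chartReeb (ι p₀)) a y)
          (horizontalPart (formChart K.form (ι p₀)) (K.chartReeb (ι p₀)) c y) ≠ 0) :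
    ∃ s : ℝ, ∀ᶠ p in 𝓝 p₀,
      srMeanCurvature K ι A p = -s * chartCurvature (formChart K.form (ι p₀))
        (K.chartMetric (ι p₀)) (K.chartReeb (ι p₀)) a c (chartExpr (m := 2) (n := 3) ι p₀)
        (extChartAt (𝓡 2) p₀ p) ∧
      (p ∉ charSet K ι → Tendsto (fun ε : ℝ ↦ meanCurvature K ι A ε p) (𝓝[>] 0)
        (𝓝 (srMeanCurvature K ι A p))) := by
  have hf := hι.isImmersion.contMDiff
  have hinj : ∀ p, Function.Injective (mfderiv (𝓡 2) (𝓡 3) ι p) := fun p ↦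
    mfderiv_injective_of_isImmersionAt (hι.isImmersion.isImmersionAt p)
  have hs := mem_extChartAt_source (I := 𝓡 2) p₀
  have hs' := mem_extChartAt_source (I := 𝓡 3) (ι p₀)
  -- `s` is the sign of the area form in the chart at `p₀`; by continuity it is the same at all
  -- nearby points, so a single `s` serves on a neighbourhood.
  obtain ⟨s, hs1, hsA⟩ : ∃ s : ℝ, s ^ 2 = 1 ∧ 0 < s * A.coeff p₀ (extChartAt (𝓡 2) p₀ p₀) := by
    rcases lt_or_gt_of_ne (A.coeff_ne_zero hs) with h | h
    · exact ⟨-1, by norm_num, by linarith⟩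
    · exact ⟨1, by norm_num, by linarith⟩
  refine ⟨s, ?_⟩
  have hx : chartExpr (m := 2) (n := 3) ι p₀ (extChartAt (𝓡 2) p₀ p₀) =
    extChartAt (𝓡 3) (ι p₀) (ι p₀) := chartExpr_apply hs
  have hG : IsContactGerm (formChart K.form (ι p₀)) (K.chartMetric (ι p₀)) (K.chartReeb (ι p₀))
      (chartExpr (m := 2) (n := 3) ι p₀ (extChartAt (𝓡 2) p₀ p₀)) := by
    rw [hx]
    exact K.isContactGerm (mem_extChartAt_target (ι p₀))
  have hlim := eventually_tendsto_meanCurvatureParam hG (contDiffAt_chartExpr hf hs hs')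
    (fderiv_chartExpr_injective hf (hinj p₀) hs hs') hac
  have hev : ∀ᶠ p in 𝓝 p₀, 0 < s * A.coeff p₀ (extChartAt (𝓡 2) p₀ p) :=
    ((A.continuousAt_coeff hs).const_mul s).eventually_const_lt hsA
  filter_upwards [eventually_mem_chart (m := 2) (n := 3) hf.continuous p₀, hev,
    (continuousAt_extChartAt (I := 𝓡 2) p₀).eventually hlim] with p ⟨hp, hfp⟩ hsp hp'
  have hchar := mem_charSet_iff K hf (hinj p) hp hfp
  by_cases h : p ∈ charSet K ι
  · have h0 := hchar.1 h
    refine ⟨?_, fun h' ↦ absurd h h'⟩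
    rw [srMeanCurvature, if_pos h, chartCurvature_eq_zero h0.1 h0.2, mul_zero]
  · obtain ⟨ν, hν, htend⟩ := hp' (mt hchar.2 h) s hs1
    have hmean : ∀ ε > 0, meanCurvature K ι A ε p = meanCurvatureParam
        (fun y u v ↦ dilatedMetric (K.chartMetric (ι p₀) y) (formChart K.form (ι p₀) y) ε u v)
        (chartExpr (m := 2) (n := 3) ι p₀) (extChartAt (𝓡 2) p₀ p) (ν ε) := fun ε hε ↦ by
      -- Uniqueness of the normal identifies the chosen unit normal with the explicit vector `ν ε`,
      -- along which the limit is known.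
      have hiff : ∀ v, IsUnitNormal K ι A ε p v ↔ chartDiff (n := 3) (ι p₀) (ι p) v = ν ε :=
        fun v ↦ (isUnitNormal_iff K A hf hp hfp hsp ε v).trans (hν ε hε _)
      have hu : IsUnitNormal K ι A ε p (unitNormal K ι A ε p) := by
        obtain ⟨v, hv⟩ := chartDiff_surjective (n := 3) hfp (ν ε)
        exact Classical.epsilon_spec ⟨v, (hiff v).2 hv⟩
      rw [← (hiff _).1 hu]
      exact meanCurvatureParam_chartExpr K hf hp hfp ε hu.1
    have htend' : Tendsto (fun ε : ℝ ↦ meanCurvature K ι A ε p) (𝓝[>] 0)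
        (𝓝 (-s * chartCurvature (formChart K.form (ι p₀))
          (K.chartMetric (ι p₀)) (K.chartReeb (ι p₀)) a c (chartExpr (m := 2) (n := 3) ι p₀)
          (extChartAt (𝓡 2) p₀ p))) :=
      htend.congr' (eventually_nhdsWithin_of_forall fun ε hε ↦ (hmean ε hε).symm)
    have heq : srMeanCurvature K ι A p = -s * chartCurvature (formChart K.form (ι p₀))
        (K.chartMetric (ι p₀)) (K.chartReeb (ι p₀)) a c (chartExpr (m := 2) (n := 3) ι p₀)
        (extChartAt (𝓡 2) p₀ p) := by
      rw [srMeanCurvature, if_neg h, htend'.limUnder_eq]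
    exact ⟨heq, fun _ ↦ heq ▸ htend'⟩

/-- A punctured neighbourhood property, in the preferred chart. -/
theorem eventually_nhdsNE_extChartAt_symm {p₀ : S} {P : S → Prop} (h : ∀ᶠ p in 𝓝[≠] p₀, P p) :
    ∀ᶠ x in 𝓝[≠] (extChartAt (𝓡 2) p₀ p₀), P ((extChartAt (𝓡 2) p₀).symm x) := by
  have h1 : Tendsto (extChartAt (𝓡 2) p₀).symm (𝓝 (extChartAt (𝓡 2) p₀ p₀)) (𝓝 p₀) := by
    have := (continuousAt_extChartAt_symm (I := 𝓡 2) p₀).tendsto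
    rwa [(extChartAt (𝓡 2) p₀).left_inv (mem_extChartAt_source (I := 𝓡 2) p₀)] at this
  have h0 : ∀ᶠ x in 𝓝 (extChartAt (𝓡 2) p₀ p₀), x ∈ (extChartAt (𝓡 2) p₀).target :=
    extChartAt_target_mem_nhds p₀
  rw [eventually_nhdsWithin_iff] at h ⊢
  filter_upwards [h1.eventually h, h0] with x hx hxt hne
  refine hx fun h2 ↦ hne ?_
  exact ((extChartAt (𝓡 2) p₀).right_inv hxt).symm.trans (congrArg _ h2)

/-- Near `p₀` the curvature is a constant multiple of the chart formula, whose integrability for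
Lebesgue measure passes to the smooth measure. -/
theorem integrableAtFilter_srMeanCurvature (hι : Manifold.IsSmoothEmbedding (𝓡 2) (𝓡 3) ω ι)
    (A : AreaForm S) [MeasurableSpace S] [BorelSpace S] {σ : Measure S} (hσ : IsSmoothMeasure σ)
    (hiso : ∀ p ∈ charSet K ι, ∀ᶠ q in 𝓝[≠] p, q ∉ charSet K ι) (p₀ : S) :
    IntegrableAtFilter (srMeanCurvature K ι A) (𝓝 p₀) σ := by
  have hf := hι.isImmersion.contMDiff
  have hinj : ∀ p, Function.Injective (mfderiv (𝓡 2) (𝓡 3) ι p) := fun p ↦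
    mfderiv_injective_of_isImmersionAt (hι.isImmersion.isImmersionAt p)
  have hs := mem_extChartAt_source (I := 𝓡 2) p₀
  have hs' := mem_extChartAt_source (I := 𝓡 3) (ι p₀)
  have hx : chartExpr (m := 2) (n := 3) ι p₀ (extChartAt (𝓡 2) p₀ p₀) =
    extChartAt (𝓡 3) (ι p₀) (ι p₀) := chartExpr_apply hs
  have hG : IsContactGerm (formChart K.form (ι p₀)) (K.chartMetric (ι p₀)) (K.chartReeb (ι p₀))
      (chartExpr (m := 2) (n := 3) ι p₀ (extChartAt (𝓡 2) p₀ p₀)) := by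
    rw [hx]
    exact K.isContactGerm (mem_extChartAt_target (ι p₀))
  obtain ⟨a, c, hac⟩ := hG.exists_frame
  obtain ⟨s, hev⟩ := exists_srMeanCurvature_eq K hι A p₀ hac
  obtain ⟨U, hU, hint⟩ := exists_integrableOn_chartCurvature hG (contDiffAt_chartExpr hf hs hs')
    -- Isolation of `p₀` among characteristic points becomes isolation of the common zero of the two
    -- components of the form.
    (fderiv_chartExpr_injective hf (hinj p₀) hs hs') hac fun h0 h1 ↦ by
      have hp₀ : p₀ ∈ charSet K ι := (mem_charSet_iff K hf (hinj p₀) hs hs').2 ⟨h0, h1⟩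
      have h0 : ∀ᶠ x in 𝓝 (extChartAt (𝓡 2) p₀ p₀), x ∈ (extChartAt (𝓡 2) p₀).target :=
        extChartAt_target_mem_nhds p₀
      filter_upwards [eventually_nhdsNE_extChartAt_symm (hiso p₀ hp₀),
        eventually_nhdsNE_extChartAt_symm ((eventually_mem_chart (m := 2) (n := 3)
          hf.continuous p₀).filter_mono nhdsWithin_le_nhds),
        h0.filter_mono nhdsWithin_le_nhds] with x hx1 hx2 hx3
      have := mt (mem_charSet_iff K hf (hinj _) hx2.1 hx2.2).2 hx1
      rwa [(extChartAt (𝓡 2) p₀).right_inv hx3] at this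
  obtain ⟨W, hW, hWint⟩ := hσ.integrableAtFilter_comp_chartAt (p₀ := p₀) hU (hint.const_mul (-s))
  obtain ⟨V, hVsub, hVo, hV⟩ := mem_nhds_iff.1 (inter_mem hW hev)
  refine ⟨V, hVo.mem_nhds hV, (hWint.mono_set fun p hp ↦ (hVsub hp).1).congr_fun
    (fun p hp ↦ ?_) hVo.measurableSet⟩
  exact (hVsub hp).2.1.symm

end MeanCurvature

end SubRiem

/-! ### Pointwise convergence and local integrability -/

theorem corollary1p9
    {M : Type*} [TopologicalSpace M] [T2Space M] [SecondCountableTopology M]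
    [ChartedSpace (EuclideanSpace ℝ (Fin 3)) M] [IsManifold (𝓡 3) ω M]
    (K : SubRiem.AnalyticContactStructure M)
    {S : Type*} [TopologicalSpace S] [ChartedSpace (EuclideanSpace ℝ (Fin 2)) S]
    [IsManifold (𝓡 2) ω S]
    (ι : S → M) (hι : Manifold.IsSmoothEmbedding (𝓡 2) (𝓡 3) ω ι)
    (A : SubRiem.AreaForm S)
    [MeasurableSpace S] [BorelSpace S]
    (σ : Measure S) (hσ : SubRiem.IsSmoothMeasure σ)
    (hiso : ∀ p ∈ SubRiem.charSet K ι, ∀ᶠ q in 𝓝[≠] p, q ∉ SubRiem.charSet K ι) :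
    (∀ p, p ∉ SubRiem.charSet K ι →
      Tendsto (fun ε : ℝ ↦ SubRiem.meanCurvature K ι A ε p) (𝓝[>] 0)
        (𝓝 (SubRiem.srMeanCurvature K ι A p))) ∧
    LocallyIntegrable (SubRiem.srMeanCurvature K ι A) σ := by
  refine ⟨fun p hp ↦ ?_, SubRiem.integrableAtFilter_srMeanCurvature K hι A hσ hiso⟩
  obtain ⟨a, c, hac⟩ := (K.isContactGerm (mem_extChartAt_target (ι p))).exists_frame
  rw [← SubRiem.chartExpr_apply (m := 2) (n := 3) (f := ι)
    (mem_extChartAt_source (I := 𝓡 2) p)] at hac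
  obtain ⟨s, hev⟩ := SubRiem.exists_srMeanCurvature_eq K hι A p hac
  -- The local statement is centred at `p` and evaluated at `p` itself.
  exact hev.self_of_nhds.2 hp
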